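/- Let $n\ge 2$, $\hbar,m_0,\tau>0$, $c_\hbar=\hbar^2/(2m_0)$, $X_k>0$, $J_k\in\mathbb N$, $J_k\ge1$, $h_k=X_k/J_k$ ($1\le k\le n$), and $0<X_0<X_1$ with $2h_1\le X_1-X_0$. Let $V(x)$ and $\widetilde V(x_1)$ be real potentials with $V(x)=V_\infty$ for $x\in[X_0,\infty)\times(0,X_2)\times\dots\times(0,X_n)$ and $\widetilde V(x_1)=V_\infty$ for $x_1\ge X_0$; put $\Delta V=V-\widetilde V$. Meshes. The nodes are $x_{\mathbf j}=(j_1h_1,\dots,j_nh_n)$. Let $\overline\omega_h=\{0\le j_k\le J_k\ \forall k\}$, $\omega_h=\{1\le j_k\le J_k-1\ \forall k\}$, $\Gamma_{1h}=\{j_1=J_1,\ 1\le j_k\le J_k-1\ (k\ge2)\}$, $\Gamma_h=(\overline\omega_h\setminus\omega_h)\setminus\Gamma_{1h}$. The norms are $$\|W\|_{\omega_h}^2=\sum_{\omega_h}|W_{\mathbf j}|^2h_1\cdots h_n,\qquad \|W\|_{\widetilde\omega_h}^2=\|W\|_{\omega_h}^2+h_1\sum_{\Gamma_{1h}}|W_{\mathbf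 j}|^2h_2\cdots h_n .$$ Operators. $\partial_k$ and $\bar\partial_k$ are the forward and backward difference quotients in direction $k$; $s_{Nk}W_j=\frac1{12}W_{j-1}+\frac56W_j+\frac1{12}W_{j+1}$ (in direction $k$); $s_{N1}^-W_j=\frac5{12}W_j+\frac1{12}W_{j-1}$ (in direction 1); $\overline s_N=s_{N1}\cdots s_{Nn}$, $\overline s_{N\widehat k}=\prod_{\ell\ne k}s_{N\ell}$, $\overline s_{N\widehat{1k}}=\prod_{\ell\ge2,\,\ell\ne k}s_{N\ell}$, $\bar\Delta_{hN}=\sum_{k=1}^n\overline s_{N\widehat k}\partial_k\bar\partial_k$. For $2\le k\le n$ let $(\mathcal F_kP)^{(q)}=\frac2{J_k}\sum_{j=1}^{J_k-1}P_j\sin\frac{\pi qj}{J_k}$ and $(\mathcal F_k^{-1}P)_j=\sum_{q=1}^{J_k-1}P^{(q)}\sin\frac{\pi qj}{J_k}$ be the sine transforms in direction $k$, $\lambda^{(k)}_q=\bigl(\frac2{h_k}\sin\frac{\pi qh_k}{2X_k}\bigr)^2$, $\sigma^{(k)}_q=1-\frac13\sin^2\frac{\pi qh_k}{2X_k}$.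 For real $v$ put $a=\frac v{2c_\hbar}+i\frac{\hbar}{\tau c_\hbar}$, $\alpha=2a+\frac23h_1^2a^2$ with $\arg\alpha\in(0,2\pi)$, $\beta=2\,\mathrm{Re}\,a+\frac23h_1^2|a|^2$, $c_1=-\frac{|\alpha|^{1/2}}2e^{-i(\arg\alpha)/2}$, $\varkappa=-e^{i\arg\alpha}$, $\mu=\beta/|\alpha|$, and define $R[v]$ by $R^0=c_1$, $R^1=-c_1\varkappa\mu$, $R^m=\frac{2m-3}m\varkappa\mu R^{m-1}-\frac{m-3}m\varkappa^2R^{m-2}$ for $m\ge2$. For $\mathbf q=(q_2,\dots,q_n)$ let $R_{\mathbf q}=R\bigl[V_\infty+c_\hbar\sum_{k=2}^n\lambda^{(k)}_{q_k}/\sigma^{(k)}_{q_k}\bigr]$. For functions $\Phi^0=0,\Phi^1,\Phi^2,\dots$ on $\Gamma_{1h}$ put $$\mathcal S^m_{\rm ref}\mathbf\Phi^m=\mathcal F_2^{-1}\cdots\mathcal F_n^{-1}\Bigl[\sigma^{(2)}_{q_2}\cdots\sigma^{(n)}_{q_n}\sum_{p=0}^mR^p_{\mathbf q}\,(\mathcal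 F_n\cdots\mathcal F_2\Phi^{m-p})^{\mathbf q}\Bigr].$$ Scheme. Let $\Psi^0_h:\overline\omega_h\to\mathbb C$ satisfy $\Psi^0_h|_{\Gamma_h}=0$ and $\Psi^0_h|_{j_1=J_1-1,\,J_1}=0$, and let $F^m:\omega_h\to\mathbb C$, $m\ge1$. A solution consists of mesh functions $\Psi^m$ ($m\ge0$), $\breve\Psi^m,\widetilde\Psi^m$ ($m\ge1$) on $\overline\omega_h$ with $\Psi^0=\Psi^0_h$ on $\overline\omega_h$ and, for all $m\ge1$, $$i\hbar\frac{\breve\Psi^m-\Psi^{m-1}}{\tau/2}=\Delta V\frac{\breve\Psi^m+\Psi^{m-1}}2\ \text{ on }\omega_h\cup\Gamma_{1h},$$ $$i\hbar\,\overline s_N\frac{\widetilde\Psi^m-\breve\Psi^m}\tau=-c_\hbar\bar\Delta_{hN}\frac{\widetilde\Psi^m+\breve\Psi^m}2+\overline s_N\Bigl(\widetilde V\frac{\widetilde\Psi^m+\breve\Psi^m}2\Bigr)+F^m\ \text{ on }\omega_h,$$ $$i\hbar\frac{\Psi^m-\widetilde\Psi^m}{\tau/2}=\Delta V\frac{\Psi^m+\widetilde\Psi^m}2\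 \text{ on }\omega_h\cup\Gamma_{1h},$$ $$\breve\Psi^m|_{\Gamma_h}=\widetilde\Psi^m|_{\Gamma_h}=\Psi^m|_{\Gamma_h}=0,$$ and the discrete transparent boundary condition, on $\Gamma_{1h}$, $$c_\hbar\overline s_{N\widehat1}\bar\partial_1\frac{\widetilde\Psi^m+\breve\Psi^m}2-h_1s_{N1}^-\Bigl\{i\hbar\,\overline s_{N\widehat1}\frac{\widetilde\Psi^m-\breve\Psi^m}\tau+\Bigl[c_\hbar\sum_{k=2}^n\overline s_{N\widehat{1k}}\partial_k\bar\partial_k-V_\infty\overline s_{N\widehat1}\Bigr]\frac{\widetilde\Psi^m+\breve\Psi^m}2\Bigr\}=c_\hbar\mathcal S^m_{\rm ref}\widetilde{\mathbf\Psi}^m_{J_1},$$ where $\widetilde{\mathbf\Psi}^m_{J_1}=\{0,\widetilde\Psi^1,\dots,\widetilde\Psi^m\}|_{j_1=J_1}$. Claim. Without any restriction on $\tau>0$, the scheme has a solution, the solution is unique, and it satisfies $$\max_{0\le m\le M}\|\Psi^m\|_{\widetilde\omega_h}\le\|\Psi^0_h\|_{\widetilde\omega_h}+\frac2\hbar\Bigl(\frac32\Bigr)^n\sum_{m=1}^M\|F^m\|_{\omega_h}\tau\quad\text{for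 any }M\ge1.$$ In particular, if $F=0$ then $\|\Psi^m\|_{\widetilde\omega_h}\le\|\Psi^0_h\|_{\widetilde\omega_h}$ for all $m\ge 0$. -/

import Mathlib

/-- A grid function of `n` integer indices. A mesh function on a finite mesh is represented by such
a function, of which only the values at the nodes of the mesh are relevant. -/
abbrev GridFun (n : ℕ) : Type := (Fin n → ℤ) → ℂ

/-- The data of the problem and of the meshes. Direction `0` is the leading axis `x₁`. -/
structure SplittingData (n : ℕ) where
  /-- the physical constant `ħ` -/
  hbar : ℝ
  /-- the physical constant `m₀` -/
  m0 : ℝ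
  /-- `X k` is the length of the computational domain in direction `k` -/
  X : Fin n → ℝ
  /-- `J k` is the number of mesh intervals in direction `k` -/
  J : Fin n → ℕ
  /-- the potential is constant for `x₁ ≥ X0` -/
  X0 : ℝ
  /-- the real potential `V(x)` -/
  V : (Fin n → ℝ) → ℝ
  /-- the auxiliary one-dimensional real potential `Ṽ(x₁)` -/
  Vaux : ℝ → ℝ
  /-- the constant value of the potential at infinity -/
  Vinf : ℝ
  /-- the step of the uniform time mesh -/
  tau : ℝ

namespace SplittingData

noncomputable section

variable {n : ℕ}

/-- `c_ħ = ħ² / (2 m₀)`. -/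
def c (D : SplittingData n) : ℝ := D.hbar ^ 2 / (2 * D.m0)

/-- The space steps `h_k = X_k / J_k`. -/
def h (D : SplittingData n) (k : Fin n) : ℝ := D.X k / D.J k

/-- The node `x_j = (j₁ h₁, …, j_n h_n)`. -/
def node (D : SplittingData n) (j : Fin n → ℤ) : Fin n → ℝ := fun k => (j k : ℝ) * D.h k

/-! ### Meshes (as sets of multi-indices) -/

/-- The finite mesh `ω̄_h`: `0 ≤ j_k ≤ J_k` for all `k`. -/
def meshClosed (D : SplittingData n) : Finset (Fin n → ℤ) :=
  Fintype.piFinset fun k => Finset.Icc (0 : ℤ) (D.J k)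

/-- The internal part `ω_h`: `1 ≤ j_k ≤ J_k - 1` for all `k`. -/
def meshInner (D : SplittingData n) : Finset (Fin n → ℤ) :=
  Fintype.piFinset fun k => Finset.Icc (1 : ℤ) ((D.J k : ℤ) - 1)

/-- The artificial boundary `Γ_{1h}`: `j₁ = J₁` and `1 ≤ j_k ≤ J_k - 1` for the other `k`. -/
def meshGamma1 [NeZero n] (D : SplittingData n) : Finset (Fin n → ℤ) :=
  Fintype.piFinset fun k =>
    if k = 0 then {(D.J k : ℤ)} else Finset.Icc (1 : ℤ) ((D.J k : ℤ) - 1)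

/-- The rest `Γ_h` of the boundary: `(ω̄_h \ ω_h) \ Γ_{1h}`. -/
def meshGamma [NeZero n] (D : SplittingData n) : Finset (Fin n → ℤ) :=
  (D.meshClosed \ D.meshInner) \ D.meshGamma1

/-! ### Difference operators -/

/-- The backward difference quotient `∂̄_k`. -/
def bdiff (D : SplittingData n) (k : Fin n) : Module.End ℂ (GridFun n) where
  toFun W := fun j => (W j - W (j - Pi.single k 1)) / (D.h k : ℂ)
  map_add' U W := by funext j; simp only [Pi.add_apply]; ring
  map_smul' a W := by
    funext j; simp only [Pi.smul_apply, smul_eq_mul, RingHom.id_apply]; ring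

/-- The forward difference quotient `∂_k`. -/
def fdiff (D : SplittingData n) (k : Fin n) : Module.End ℂ (GridFun n) where
  toFun W := fun j => (W (j + Pi.single k 1) - W j) / (D.h k : ℂ)
  map_add' U W := by funext j; simp only [Pi.add_apply]; ring
  map_smul' a W := by
    funext j; simp only [Pi.smul_apply, smul_eq_mul, RingHom.id_apply]; ring

/-- The Numerov average `s_{Nk}`. -/
def sN (k : Fin n) : Module.End ℂ (GridFun n) where
  toFun W := fun j =>
    (1 / 12 : ℂ) * W (j - Pi.single k 1) + (5 / 6 : ℂ) * W j + (1 / 12 : ℂ) * W (j + Pi.single k 1)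
  map_add' U W := by funext j; simp only [Pi.add_apply]; ring
  map_smul' a W := by
    funext j; simp only [Pi.smul_apply, smul_eq_mul, RingHom.id_apply]; ring

/-- The one-sided average `s_{N1}⁻` in the direction `x₁`. -/
def sNminus [NeZero n] : Module.End ℂ (GridFun n) where
  toFun W := fun j => (5 / 12 : ℂ) * W j + (1 / 12 : ℂ) * W (j - Pi.single 0 1)
  map_add' U W := by funext j; simp only [Pi.add_apply]; ring
  map_smul' a W := by
    funext j; simp only [Pi.smul_apply, smul_eq_mul, RingHom.id_apply]; ring

/-- The composition of the Numerov averages `s_{Nℓ}` over all directions `ℓ` outside the set `E`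
(they commute with each other, so the order is immaterial). -/
def sNprod (E : Finset (Fin n)) : Module.End ℂ (GridFun n) :=
  (((List.finRange n).filter fun l => decide (l ∉ E)).map sN).prod

/-- `Δ̄_{hN} = ∑_k s̄_{N k̂} ∂_k ∂̄_k`, with `s̄_{N k̂}` the product of `s_{Nℓ}` over `ℓ ≠ k`. -/
def lapN (D : SplittingData n) : Module.End ℂ (GridFun n) :=
  ∑ k : Fin n, sNprod {k} * (D.fdiff k * D.bdiff k)

/-! ### Discrete sine transforms and the convolution kernel -/

/-- The direct discrete Fourier sine transform in direction `k`; in the result the `k`-th index is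
the frequency `q_k`, and the other indices are parameters. -/
def dst (D : SplittingData n) (k : Fin n) : Module.End ℂ (GridFun n) where
  toFun P := fun q => (2 / (D.J k : ℂ)) * ∑ i ∈ Finset.Icc (1 : ℤ) ((D.J k : ℤ) - 1),
    P (Function.update q k i) * (Real.sin (Real.pi * q k * i / D.J k) : ℂ)
  map_add' U W := by
    funext q; simp only [Pi.add_apply, add_mul, Finset.sum_add_distrib, mul_add]
  map_smul' a W := by
    funext q
    simp only [Pi.smul_apply, smul_eq_mul, RingHom.id_apply, mul_assoc, ← Finset.mul_sum]
    ring

/-- The inverse discrete Fourier sine transform in direction `k`. -/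
def idst (D : SplittingData n) (k : Fin n) : Module.End ℂ (GridFun n) where
  toFun P := fun j => ∑ q ∈ Finset.Icc (1 : ℤ) ((D.J k : ℤ) - 1),
    P (Function.update j k q) * (Real.sin (Real.pi * q * j k / D.J k) : ℂ)
  map_add' U W := by
    funext q; simp only [Pi.add_apply, add_mul, Finset.sum_add_distrib]
  map_smul' a W := by
    funext q
    simp only [Pi.smul_apply, smul_eq_mul, RingHom.id_apply, mul_assoc, ← Finset.mul_sum]

/-- The directions perpendicular to the leading axis, in increasing order. -/
def perp (n : ℕ) [NeZero n] : List (Fin n) :=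
  (List.finRange n).filter fun k => decide (k ≠ 0)

/-- `λ_q^{(k)} = ((2 / h_k) sin (π q h_k / (2 X_k)))²`. -/
def lam (D : SplittingData n) (k : Fin n) (q : ℤ) : ℝ :=
  (2 / D.h k * Real.sin (Real.pi * q * D.h k / (2 * D.X k))) ^ 2

/-- `σ_q^{(k)} = 1 - (1 / 3) sin² (π q h_k / (2 X_k))`. -/
def sig (D : SplittingData n) (k : Fin n) (q : ℤ) : ℝ :=
  1 - 1 / 3 * Real.sin (Real.pi * q * D.h k / (2 * D.X k)) ^ 2

/-- `V_{∞,q} = V_∞ + c_ħ ∑_{k ≥ 2} λ_{q_k}^{(k)} / σ_{q_k}^{(k)}`. -/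
def VinfQ [NeZero n] (D : SplittingData n) (q : Fin n → ℤ) : ℝ :=
  D.Vinf + D.c * ∑ k ∈ Finset.univ.filter (fun k : Fin n => k ≠ 0), D.lam k (q k) / D.sig k (q k)

/-- The argument of a complex number with values in `[0, 2π)`. -/
def argPos (z : ℂ) : ℝ := if z.arg < 0 then z.arg + 2 * Real.pi else z.arg

/-- `a = v / (2 c_ħ) + i ħ / (τ c_ħ)`. -/
def aCoef (D : SplittingData n) (v : ℝ) : ℂ :=
  ((v / (2 * D.c) : ℝ) : ℂ) + Complex.I * ((D.hbar / (D.tau * D.c) : ℝ) : ℂ)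

/-- `α = 2 a + (2 / 3) h₁² a²`. -/
def alpha [NeZero n] (D : SplittingData n) (v : ℝ) : ℂ :=
  2 * D.aCoef v + (2 / 3 : ℂ) * (D.h 0 : ℂ) ^ 2 * D.aCoef v ^ 2

/-- `β = 2 Re a + (2 / 3) h₁² |a|²`. -/
def beta [NeZero n] (D : SplittingData n) (v : ℝ) : ℝ :=
  2 * (D.aCoef v).re + 2 / 3 * D.h 0 ^ 2 * ‖D.aCoef v‖ ^ 2

/-- `c₁ = -(|α|^{1/2} / 2) exp(-i (arg α) / 2)`. -/
def c1 [NeZero n] (D : SplittingData n) (v : ℝ) : ℂ :=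
  -((Real.sqrt ‖D.alpha v‖ / 2 : ℝ) : ℂ) *
    Complex.exp (-(Complex.I * ((argPos (D.alpha v) / 2 : ℝ) : ℂ)))

/-- `ϰ = -exp(i arg α)`. -/
def kap [NeZero n] (D : SplittingData n) (v : ℝ) : ℂ :=
  -Complex.exp (Complex.I * (argPos (D.alpha v) : ℂ))

/-- `μ = β / |α|`. -/
def mu [NeZero n] (D : SplittingData n) (v : ℝ) : ℝ := D.beta v / ‖D.alpha v‖

/-- The kernel `R[v]`, by its three-term recurrence. -/
def kernelR [NeZero n] (D : SplittingData n) (v : ℝ) : ℕ → ℂ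
  | 0 => D.c1 v
  | 1 => -(D.c1 v * D.kap v * (D.mu v : ℂ))
  | m + 2 =>
      (2 * ((m + 2 : ℕ) : ℂ) - 3) / ((m + 2 : ℕ) : ℂ) * D.kap v * (D.mu v : ℂ) *
          D.kernelR v (m + 1)
        - (((m + 2 : ℕ) : ℂ) - 3) / ((m + 2 : ℕ) : ℂ) * D.kap v ^ 2 * D.kernelR v m

/-- The operator of the discrete TBC,
`S_ref^m Φ = F₂⁻¹ … F_n⁻¹ [σ_{q₂} … σ_{q_n} (R_q * Φ^q)^m]`, with `Φ^q = (F_n … F₂ Φ)^q`.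
The first index is only a parameter: the values on `j₁ = J₁` depend only on the trace of `Φ` there. -/
def Sref [NeZero n] (D : SplittingData n) (m : ℕ) (Φ : ℕ → GridFun n) : GridFun n :=
  ((perp n).map D.idst).prod fun q =>
    (∏ k ∈ Finset.univ.filter (fun k : Fin n => k ≠ 0), (D.sig k (q k) : ℂ)) *
      ∑ p ∈ Finset.range (m + 1),
        D.kernelR (D.VinfQ q) p * ((perp n).reverse.map D.dst).prod (Φ (m - p)) q

/-! ### The scheme -/

/-- `(U - W) / τ`. -/
def tdiff (D : SplittingData n) (U W : GridFun n) : GridFun n := fun j => (U j - W j) / (D.tau : ℂ)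

/-- `(U + W) / 2`. -/
def avg (U W : GridFun n) : GridFun n := fun j => (U j + W j) / 2

/-- `ΔV = V - Ṽ` at the nodes. -/
def dV [NeZero n] (D : SplittingData n) (j : Fin n → ℤ) : ℝ :=
  D.V (D.node j) - D.Vaux (D.node j 0)

/-- The left-hand side `D_{1h}(U, W)` of the discrete TBC. -/
def tbcLeft [NeZero n] (D : SplittingData n) (U W : GridFun n) : GridFun n :=
  (D.c : ℂ) • sNprod {0} (D.bdiff 0 (avg U W))
    - (D.h 0 : ℂ) • sNminus
        ((Complex.I * (D.hbar : ℂ)) • sNprod {0} (D.tdiff U W)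
          + ((D.c : ℂ) • (∑ k ∈ Finset.univ.filter (fun k : Fin n => k ≠ 0),
                sNprod {0, k} (D.fdiff k (D.bdiff k (avg U W))))
              - (D.Vinf : ℂ) • sNprod {0} (avg U W)))

/-- `(Ψ̆, Ψ̃, Ψ) = (Pb, Pt, P)` is a solution of the splitting scheme with the discrete TBC on the
finite mesh, with initial function `P0` and free term `F`. The auxiliary functions `Pb m`, `Pt m`
and the free term `F m` are meaningful for `m ≥ 1` only; in the convolution of the TBC the zeroth
term is zero. -/
structure IsSolution [NeZero n] (D : SplittingData n) (P0 : GridFun n) (F : ℕ → GridFun n)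
    (Pb Pt P : ℕ → GridFun n) : Prop where
  /-- the first half-step in the potential, on `ω_h ∪ Γ_{1h}` -/
  step1 : ∀ m ≥ 1, ∀ j ∈ D.meshInner ∪ D.meshGamma1,
    Complex.I * (D.hbar : ℂ) * ((Pb m j - P (m - 1) j) / ((D.tau : ℂ) / 2))
      = (D.dV j : ℂ) * ((Pb m j + P (m - 1) j) / 2)
  /-- the main equation, on `ω_h` -/
  step2 : ∀ m ≥ 1, ∀ j ∈ D.meshInner,
    Complex.I * (D.hbar : ℂ) * sNprod ∅ (D.tdiff (Pt m) (Pb m)) j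
      = -(D.c : ℂ) * D.lapN (avg (Pt m) (Pb m)) j
        + sNprod ∅ (fun i => (D.Vaux (D.node i 0) : ℂ) * avg (Pt m) (Pb m) i) j
        + F m j
  /-- the second half-step in the potential, on `ω_h ∪ Γ_{1h}` -/
  step3 : ∀ m ≥ 1, ∀ j ∈ D.meshInner ∪ D.meshGamma1,
    Complex.I * (D.hbar : ℂ) * ((P m j - Pt m j) / ((D.tau : ℂ) / 2))
      = (D.dV j : ℂ) * ((P m j + Pt m j) / 2)
  /-- the homogeneous Dirichlet conditions on `Γ_h` -/
  dirichlet : ∀ m ≥ 1, ∀ j ∈ D.meshGamma, Pb m j = 0 ∧ Pt m j = 0 ∧ P m j = 0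
  /-- the discrete transparent boundary condition, on `Γ_{1h}` -/
  tbc : ∀ m ≥ 1, ∀ j ∈ D.meshGamma1,
    D.tbcLeft (Pt m) (Pb m) j = (D.c : ℂ) * D.Sref m (Function.update Pt 0 0) j
  /-- the initial condition, on `ω̄_h` -/
  initial : ∀ j ∈ D.meshClosed, P 0 j = P0 j

/-! ### Mesh norms -/

/-- The mesh norm `‖·‖_{ω_h}`. -/
def normInner (D : SplittingData n) (W : GridFun n) : ℝ :=
  Real.sqrt (∑ j ∈ D.meshInner, ‖W j‖ ^ 2 * ∏ k, D.h k)

/-- The mesh norm `‖·‖_{ω̃_h}`, where `‖W‖² = ‖W‖²_{ω_h} + ‖W_{J₁}‖²_{ω_{h1̂}} h₁`. -/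
def normTilde [NeZero n] (D : SplittingData n) (W : GridFun n) : ℝ :=
  Real.sqrt ((∑ j ∈ D.meshInner, ‖W j‖ ^ 2 * ∏ k, D.h k) +
    (∑ j ∈ D.meshGamma1,
      ‖W j‖ ^ 2 * ∏ k ∈ Finset.univ.filter (fun k : Fin n => k ≠ 0), D.h k) * D.h 0)

end

end SplittingData

/-! The discrete transparent boundary condition is an exact condition. A mesh function that
satisfies it is, mode by mode, the restriction of a square summable solution on the half-line. On
the half-line the Crank-Nicolson step obeys a plain energy estimate, so the norm on the finite mesh
is controlled once the energy of the continuation beyond `Γ_{1h}` is added to it.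

The half-steps in the potential multiply pointwise by unimodular numbers, so they preserve the mesh
norm. On the layers `j₁ = J₁ - 1, J₁`, where `ΔV = 0`, they are the identity; there the lower level
of each step is the upper level of the previous one. The middle step has coefficients depending only
on `x₁`. Products of sines in the other directions diagonalize it (`main_equation_iff`, `tbc_iff`),
the potential of mode `q` being `Ṽ + c_ħ ∑ λ/σ` and its free term being divided by `∏ σ`.

For one mode, pass to generating functions in time. With `u = (1+X)/2` and `w = ā + aX`, the
constant-coefficient scheme has in space the characteristic equation `r ν² - 2 p ν + r = 0`, where
`r = u/h - hw/12` and `p = u/h + 5hw/12`. The three-term recurrence says that the generating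
function `R` of the kernel is a square root of `p² - r²` (`PowerSeries.mk_sq_of_recurrence`,
`mk_kernelR_sq`), and the branch of the argument in `c₁` makes `ν = (p + R)/r` the root with `|ν(0)|
< 1` (`exists_decaying_root`). The boundary condition reads `r Φ_{J-1} = (p - R) Φ_J`, that is `Φ_J
= ν Φ_{J-1}`. Hence `ν^k Φ_{J-1}` continues the solution, and each of its time coefficients is
square summable in `k` (`ModeTBC.exists_continuation`).

The energy estimate (`norm_le_of_averaged_step`) writes the Numerov average as `1 - T` with `T`
symmetric and `‖T‖ ≤ 1/3`, and tests the equation with `(1 - T)⁻¹(f + g)`. The terms with the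
Laplacian and the potential are then real and drop out. Applied to the glued function it gives
`ModeTBC.exists_tail_energy`; Parseval and Minkowski sum it over the modes
(`IsSolution.exists_energy`).

For zero data the same estimate makes the linear system of one mode at one level injective, hence
solvable (`exists_mode_step`), which gives existence level by level. Uniqueness is the stability
bound applied to a difference of solutions. -/

open scoped ComplexConjugate InnerProductSpace

/-! ### Energy estimate in a Hilbert space. -/

/-- Energy estimate for one step of the Crank-Nicolson scheme in a Hilbert space, with the averaging
operator `1 - T`. -/
theorem norm_le_of_averaged_step {H : Type*} [NormedAddCommGroup H] [InnerProductSpace ℂ H]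
    [CompleteSpace H] (T : H →L[ℂ] H) (hT : ∀ x y, ⟪T x, y⟫_ℂ = ⟪x, T y⟫_ℂ) (hn : ‖T‖ ≤ 1 / 3)
    {k b : ℝ} (hk : 0 < k) {f g z G : H} (hz : (⟪f + g, z⟫_ℂ).im = 0)
    (heq : (Complex.I * k) • ((f - g) - T (f - g)) = (b : ℂ) • T (f + g) + (z - T z) + G) :
    ‖f‖ ≤ ‖g‖ + 3 / (2 * k) * ‖G‖ := by
  have hT1 : ‖T‖ < 1 := by linarith
  let S := Units.oneSub T hT1
  -- The test element is `Y = (1 - T)⁻¹(f + g)`: by symmetry of `T`, pairing it with `(1 - T) x`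
  -- gives `⟪f + g, x⟫`, which removes the average from the equation.
  obtain ⟨Y, hY⟩ : ∃ Y, Y - T Y = f + g := by
    refine ⟨(↑S⁻¹ : H →L[ℂ] H) (f + g), ?_⟩
    have h1 : (S : H →L[ℂ] H) * (↑S⁻¹ : H →L[ℂ] H) = 1 := Units.mul_inv S
    have h2 := congrArg (fun A : H →L[ℂ] H => A (f + g)) h1
    simpa [S, Units.val_oneSub] using h2
  have hYn : ‖Y‖ ≤ 3 / 2 * ‖f + g‖ := by
    have h1 : ‖T Y‖ ≤ 1 / 3 * ‖Y‖ := T.le_of_opNorm_le hn Y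
    have h2 : ‖Y‖ ≤ ‖f + g‖ + ‖T Y‖ := by
      have : Y = (f + g) + T Y := by rw [← hY]; abel
      calc ‖Y‖ = ‖(f + g) + T Y‖ := by rw [← this]
        _ ≤ _ := norm_add_le _ _
    linarith
  have hS : ∀ x, ⟪Y, x - T x⟫_ℂ = ⟪f + g, x⟫_ℂ := fun x => by
    rw [← hY, inner_sub_right, inner_sub_left, hT]
  have hreal : ∀ x, (⟪x, T x⟫_ℂ).im = 0 := fun x => by
    have h1 := inner_conj_symm (𝕜 := ℂ) x (T x)
    rw [hT] at h1
    exact Complex.conj_eq_iff_im.mp h1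
  -- `T` commutes with `1 - T`, so this product is `⟪Y, T Y⟫ - ⟪T Y, T Y⟫`, a real number.
  have hTY : (⟪Y, T (f + g)⟫_ℂ).im = 0 := by
    rw [← hY, map_sub, inner_sub_right, Complex.sub_im, hreal, ← hT Y (T Y)]
    have : (⟪T Y, T Y⟫_ℂ).im = 0 := inner_self_im (𝕜 := ℂ) (T Y)
    rw [this]; simp
  have h1 := congrArg (fun x => (⟪Y, x⟫_ℂ).im) heq
  simp only [inner_smul_right, inner_add_right, hS] at h1
  rw [Complex.add_im, Complex.add_im, hz, Complex.im_ofReal_mul, hTY, mul_zero, zero_add, zero_add,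
    mul_assoc, Complex.I_mul_im, Complex.re_ofReal_mul] at h1
  have h2 : (⟪f + g, f - g⟫_ℂ).re = ‖f‖ ^ 2 - ‖g‖ ^ 2 := by
    rw [inner_add_left, inner_sub_right, inner_sub_right, inner_self_eq_norm_sq_to_K,
      inner_self_eq_norm_sq_to_K]
    have h3 : (⟪f, g⟫_ℂ).re = (⟪g, f⟫_ℂ).re := by rw [← inner_conj_symm f g, Complex.conj_re]
    simp [← Complex.ofReal_pow, h3]
  have h3 : (⟪Y, G⟫_ℂ).im ≤ ‖Y‖ * ‖G‖ :=
    (Complex.abs_im_le_norm _ |>.trans' (le_abs_self _)).trans (norm_inner_le_norm _ _)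
  have h4 : ‖Y‖ * ‖G‖ ≤ 3 / 2 * (‖f‖ + ‖g‖) * ‖G‖ := by
    have := norm_add_le f g
    gcongr
    linarith
  rw [h2] at h1
  -- The estimate so far is quadratic; a factor `‖f‖ + ‖g‖` is cancelled unless it vanishes, when
  -- nothing is left to prove.
  rcases (add_nonneg (norm_nonneg f) (norm_nonneg g)).eq_or_lt with h0 | h0
  · have : 0 ≤ 3 / (2 * k) * ‖G‖ := by positivity
    linarith [norm_nonneg f, norm_nonneg g]
  · have h5 : (k * (‖f‖ - ‖g‖)) * (‖f‖ + ‖g‖) ≤ (3 / 2 * ‖G‖) * (‖f‖ + ‖g‖) := by linarith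
    have h6 := le_of_mul_le_mul_right h5 h0
    have h7 : 3 / (2 * k) * ‖G‖ = (3 / 2 * ‖G‖) / k := by field_simp
    have h8 : ‖f‖ - ‖g‖ ≤ (3 / 2 * ‖G‖) / k := by
      rw [le_div_iff₀ hk]; linarith
    linarith

/-! ### The Numerov scheme on the half-line. -/

/-- The Hilbert space of square summable sequences. -/
abbrev EllTwo : Type := lp (fun _ : ℕ => ℂ) 2

theorem EllTwo.norm_eq (x : EllTwo) : ‖x‖ = Real.sqrt (∑' i, ‖x i‖ ^ 2) := by
  rw [lp.norm_eq_tsum_rpow (by norm_num), Real.sqrt_eq_rpow]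
  norm_num

theorem memℓp_two_iff {f : ℕ → ℂ} : Memℓp f 2 ↔ Summable fun i => ‖f i‖ ^ 2 := by
  rw [memℓp_gen_iff (by norm_num)]
  norm_num

/-- The right shift of a sequence. -/
def shiftSeq (x : ℕ → ℂ) : ℕ → ℂ
  | 0 => 0
  | i + 1 => x i

theorem summable_shiftSeq {x : ℕ → ℂ} (hx : Summable fun i => ‖x i‖ ^ 2) :
    Summable fun i => ‖shiftSeq x i‖ ^ 2 :=
  (summable_nat_add_iff 1).mp hx

/-- The right shift on square summable sequences. -/
noncomputable def shiftRight : EllTwo →L[ℂ] EllTwo :=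
  LinearMap.mkContinuous
    { toFun := fun x => ⟨shiftSeq x, memℓp_two_iff.mpr
        (summable_shiftSeq (memℓp_two_iff.mp (lp.memℓp x)))⟩
      map_add' := fun x y => by
        ext i
        cases i
        · exact (add_zero (0 : ℂ)).symm
        · rfl
      map_smul' := fun a x => by
        ext i; cases i <;> simp [shiftSeq] } 1 fun x => by
    have hx := memℓp_two_iff.mp (lp.memℓp x)
    rw [one_mul, EllTwo.norm_eq, EllTwo.norm_eq]
    refine Real.sqrt_le_sqrt (le_of_eq ?_)
    refine (((summable_shiftSeq hx).tsum_eq_zero_add).trans ?_)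
    simp [shiftSeq]

theorem shiftRight_apply (x : EllTwo) (i : ℕ) : shiftRight x i = shiftSeq x i := rfl

theorem norm_shiftRight_le : ‖shiftRight‖ ≤ 1 := LinearMap.mkContinuous_norm_le _ zero_le_one _

/-- Entries are inner products with unit vectors, and the right shift moves the `i`-th unit vector
to the next one. -/
theorem adjoint_shiftRight_apply (x : EllTwo) (i : ℕ) :
    ContinuousLinearMap.adjoint shiftRight x i = x (i + 1) := by
  have h1 : ∀ (y : EllTwo) (j : ℕ), ⟪lp.single 2 j (1 : ℂ), y⟫_ℂ = y j := fun y j => by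
    rw [lp.inner_single_left]; simp
  rw [← h1, ContinuousLinearMap.adjoint_inner_right, ← h1]
  congr 1
  ext j
  rw [shiftRight_apply]
  cases j with
  | zero => simp [shiftSeq, lp.single_apply]
  | succ j => simp [shiftSeq, lp.single_apply, Pi.single_apply]

/-- Minus one twelfth of the second difference, with the zero value at the origin. -/
noncomputable def secondDiffPart : EllTwo →L[ℂ] EllTwo :=
  (1 / 12 : ℂ) • ((2 : ℂ) • ContinuousLinearMap.id ℂ EllTwo - shiftRight
    - ContinuousLinearMap.adjoint shiftRight)

/-- The bound is `(2 + 1 + 1) / 12`, both shifts being contractions. It is the source of the factor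
`3/2 = (1 - 1/3)⁻¹` for the inverse of the Numerov average. -/
theorem norm_secondDiffPart_le : ‖secondDiffPart‖ ≤ 1 / 3 := by
  have h1 : ‖ContinuousLinearMap.adjoint shiftRight‖ ≤ 1 := by
    rw [LinearIsometryEquiv.norm_map]; exact norm_shiftRight_le
  have h2 : ‖(2 : ℂ) • ContinuousLinearMap.id ℂ EllTwo‖ ≤ 2 := by
    rw [norm_smul]
    have := ContinuousLinearMap.norm_id_le (𝕜 := ℂ) (E := EllTwo)
    norm_num
    linarith
  rw [secondDiffPart, norm_smul]
  have h3 := norm_sub_le ((2 : ℂ) • ContinuousLinearMap.id ℂ EllTwo - shiftRight)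
    (ContinuousLinearMap.adjoint shiftRight)
  have h4 := norm_sub_le ((2 : ℂ) • ContinuousLinearMap.id ℂ EllTwo) shiftRight
  have h5 := norm_shiftRight_le
  norm_num
  linarith

theorem secondDiffPart_symm (x y : EllTwo) :
    ⟪secondDiffPart x, y⟫_ℂ = ⟪x, secondDiffPart y⟫_ℂ := by
  simp only [secondDiffPart, smul_apply, sub_apply,
    ContinuousLinearMap.id_apply, inner_smul_left, inner_smul_right, inner_sub_left,
    inner_sub_right, ContinuousLinearMap.adjoint_inner_left,
    ContinuousLinearMap.adjoint_inner_right]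
  simp only [map_div₀, map_one, map_ofNat]
  ring

theorem secondDiffPart_apply (x : EllTwo) (i : ℕ) :
    secondDiffPart x i = (1 / 12 : ℂ) * (2 * x i - shiftSeq x i - x (i + 1)) := by
  rw [← adjoint_shiftRight_apply, ← shiftRight_apply]
  rfl

/-- The Numerov average of a function of one integer index. -/
noncomputable def numerov (f : ℤ → ℂ) (j : ℤ) : ℂ :=
  (1 / 12 : ℂ) * f (j - 1) + (5 / 6 : ℂ) * f j + (1 / 12 : ℂ) * f (j + 1)

/-- The second difference quotient of a function of one integer index. -/
noncomputable def secondDiff (h : ℝ) (f : ℤ → ℂ) (j : ℤ) : ℂ :=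
  ((f (j + 1) - f j) / (h : ℂ) - (f j - f (j - 1)) / (h : ℂ)) / (h : ℂ)

/-- The one-dimensional Numerov-Crank-Nicolson equation at the node `j`. -/
def StepEq (hbar tau c h : ℝ) (v : ℤ → ℝ) (f g G : ℤ → ℂ) (j : ℤ) : Prop :=
  Complex.I * (hbar : ℂ) * numerov (fun i => (f i - g i) / (tau : ℂ)) j
    = -(c : ℂ) * secondDiff h (fun i => (f i + g i) / 2) j
      + numerov (fun i => (v i : ℂ) * ((f i + g i) / 2)) j + G j

/-- With the zero value at node `0`, the Numerov average is `1 - T` and the second difference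
quotient is `-(12/h²) T`, where `T = secondDiffPart`; the abstract estimate then applies. The bound
`C` only serves to make the potential term square summable, and does not enter the result. -/
theorem StepEq.norm_le {hbar tau c h : ℝ} (hhbar : 0 < hbar) (htau : 0 < tau) (hh : 0 < h)
    {v : ℤ → ℝ} {C : ℝ} (hv : ∀ j, |v j| ≤ C) {f g G : ℤ → ℂ} (hf0 : f 0 = 0) (hg0 : g 0 = 0)
    (hf : Summable fun i : ℕ => ‖f (i + 1)‖ ^ 2) (hg : Summable fun i : ℕ => ‖g (i + 1)‖ ^ 2)
    (hG : Summable fun i : ℕ => ‖G (i + 1)‖ ^ 2)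
    (heq : ∀ j ≥ 1, StepEq hbar tau c h v f g G j) :
    Real.sqrt (∑' i : ℕ, ‖f (i + 1)‖ ^ 2) ≤ Real.sqrt (∑' i : ℕ, ‖g (i + 1)‖ ^ 2)
      + 3 * tau / (2 * hbar) * Real.sqrt (∑' i : ℕ, ‖G (i + 1)‖ ^ 2) := by
  let f' : EllTwo := ⟨fun i => f (i + 1), memℓp_two_iff.mpr hf⟩
  let g' : EllTwo := ⟨fun i => g (i + 1), memℓp_two_iff.mpr hg⟩
  let G' : EllTwo := ⟨fun i => G (i + 1), memℓp_two_iff.mpr hG⟩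
  have hfa : ∀ i, f' i = f (i + 1) := fun i => rfl
  have hga : ∀ i, g' i = g (i + 1) := fun i => rfl
  have hGa : ∀ i, G' i = G (i + 1) := fun i => rfl
  have hz : Memℓp (fun i : ℕ => (v (i + 1) : ℂ) * ((f (i + 1) + g (i + 1)) / 2)) 2 := by
    have h1 := memℓp_two_iff.mp (lp.memℓp (f' + g'))
    refine memℓp_two_iff.mpr (Summable.of_nonneg_of_le (fun i => by positivity) (fun i => ?_)
      (h1.mul_left ((C / 2) ^ 2)))
    have h2 : ‖(f' + g') i‖ = ‖f (i + 1) + g (i + 1)‖ := rfl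
    rw [h2, norm_mul, norm_div, Complex.norm_real, Real.norm_eq_abs, ← mul_pow]
    have h3 := hv (i + 1)
    have h4 : ‖(2 : ℂ)‖ = 2 := by norm_num
    rw [h4]
    refine pow_le_pow_left₀ (by positivity) ?_ 2
    nlinarith [norm_nonneg (f (i + 1) + g (i + 1))]
  let z' : EllTwo := ⟨_, hz⟩
  have hza : ∀ i : ℕ, z' i = (v (i + 1) : ℂ) * ((f (i + 1) + g (i + 1)) / 2) := fun i => rfl
  -- `b` comes from `-c · (-(12/h²) T) (f + g)/2`.
  have key := norm_le_of_averaged_step (k := hbar / tau) (b := 6 * c / h ^ 2) secondDiffPart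
    secondDiffPart_symm norm_secondDiffPart_le (by positivity) (f := f') (g := g') (z := z')
    (G := G') ?_ ?_
  · rw [EllTwo.norm_eq, EllTwo.norm_eq, EllTwo.norm_eq] at key
    have h1 : 3 / (2 * (hbar / tau)) = 3 * tau / (2 * hbar) := by field_simp
    rw [h1] at key
    exact key
  · have h1 := lp.hasSum_inner (𝕜 := ℂ) (f' + g') z'
    have h2 := (Complex.hasSum_im h1)
    refine h2.unique ?_
    convert hasSum_zero with i
    rw [hza, lp.coeFn_add, Pi.add_apply, hfa, hga]
    simp only [RCLike.inner_apply]
    set w := f (i + 1) + g (i + 1)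
    have : (v (i + 1) : ℂ) * (w / 2) * (starRingEnd ℂ) w
        = ((v (i + 1) / 2 * Complex.normSq w : ℝ) : ℂ) := by
      push_cast
      rw [← Complex.mul_conj]; ring
    rw [this, Complex.ofReal_im]
  · have hsub : ∀ (x : ℤ → ℂ) (x' : EllTwo), x 0 = 0 → (∀ i, x' i = x (i + 1)) → ∀ i,
        secondDiffPart x' i = (1 / 12 : ℂ) * (2 * x (i + 1) - x i - x (i + 2)) := by
      intro x x' hx0 hx i
      rw [secondDiffPart_apply, hx, hx]
      have : shiftSeq x' i = x i := by
        cases i with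
        | zero => simp [shiftSeq, hx0]
        | succ i => simp [shiftSeq, hx]
      rw [this]
      push_cast
      ring_nf
    ext i
    have h1 := heq (i + 1) (by omega)
    have hzs := hsub (fun j => (v j : ℂ) * ((f j + g j) / 2)) z' (by simp [hf0, hg0]) hza i
    have hfs := hsub f f' hf0 hfa i
    have hgs := hsub g g' hg0 hga i
    have hht : (h : ℂ) ≠ 0 := by exact_mod_cast hh.ne'
    have htt : (tau : ℂ) ≠ 0 := by exact_mod_cast htau.ne'
    have e1 : ((i : ℤ) + 1 - 1) = i := by ring
    have e2 : ((i : ℤ) + 1 + 1) = i + 2 := by ring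
    simp only [StepEq, numerov, secondDiff, e1, e2] at h1
    simp only [lp.coeFn_add, lp.coeFn_sub, lp.coeFn_smul, Pi.add_apply, Pi.sub_apply,
      Pi.smul_apply, map_sub, map_add, smul_eq_mul, hzs, hfs, hgs, hfa, hga, hza, hGa]
    push_cast
    linear_combination (norm := skip) h1
    field_simp
    ring

/-! ### Generating function of the convolution kernel. -/

namespace PowerSeries

/-- The series with the coefficients given by the three-term recurrence of Legendre type is a square
root of a quadratic polynomial. -/
theorem mk_sq_of_recurrence {x y : ℂ} {r : ℕ → ℂ} (h1 : r 1 = -(r 0 * x))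
    (h2 : ∀ m : ℕ, r (m + 2) = (2 * ((m + 2 : ℕ) : ℂ) - 3) / ((m + 2 : ℕ) : ℂ) * x * r (m + 1)
      - (((m + 2 : ℕ) : ℂ) - 3) / ((m + 2 : ℕ) : ℂ) * y * r m) :
    (mk r) ^ 2 = C (r 0 ^ 2) * (1 - C (2 * x) * X + C y * X ^ 2) := by
  set R : PowerSeries ℂ := mk r
  obtain ⟨b, hb⟩ : ∃ b, b = 2 * x := ⟨_, rfl⟩
  rw [← hb]
  set Q : PowerSeries ℂ := 1 - C b * X + C y * X ^ 2 with hQ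
  have hc0 : constantCoeff (derivative ℂ R) = r 1 := by
    rw [← coeff_zero_eq_constantCoeff_apply, coeff_derivative]; simp [R]
  -- This is the differential equation `2 Q R' = Q' R` of a multiple of `√Q`. Its coefficient of
  -- degree `m + 1` is the recurrence for `r (m + 2)`, and the one of degree `0` is the relation for
  -- `r 1`.
  have hode : Q * derivative ℂ R = (C y * X - C x) * R := by
    ext m
    have e1 : Q * derivative ℂ R = derivative ℂ R - C b * (derivative ℂ R * X)
        + C y * (derivative ℂ R * X * X) := by rw [hQ]; ring
    have e2 : (C y * X - C x) * R = C y * (R * X) - C x * R := by ring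
    rw [e1, e2]
    rcases m with _ | _ | m
    · simp [hc0, h1, R]; ring
    · have := h2 0
      simp only [map_add, map_sub, coeff_C_mul, coeff_succ_mul_X, coeff_derivative, R, coeff_mk,
        coeff_zero_mul_X] at this ⊢
      rw [this, hb]; push_cast; field_simp; ring
    · have := h2 (m + 1)
      simp only [map_add, map_sub, coeff_C_mul, coeff_succ_mul_X, coeff_derivative, R, coeff_mk]
        at this ⊢
      have h3 : (m : ℂ) + 1 + 2 ≠ 0 := by exact_mod_cast (by omega : m + 1 + 2 ≠ 0)
      rw [this, hb]; push_cast; field_simp; ring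
  have hQ0 : constantCoeff Q ≠ 0 := by simp [hQ]
  have hQd : derivative ℂ Q = 2 * (C y * X - C x) := by
    have hbC : (C b : PowerSeries ℂ) = 2 * C x := by rw [hb, map_mul, map_ofNat]
    rw [hQ]
    simp only [map_add, map_sub, Derivation.leibniz, Derivation.leibniz_pow, derivative_X,
      derivative_C, Derivation.map_one_eq_zero, smul_eq_mul, nsmul_eq_mul]
    rw [hbC]
    push_cast
    ring
  -- `R²` and `Q` both solve `Q Z' = Q' Z`, hence so does `Z`. Then `(Z/Q)' = 0`, and `Z/Q` has zero
  -- constant term.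
  set Z := R ^ 2 - C (r 0 ^ 2) * Q with hZ
  have hZd : Q * derivative ℂ Z = derivative ℂ Q * Z := by
    have : derivative ℂ Z = 2 * R * derivative ℂ R - C (r 0 ^ 2) * derivative ℂ Q := by
      rw [hZ]
      simp only [map_sub, Derivation.leibniz, Derivation.leibniz_pow,
        derivative_C, smul_eq_mul, nsmul_eq_mul]
      push_cast
      ring
    rw [this, hQd, hZ]
    linear_combination 2 * R * hode
  have hQi : Q * Q⁻¹ = 1 := PowerSeries.mul_inv_cancel Q hQ0
  have hW : Z * Q⁻¹ = 0 := by
    apply derivative.ext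
    · rw [Derivation.leibniz, derivative_inv', map_zero, smul_eq_mul, smul_eq_mul]
      linear_combination (Q⁻¹) ^ 2 * hZd - Q⁻¹ * derivative ℂ Z * hQi
    · simp [hZ, R, hQ]
  have : Z = 0 := by
    rw [← mul_one Z, ← hQi]
    linear_combination Q * hW
  exact sub_eq_zero.mp this

end PowerSeries

namespace SplittingData

variable {n : ℕ} [NeZero n] (D : SplittingData n)

/-- The choice of the branch `[0, 2π)` is invisible here; it matters only for `c1`, which contains
half of the argument. -/
theorem exp_argPos (z : ℂ) : Complex.exp (Complex.I * (argPos z : ℂ)) =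
    Complex.exp (Complex.I * (z.arg : ℂ)) := by
  unfold argPos
  split_ifs
  · push_cast
    rw [mul_add, Complex.exp_add]
    have : Complex.exp (Complex.I * (2 * (Real.pi : ℂ))) = 1 := by
      rw [mul_comm]; exact Complex.exp_two_pi_mul_I
    rw [this, mul_one]
  · rfl

theorem norm_mul_exp_argPos (z : ℂ) : (‖z‖ : ℂ) * Complex.exp (Complex.I * (argPos z : ℂ)) = z := by
  rw [exp_argPos, mul_comm Complex.I, Complex.norm_mul_exp_arg_mul_I]

theorem c1_sq (v : ℝ) : D.c1 v ^ 2 = conj (D.alpha v) / 4 := by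
  have h1 : conj (D.alpha v) =
      (‖D.alpha v‖ : ℂ) * Complex.exp (-(Complex.I * (argPos (D.alpha v) : ℂ))) := by
    conv_lhs => rw [← norm_mul_exp_argPos (D.alpha v)]
    rw [map_mul, Complex.conj_ofReal, ← Complex.exp_conj]
    simp
  have h2 : ((Real.sqrt ‖D.alpha v‖ : ℝ) : ℂ) ^ 2 = (‖D.alpha v‖ : ℂ) := by
    rw [← Complex.ofReal_pow, Real.sq_sqrt (norm_nonneg _)]
  rw [c1, mul_pow, neg_sq, ← Complex.exp_nat_mul, h1]
  push_cast
  rw [div_pow, h2]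
  ring_nf

theorem c1_sq_mul_kap (v : ℝ) : D.c1 v ^ 2 * D.kap v = -((‖D.alpha v‖ : ℂ) / 4) := by
  have h1 : (D.alpha v) * conj (D.alpha v) = (‖D.alpha v‖ : ℂ) ^ 2 := Complex.mul_conj' _
  have h2 := norm_mul_exp_argPos (D.alpha v)
  by_cases h0 : (‖D.alpha v‖ : ℂ) = 0
  · have : D.alpha v = 0 := by simpa using h0
    rw [c1_sq, this]; simp
  · rw [c1_sq, kap]
    apply mul_left_cancel₀ h0
    linear_combination (-conj (D.alpha v) / 4) * h2 - h1 / 4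

theorem c1_sq_mul_kap_sq (v : ℝ) : D.c1 v ^ 2 * D.kap v ^ 2 = D.alpha v / 4 := by
  have h2 := norm_mul_exp_argPos (D.alpha v)
  have := D.c1_sq_mul_kap v
  rw [kap] at this ⊢
  linear_combination (-Complex.exp (Complex.I * (argPos (D.alpha v) : ℂ))) * this + h2 / 4

/-- The recurrence is that of a square root with `x = ϰμ` and `y = ϰ²`. After multiplication by
`c₁²` the moduli and arguments recombine into `α`, `β` and `ᾱ`. -/
theorem mk_kernelR_sq (v : ℝ) (hα : D.alpha v ≠ 0) :
    (PowerSeries.mk (D.kernelR v)) ^ 2 =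
      PowerSeries.C (conj (D.alpha v) / 4) + PowerSeries.C ((D.beta v : ℂ) / 2) * PowerSeries.X
        + PowerSeries.C (D.alpha v / 4) * PowerSeries.X ^ 2 := by
  have hn : (‖D.alpha v‖ : ℂ) ≠ 0 := by simpa using hα
  rw [PowerSeries.mk_sq_of_recurrence (x := D.kap v * D.mu v) (y := D.kap v ^ 2)
    (by simp [kernelR, mul_assoc]) (fun m => by rw [kernelR]; ring)]
  have e0 : D.kernelR v 0 = D.c1 v := rfl
  have e1 : D.c1 v ^ 2 * (2 * (D.kap v * D.mu v)) = -((D.beta v : ℂ) / 2) := by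
    have := D.c1_sq_mul_kap v
    rw [mu]
    push_cast
    field_simp
    linear_combination 4 * (D.beta v : ℂ) * this
  have e2 := D.c1_sq_mul_kap_sq v
  have e1' := congrArg (PowerSeries.C (R := ℂ)) e1
  have e2' := congrArg (PowerSeries.C (R := ℂ)) e2
  rw [map_mul] at e1' e2'
  rw [map_neg] at e1'
  rw [e0, ← D.c1_sq]
  linear_combination -PowerSeries.X * e1' + PowerSeries.X ^ 2 * e2'

theorem alpha_re (v : ℝ) : (D.alpha v).re = 2 * (D.aCoef v).re
    + 2 / 3 * D.h 0 ^ 2 * ((D.aCoef v).re ^ 2 - (D.aCoef v).im ^ 2) := by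
  have : D.alpha v = ((2 : ℝ) : ℂ) * D.aCoef v
      + ((2 / 3 * D.h 0 ^ 2 : ℝ) : ℂ) * (D.aCoef v * D.aCoef v) := by
    rw [alpha]; push_cast; ring
  rw [this, Complex.add_re, Complex.re_ofReal_mul, Complex.re_ofReal_mul, Complex.mul_re]
  ring

theorem alpha_im (v : ℝ) : (D.alpha v).im =
    2 * (D.aCoef v).im * (1 + 2 / 3 * D.h 0 ^ 2 * (D.aCoef v).re) := by
  have : D.alpha v = ((2 : ℝ) : ℂ) * D.aCoef v
      + ((2 / 3 * D.h 0 ^ 2 : ℝ) : ℂ) * (D.aCoef v * D.aCoef v) := by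
    rw [alpha]; push_cast; ring
  rw [this, Complex.add_im, Complex.im_ofReal_mul, Complex.im_ofReal_mul, Complex.mul_im]
  ring

omit [NeZero n] in
theorem aCoef_im (v : ℝ) : (D.aCoef v).im = D.hbar / (D.tau * D.c) := by
  simp [aCoef, -Complex.ofReal_div]

/-- If `α` is real, its imaginary part forces `h² Re a = -3/2`, and then `h² Re α = -3/2 - (2/3)(h²
Im a)² < 0`. So `α` is never a nonnegative real. -/
theorem arg_alpha_ne_zero (hh : 0 < D.h 0) (v : ℝ) (ha : 0 < (D.aCoef v).im) :
    (D.alpha v).arg ≠ 0 := by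
  rw [Ne, Complex.arg_eq_zero_iff, alpha_re, alpha_im]
  rintro ⟨h1, h2⟩
  set x := (D.aCoef v).re
  set y := (D.aCoef v).im
  set H := D.h 0 ^ 2 with hH
  have hHp : 0 < H := by positivity
  have h3 : 1 + 2 / 3 * H * x = 0 := by
    rcases mul_eq_zero.mp h2 with h | h
    · linarith
    · exact h
  have hx : H * x = -(3 / 2) := by linarith
  have h4 : 0 ≤ H * (2 * x + 2 / 3 * H * (x ^ 2 - y ^ 2)) := mul_nonneg hHp.le h1
  have h5 : H * (2 * x + 2 / 3 * H * (x ^ 2 - y ^ 2))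
    = 2 * (H * x) + 2 / 3 * (H * x) ^ 2 - 2 / 3 * (H * y) ^ 2 := by ring
  rw [h5, hx] at h4
  nlinarith [sq_nonneg (H * y)]

/-- Half of the argument lies in `(0, π)`, where the sine is positive. This sign is what singles out
the square root belonging to the decaying solution. -/
theorem c1_im_pos (hh : 0 < D.h 0) (v : ℝ) (ha : 0 < (D.aCoef v).im) : 0 < (D.c1 v).im := by
  have harg := D.arg_alpha_ne_zero hh v ha
  have hα : D.alpha v ≠ 0 := fun h => harg (by rw [h, Complex.arg_zero])
  have h1 : 0 < argPos (D.alpha v) ∧ argPos (D.alpha v) < 2 * Real.pi := by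
    have := Complex.neg_pi_lt_arg (D.alpha v)
    have := Complex.arg_le_pi (D.alpha v)
    have := Real.pi_pos
    unfold argPos
    split_ifs with h
    · constructor <;> linarith
    · exact ⟨lt_of_le_of_ne (not_lt.mp h) (Ne.symm harg), by linarith⟩
  have h2 : 0 < Real.sin (argPos (D.alpha v) / 2) :=
    Real.sin_pos_of_pos_of_lt_pi (by linarith) (by linarith)
  have h3 : 0 < Real.sqrt ‖D.alpha v‖ / 2 := by
    have : 0 < ‖D.alpha v‖ := norm_pos_iff.mpr hα
    positivity
  have h4 : D.c1 v = ((Real.sqrt ‖D.alpha v‖ / 2 : ℝ) : ℂ) *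
      -Complex.exp (((-(argPos (D.alpha v) / 2) : ℝ) : ℂ) * Complex.I) := by
    rw [c1]; push_cast; ring_nf
  rw [h4, Complex.im_ofReal_mul, Complex.neg_im, Complex.exp_ofReal_mul_I_im, Real.sin_neg, neg_neg]
  positivity

end SplittingData

/-! ### The decaying root of the characteristic equation. -/

/-- Of two factors of `z²`, both or none have positive real part relative to `z`. -/
theorem re_mul_conj_neg_of_sq_eq_mul {A B z : ℂ} (h : z ^ 2 = A * B)
    (hA : (A * conj z).re < 0) : (B * conj z).re < 0 := by
  have h1 : (A * conj z) * (B * conj z) = (((Complex.normSq z) ^ 2 : ℝ) : ℂ) := by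
    push_cast
    rw [← Complex.mul_conj]; linear_combination -(conj z) ^ 2 * h
  have hz : z ≠ 0 := by rintro rfl; simp at hA
  have hs : 0 < Complex.normSq z ^ 2 := by have := Complex.normSq_pos.mpr hz; positivity
  have h2 := congrArg Complex.re h1
  have h3 := congrArg Complex.im h1
  rw [Complex.ofReal_re, Complex.mul_re] at h2
  rw [Complex.ofReal_im, Complex.mul_im] at h3
  generalize A * conj z = a at *
  generalize B * conj z = b at *
  by_contra hb
  push Not at hb
  -- As `a * b` is a positive real, `b` is a positive multiple of the conjugate of `a`; this
  -- identity expresses it for the real parts.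
  have h4 : a.re * (a.re * b.re - a.im * b.im) = b.re * (a.re ^ 2 + a.im ^ 2) := by
    linear_combination -a.im * h3
  have h5 : a.re * Complex.normSq z ^ 2 < 0 := mul_neg_of_neg_of_pos hA hs
  rw [← h2, h4] at h5
  have : 0 ≤ b.re * (a.re ^ 2 + a.im ^ 2) := by positivity
  linarith

/-- A nonnegative sequence satisfying a contractive recurrence with a summable perturbation is
summable. -/
theorem summable_of_le_mul_add {a b : ℕ → ℝ} {ρ : ℝ} (ha : ∀ k, 0 ≤ a k) (hb : ∀ k, 0 ≤ b k)
    (hρ : ρ < 1) (hs : Summable b) (h : ∀ k, a (k + 1) ≤ ρ * a k + b k) : Summable a := by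
  -- Summing the recurrence gives `S ≤ a 0 + ρ S + ∑ b` for each partial sum `S`.
  refine summable_of_sum_range_le (c := (a 0 + ∑' k, b k) / (1 - ρ)) ha fun K => ?_
  rw [le_div_iff₀ (by linarith)]
  have h1 : ∑ k ∈ Finset.range K, a (k + 1) ≤ ρ * ∑ k ∈ Finset.range K, a k + ∑' k, b k :=
    calc ∑ k ∈ Finset.range K, a (k + 1) ≤ ∑ k ∈ Finset.range K, (ρ * a k + b k) :=
          Finset.sum_le_sum fun k _ => h k
      _ = ρ * ∑ k ∈ Finset.range K, a k + ∑ k ∈ Finset.range K, b k := by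
          rw [Finset.sum_add_distrib, Finset.mul_sum]
      _ ≤ _ := by gcongr; exact hs.sum_le_tsum _ fun k _ => hb k
  have h2 := Finset.sum_range_succ a K
  have h3 := Finset.sum_range_succ' a K
  have := ha K
  linarith

theorem Summable.norm_sq {a : ℕ → ℂ} (h : Summable fun k => ‖a k‖) :
    Summable fun k => ‖a k‖ ^ 2 := by
  have h1 := h.mul_of_nonneg h (fun k => norm_nonneg _) (fun k => norm_nonneg _)
  have h2 := h1.comp_injective (i := fun k : ℕ => (k, k)) fun i j hij => (Prod.mk.inj hij).1
  refine h2.congr fun k => ?_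
  simp [sq]

/-- The coefficient of degree `m` of `ν^(k+1) Φ` is `ν(0)` times that of `ν^k Φ` plus terms of lower
degree in `ν^k Φ`, which are summable by induction. Only `|ν(0)| < 1` is used; the other
coefficients of `ν` are arbitrary. -/
theorem PowerSeries.summable_norm_coeff_pow_mul {ν : PowerSeries ℂ}
    (hν : ‖PowerSeries.constantCoeff ν‖ < 1) (Φ : PowerSeries ℂ) (m : ℕ) :
    Summable fun k : ℕ => ‖PowerSeries.coeff m (ν ^ k * Φ)‖ := by
  induction m using Nat.strong_induction_on with
  | _ m ih =>
    refine summable_of_le_mul_add (fun k => norm_nonneg _)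
      (b := fun k => ∑ i ∈ Finset.range m,
        ‖PowerSeries.coeff (i + 1) ν‖ * ‖PowerSeries.coeff (m - (i + 1)) (ν ^ k * Φ)‖)
      (fun k => by positivity) hν ?_ fun k => ?_
    · refine summable_sum fun i hi => (ih _ ?_).mul_left _
      have := Finset.mem_range.mp hi
      omega
    · rw [pow_succ', mul_assoc, PowerSeries.coeff_mul,
        Finset.Nat.sum_antidiagonal_eq_sum_range_succ_mk, Finset.sum_range_succ', add_comm]
      refine (norm_add_le _ _).trans (add_le_add ?_ ?_)
      · simp
      · exact (norm_sum_le _ _).trans (le_of_eq (by simp))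

theorem sum_Icc_one_eq_sum_range {M : Type*} [AddCommMonoid M] (φ : ℤ → M) (J : ℕ) :
    ∑ j ∈ Finset.Icc (1 : ℤ) J, φ j = ∑ i ∈ Finset.range J, φ (i + 1) := by
  refine Finset.sum_nbij' (fun j => (j - 1).toNat) (fun i => (i : ℤ) + 1) ?_ ?_ ?_ ?_ ?_
  · intro j hj; simp only [Finset.mem_Icc, Finset.mem_range] at *; omega
  · intro j hj; simp only [Finset.mem_Icc, Finset.mem_range] at *; omega
  · intro j hj; simp only [Finset.mem_Icc] at *; omega
  · intro j hj; simp
  · intro j hj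
    simp only [Finset.mem_Icc] at hj
    congr 1; omega

namespace SplittingData

variable {n : ℕ} [NeZero n] (D : SplittingData n)

open PowerSeries in
/-- The generating function `ν` of the decaying solution on the half-line: with
`r = u/h - hw/12`, `p = u/h + 5hw/12`, `u = (1+X)/2`, `w = ā + aX` one has
`r ν = p + R` and `(p - R) ν = r`. -/
theorem exists_decaying_root (hh : 0 < D.h 0) (v : ℝ) (ha : 0 < (D.aCoef v).im) :
    ∃ r p ν : PowerSeries ℂ,
      r = C (1 / (2 * D.h 0) : ℂ) * (1 + PowerSeries.X)
        - C (D.h 0 / 12 : ℂ) * (C (conj (D.aCoef v)) + C (D.aCoef v) * PowerSeries.X) ∧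
      p = C (1 / (2 * D.h 0) : ℂ) * (1 + PowerSeries.X)
        + C (5 * D.h 0 / 12 : ℂ) * (C (conj (D.aCoef v)) + C (D.aCoef v) * PowerSeries.X) ∧
      constantCoeff r ≠ 0 ∧ r * ν = p + PowerSeries.mk (D.kernelR v) ∧
      (p - PowerSeries.mk (D.kernelR v)) * ν = r ∧
      ‖constantCoeff ν‖ < 1 := by
  obtain ⟨r, hr⟩ : ∃ r, r = C (1 / (2 * D.h 0) : ℂ) * (1 + PowerSeries.X)
        - C (D.h 0 / 12 : ℂ) * (C (conj (D.aCoef v)) + C (D.aCoef v) * PowerSeries.X) := ⟨_, rfl⟩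
  obtain ⟨p, hp⟩ : ∃ p, p = C (1 / (2 * D.h 0) : ℂ) * (1 + PowerSeries.X)
        + C (5 * D.h 0 / 12 : ℂ) * (C (conj (D.aCoef v)) + C (D.aCoef v) * PowerSeries.X) := ⟨_, rfl⟩
  have hα : D.alpha v ≠ 0 := fun h => D.arg_alpha_ne_zero hh v ha (by rw [h, Complex.arg_zero])
  set R : PowerSeries ℂ := PowerSeries.mk (D.kernelR v) with hR
  have hh' : (D.h 0 : ℂ) ≠ 0 := by exact_mod_cast hh.ne'
  -- `p² - r²` is a quarter of the discriminant of `r ν² - 2 p ν + r`.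
  have hsq : R ^ 2 = p ^ 2 - r ^ 2 := by
    rw [hR, D.mk_kernelR_sq v hα]
    obtain ⟨k, hk⟩ : ∃ k, k = (1 / (2 * D.h 0) : ℂ) := ⟨_, rfl⟩
    have hk' : k * (D.h 0 : ℂ) = 1 / 2 := by rw [hk]; field_simp
    have h1 : conj (D.alpha v) / 4 = k * D.h 0 * conj (D.aCoef v)
        + D.h 0 ^ 2 / 6 * conj (D.aCoef v) ^ 2 := by
      rw [alpha, hk']
      simp only [map_add, map_mul, map_pow, map_div₀, map_ofNat, Complex.conj_ofReal]
      ring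
    have h2 : (D.beta v : ℂ) / 2 = k * D.h 0 * (D.aCoef v + conj (D.aCoef v))
        + D.h 0 ^ 2 / 3 * (D.aCoef v * conj (D.aCoef v)) := by
      rw [beta, hk', Complex.add_conj, Complex.mul_conj, Complex.normSq_eq_norm_sq]
      push_cast; ring
    have h3 : D.alpha v / 4 = k * D.h 0 * D.aCoef v + D.h 0 ^ 2 / 6 * D.aCoef v ^ 2 := by
      rw [alpha, hk']; ring
    have e5 : (C (5 * D.h 0 / 12 : ℂ) : PowerSeries ℂ) = 5 * C (D.h 0 / 12 : ℂ) := by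
      rw [mul_div_assoc, map_mul, map_ofNat]
    have e6 : (C ((D.h 0 : ℂ) ^ 2 / 6) : PowerSeries ℂ) = 24 * C (D.h 0 / 12 : ℂ) ^ 2 := by
      rw [← map_pow, ← map_ofNat (C (R := ℂ)) 24, ← map_mul]; congr 1; ring
    have e7 : (C ((D.h 0 : ℂ) ^ 2 / 3) : PowerSeries ℂ) = 48 * C (D.h 0 / 12 : ℂ) ^ 2 := by
      rw [← map_pow, ← map_ofNat (C (R := ℂ)) 48, ← map_mul]; congr 1; ring
    have e8 : (C (D.h 0 : ℂ) : PowerSeries ℂ) = 12 * C (D.h 0 / 12 : ℂ) := by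
      rw [← map_ofNat (C (R := ℂ)) 12, ← map_mul]; congr 1; ring
    rw [hp, hr, h1, h2, h3, ← hk, e5]
    simp only [map_add, map_mul, map_pow, e6, e7, e8]
    ring
  set a := D.aCoef v with ha'
  have hr0 : constantCoeff r = 1 / (2 * D.h 0 : ℂ) - D.h 0 / 12 * conj a := by
    rw [hr]; simp
  have hp0 : constantCoeff p = 1 / (2 * D.h 0 : ℂ) + 5 * D.h 0 / 12 * conj a := by
    rw [hp]; simp
  have hR0 : constantCoeff R = D.c1 v := by
    rw [hR, ← coeff_zero_eq_constantCoeff_apply, coeff_mk]; rfl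
  -- Its imaginary part is `(h/12) Im a > 0`.
  have hrne : constantCoeff r ≠ 0 := by
    rw [hr0]; intro h0
    have h1 : (1 / (2 * D.h 0 : ℂ) - D.h 0 / 12 * conj a) =
      ((1 / (2 * D.h 0) : ℝ) : ℂ) - ((D.h 0 / 12 : ℝ) : ℂ) * conj a := by push_cast; rfl
    have := congrArg Complex.im h0
    rw [h1, Complex.sub_im, Complex.ofReal_im, Complex.im_ofReal_mul, Complex.conj_im] at this
    have : D.h 0 / 12 * a.im = 0 := by simpa using this
    have : 0 < D.h 0 / 12 * a.im := by positivity
    linarith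
  have hri : r * r⁻¹ = 1 := PowerSeries.mul_inv_cancel r hrne
  refine ⟨r, p, (p + R) * r⁻¹, hr, hp, hrne, ?_, ?_, ?_⟩
  · linear_combination (p + R) * hri
  · linear_combination r * hri - r⁻¹ * hsq
  · have hsq0 := congrArg constantCoeff hsq
    simp only [map_pow, map_sub, hR0] at hsq0
    -- The roots `(p ± R)/r` have product `1`, so it suffices to compare their moduli at `X = 0`.
    -- The inequality amounts to `Re (p(0) z̄) < 0` with `z = c₁`, and `2 p(0)` is the sum of the
    -- factors `p(0) ∓ r(0)` of `z²`. It is therefore enough to find the sign for one factor.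
    have hlt : ‖constantCoeff p + D.c1 v‖ < ‖constantCoeff p - D.c1 v‖ := by
      have hzim := D.c1_im_pos hh v ha
      have hA : constantCoeff p - constantCoeff r = ((D.h 0 / 2 : ℝ) : ℂ) * conj a := by
        rw [hp0, hr0]; push_cast; ring
      have hB : constantCoeff p + constantCoeff r =
          ((1 / D.h 0 : ℝ) : ℂ) + ((D.h 0 / 3 : ℝ) : ℂ) * conj a := by
        rw [hp0, hr0]; push_cast; field_simp; ring
      have hAB : D.c1 v ^ 2 = (constantCoeff p - constantCoeff r)
          * (constantCoeff p + constantCoeff r) := by linear_combination hsq0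
      have him := congrArg Complex.im (D.c1_sq v)
      have e4 : conj (D.alpha v) / 4 = ((1 / 4 : ℝ) : ℂ) * conj (D.alpha v) := by push_cast; ring
      rw [e4, Complex.im_ofReal_mul, Complex.conj_im, D.alpha_im, ← ha', sq, Complex.mul_im] at him
      set z := D.c1 v
      set h := D.h 0
      have hAz : ((constantCoeff p - constantCoeff r) * conj z).re
          = h / 2 * (a.re * z.re - a.im * z.im) := by
        rw [hA, mul_assoc, Complex.re_ofReal_mul, Complex.mul_re]; simp
      have hBz : ((constantCoeff p + constantCoeff r) * conj z).re
          = (1 / h + h / 3 * a.re) * z.re - h / 3 * a.im * z.im := by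
        rw [hB, add_mul, mul_assoc, Complex.add_re, Complex.re_ofReal_mul, Complex.re_ofReal_mul,
          Complex.mul_re]
        simp; ring
      have hneg : ((constantCoeff p - constantCoeff r) * conj z).re < 0 ∧
          ((constantCoeff p + constantCoeff r) * conj z).re < 0 := by
        -- Since `Im z > 0`, the sign of `Re z` is opposite to that of `1 + (2/3) h² Re a`, by the
        -- imaginary part of `z² = ᾱ/4`. In the first case the factor `p + r` has nonnegative real
        -- part; in the second `Re a < 0`, and the factor `p - r` is used.
        rcases le_or_gt 0 (1 + 2 / 3 * h ^ 2 * a.re) with hx | hx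
        · have hzre : z.re ≤ 0 := by
            by_contra hc
            push Not at hc
            have := mul_pos hc hzim
            have := mul_nonneg ha.le hx
            nlinarith
          have hB0 : ((constantCoeff p + constantCoeff r) * conj z).re < 0 := by
            rw [hBz]
            have h1 : 0 ≤ 1 / h + h / 3 * a.re := by
              have : 1 / h + h / 3 * a.re = (1 / 2 + (1 + 2 / 3 * h ^ 2 * a.re) / 2) / h := by
                field_simp; ring
              rw [this]; positivity
            have h2 : 0 < h / 3 * a.im * z.im := by positivity
            linarith [mul_nonpos_of_nonneg_of_nonpos h1 hzre]
          exact ⟨re_mul_conj_neg_of_sq_eq_mul (hAB.trans (mul_comm _ _)) hB0, hB0⟩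
        · have hzre : 0 < z.re := by
            by_contra hc
            push Not at hc
            have := mul_nonpos_of_nonpos_of_nonneg hc hzim.le
            have := mul_neg_of_pos_of_neg ha hx
            nlinarith
          have hxre : a.re < 0 := by
            by_contra hc
            push Not at hc
            have : 0 ≤ 2 / 3 * h ^ 2 * a.re := by positivity
            linarith
          have hA0 : ((constantCoeff p - constantCoeff r) * conj z).re < 0 := by
            rw [hAz]
            have h1 := mul_neg_of_neg_of_pos hxre hzre
            have h2 := mul_pos ha hzim
            exact mul_neg_of_pos_of_neg (by positivity) (by linarith)
          exact ⟨hA0, re_mul_conj_neg_of_sq_eq_mul hAB hA0⟩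
      have hsum : (constantCoeff p * conj z).re < 0 := by
        have : ((constantCoeff p - constantCoeff r) * conj z).re
          + ((constantCoeff p + constantCoeff r) * conj z).re = 2 * (constantCoeff p * conj z).re := by
          simp only [sub_mul, add_mul, Complex.sub_re, Complex.add_re]; ring
        linarith [hneg.1, hneg.2]
      refine lt_of_pow_lt_pow_left₀ 2 (norm_nonneg _) ?_
      rw [← Complex.normSq_eq_norm_sq, ← Complex.normSq_eq_norm_sq, Complex.normSq_add,
        Complex.normSq_sub]
      linarith
    have h1 : ‖constantCoeff p + D.c1 v‖ * ‖constantCoeff p - D.c1 v‖ = ‖constantCoeff r‖ ^ 2 := by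
      rw [← norm_mul, ← norm_pow]; congr 1; linear_combination -hsq0
    rw [map_mul, map_add, hR0, constantCoeff_inv, norm_mul, norm_inv,
      mul_inv_lt_iff₀ (norm_pos_iff.mpr hrne), one_mul]
    refine lt_of_pow_lt_pow_left₀ 2 (norm_nonneg _) ?_
    rw [← h1, sq]
    have h2 : 0 < ‖constantCoeff p + D.c1 v‖ * ‖constantCoeff p - D.c1 v‖ := by
      rw [h1]; have := norm_pos_iff.mpr hrne; positivity
    exact mul_lt_mul_of_pos_left hlt (pos_of_mul_pos_left h2 (norm_nonneg _))

end SplittingData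

/-! ### Continuation of a mode beyond the artificial boundary. -/

namespace SplittingData

noncomputable section

variable {n : ℕ} [NeZero n] (D : SplittingData n)

/-- The left-hand side of the one-dimensional discrete TBC at the node `J`. -/
def modeLeft (v : ℝ) (J : ℤ) (f g : ℤ → ℂ) : ℂ :=
  (D.c : ℂ) * (((f J + g J) / 2 - (f (J - 1) + g (J - 1)) / 2) / (D.h 0 : ℂ))
    - (D.h 0 : ℂ) *
      ((5 / 12 : ℂ) * (Complex.I * (D.hbar : ℂ) * ((f J - g J) / (D.tau : ℂ))
          - (v : ℂ) * ((f J + g J) / 2))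
        + (1 / 12 : ℂ) * (Complex.I * (D.hbar : ℂ) * ((f (J - 1) - g (J - 1)) / (D.tau : ℂ))
          - (v : ℂ) * ((f (J - 1) + g (J - 1)) / 2)))

/-- The discrete TBC of the one-dimensional problem at the node `J`. -/
def ModeTBC (v : ℝ) (J : ℤ) (f g : ℕ → ℤ → ℂ) (m : ℕ) : Prop :=
  D.modeLeft v J (f m) (g m)
    = (D.c : ℂ) * ∑ p ∈ Finset.range (m + 1), D.kernelR v p * f (m - p) J

omit [NeZero n] in
-- Up to a common sign, `c a` is the coefficient of the lower time level in `iħ(f - g)/τ - v(f +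
-- g)/2`, and `c ā` that of the upper level.
theorem c_mul_aCoef (hc : D.c ≠ 0) (htau : D.tau ≠ 0) (v : ℝ) :
    (D.c : ℂ) * D.aCoef v = v / 2 + Complex.I * D.hbar / D.tau := by
  have h1 : (D.c : ℂ) ≠ 0 := by exact_mod_cast hc
  have h2 : (D.tau : ℂ) ≠ 0 := by exact_mod_cast htau
  rw [aCoef]; push_cast; field_simp

omit [NeZero n] in
theorem c_mul_conj_aCoef (hc : D.c ≠ 0) (htau : D.tau ≠ 0) (v : ℝ) :
    (D.c : ℂ) * conj (D.aCoef v) = v / 2 - Complex.I * D.hbar / D.tau := by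
  have h1 := congrArg conj (D.c_mul_aCoef hc htau v)
  rw [map_mul, Complex.conj_ofReal] at h1
  rw [h1]
  simp only [map_add, map_div₀, map_mul, Complex.conj_I, Complex.conj_ofReal, map_ofNat]
  ring

-- Multiplication by `X` passes to the previous time level, so a two-level expression in time is a
-- product with a linear polynomial.
open PowerSeries in
theorem coeff_succ_linear_mul (k l a b : ℂ) (W : PowerSeries ℂ) (m : ℕ) :
    coeff (m + 1) ((C k * (1 + PowerSeries.X) + C l * (C a + C b * PowerSeries.X)) * W)
      = (k + l * a) * coeff (m + 1) W + (k + l * b) * coeff m W := by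
  have : (C k * (1 + PowerSeries.X) + C l * (C a + C b * PowerSeries.X)) * W
    = C (k + l * a) * W + C (k + l * b) * (W * PowerSeries.X) := by
    simp only [map_add, map_mul]; ring
  rw [this, map_add, coeff_C_mul, coeff_C_mul, coeff_succ_mul_X]

open PowerSeries in
/-- The functions satisfying the discrete TBC have a square summable continuation to the half-line
satisfying the scheme with a constant potential. -/
theorem ModeTBC.exists_continuation {v : ℝ} {J : ℤ} {f g : ℕ → ℤ → ℂ} (hhbar : 0 < D.hbar)
    (hc : 0 < D.c) (htau : 0 < D.tau) (hh : 0 < D.h 0)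
    (hf0 : f 0 J = 0 ∧ f 0 (J - 1) = 0) :
    ∃ t : ℕ → ℕ → ℂ, (∀ m, (∀ l < m, g (l + 1) J = f l J ∧ g (l + 1) (J - 1) = f l (J - 1) ∧
        D.ModeTBC v J f g (l + 1)) → t m 0 = f m (J - 1)) ∧ (∀ m, t m 1 = f m J) ∧ (∀ k, t 0 k = 0) ∧
      (∀ m, Summable fun k => ‖t m k‖ ^ 2) ∧
      ∀ m k, Complex.I * (D.hbar : ℂ) * (1 / 12 * ((t (m + 1) k - t m k) / D.tau)
          + 5 / 6 * ((t (m + 1) (k + 1) - t m (k + 1)) / D.tau)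
          + 1 / 12 * ((t (m + 1) (k + 2) - t m (k + 2)) / D.tau))
        = -(D.c : ℂ) * ((((t (m + 1) (k + 2) + t m (k + 2)) / 2
              - (t (m + 1) (k + 1) + t m (k + 1)) / 2) / D.h 0
            - ((t (m + 1) (k + 1) + t m (k + 1)) / 2
              - (t (m + 1) k + t m k) / 2) / D.h 0) / D.h 0)
          + v * (1 / 12 * ((t (m + 1) k + t m k) / 2)
          + 5 / 6 * ((t (m + 1) (k + 1) + t m (k + 1)) / 2)
          + 1 / 12 * ((t (m + 1) (k + 2) + t m (k + 2)) / 2)) := by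
  obtain ⟨r, p, ν, hr, hp, hr0, hν1, hν2, hν⟩ := D.exists_decaying_root hh v
    (by rw [aCoef_im]; positivity)
  have ha1 := D.c_mul_aCoef hc.ne' htau.ne' v
  have ha2 := D.c_mul_conj_aCoef hc.ne' htau.ne' v
  set R : PowerSeries ℂ := PowerSeries.mk (D.kernelR v)
  set Φ : PowerSeries ℂ := PowerSeries.mk fun m => f m J with hΦ
  set Φ' : PowerSeries ℂ := PowerSeries.mk fun m => f m (J - 1) with hΦ'
  have hh' : (D.h 0 : ℂ) ≠ 0 := by exact_mod_cast hh.ne'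
  have hc' : (D.c : ℂ) ≠ 0 := by exact_mod_cast hc.ne'
  have hr' : r = C (1 / (2 * D.h 0) : ℂ) * (1 + PowerSeries.X) + C (-(D.h 0 / 12) : ℂ)
      * (C (conj (D.aCoef v)) + C (D.aCoef v) * PowerSeries.X) := by
    rw [hr, map_neg]; ring
  have hri : r * r⁻¹ = 1 := PowerSeries.mul_inv_cancel r hr0
  -- `W` replaces the trace `Φ'` at `J - 1`. It is built from `Φ` alone, so the continuation exists
  -- before anything is known about the boundary condition, and agrees with `Φ'` up to the level to
  -- which that condition holds.
  set W := (p - R) * Φ * r⁻¹ with hW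
  -- The boundary condition at level `m`, read as a coefficient of `r Φ' = (p - R) Φ`; at level `0`
  -- both traces vanish.
  have hb : ∀ m, (∀ l < m, g (l + 1) J = f l J ∧ g (l + 1) (J - 1) = f l (J - 1) ∧
      D.ModeTBC v J f g (l + 1)) → coeff m (r * Φ') = coeff m ((p - R) * Φ) := by
    intro m hl
    rw [sub_mul, map_sub]
    rcases m with _ | m
    · have h1 : constantCoeff Φ = 0 := by
        rw [← coeff_zero_eq_constantCoeff_apply, hΦ, coeff_mk, hf0.1]
      have h2 : constantCoeff Φ' = 0 := by
        rw [← coeff_zero_eq_constantCoeff_apply, hΦ', coeff_mk, hf0.2]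
      simp [h1, h2]
    · have hRΦ : coeff (m + 1) (R * Φ)
          = ∑ p ∈ Finset.range (m + 1 + 1), D.kernelR v p * f (m + 1 - p) J := by
        rw [coeff_mul, Finset.Nat.sum_antidiagonal_eq_sum_range_succ_mk]
        simp [R, hΦ]
      rw [hr', hp, coeff_succ_linear_mul, coeff_succ_linear_mul, hRΦ]
      obtain ⟨hg1, hg2, h1⟩ := hl m (by omega)
      rw [ModeTBC, modeLeft, hg1, hg2] at h1
      apply mul_left_cancel₀ hc'
      rw [mul_sub, ← h1]
      simp only [hΦ, hΦ', coeff_mk]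
      have e1 : ∀ x y z w : ℂ, (D.c : ℂ) * ((1 / (2 * D.h 0) + z * conj (D.aCoef v)) * x
          + (1 / (2 * D.h 0) + z * D.aCoef v) * y) = D.c / (2 * D.h 0) * (x + y)
          + z * (D.c * conj (D.aCoef v)) * x + z * (D.c * D.aCoef v) * y := by intros; ring
      rw [e1 _ _ _ 0, e1 _ _ _ 0, ha1, ha2]
      have h2 : (D.tau : ℂ) ≠ 0 := by exact_mod_cast htau.ne'
      field_simp
      ring
  have hΦν : Φ = ν * W := by
    rw [hW]
    linear_combination -Φ * hri - Φ * r⁻¹ * hν2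
  have hWΦ : ∀ m, (∀ l < m, g (l + 1) J = f l J ∧ g (l + 1) (J - 1) = f l (J - 1) ∧
      D.ModeTBC v J f g (l + 1)) → coeff m W = f m (J - 1) := by
    intro m hl
    have e1 : W = ((p - R) * Φ - r * Φ') * r⁻¹ + Φ' := by
      rw [hW]; linear_combination Φ' * hri
    -- Causality: this coefficient involves only the defects of the boundary condition at levels up
    -- to `m`.
    have e2 : coeff m (((p - R) * Φ - r * Φ') * r⁻¹) = 0 := by
      rw [coeff_mul]
      refine Finset.sum_eq_zero fun x hx => ?_
      have hxm : x.1 ≤ m := by have := Finset.HasAntidiagonal.mem_antidiagonal.mp hx; omega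
      rw [map_sub, hb x.1 fun l hlx => hl l (by omega), sub_self, zero_mul]
    rw [e1, map_add, e2, zero_add, hΦ', coeff_mk]
  have hquad : r * (ν ^ 2 + 1) = 2 * p * ν := by
    linear_combination ν * hν1 - hν2
  -- The index `k` stands for the node `J - 1 + k`.
  refine ⟨fun m k => coeff m (ν ^ k * W), fun m hl => by simp [hWΦ m hl], fun m => ?_, fun k => ?_,
    fun m => Summable.norm_sq (summable_norm_coeff_pow_mul hν W m), fun m k => ?_⟩
  · beta_reduce
    rw [pow_one, ← hΦν, hΦ, coeff_mk]
  · beta_reduce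
    have h1 : coeff 0 W = 0 := by rw [hWΦ 0 (by simp), hf0.2]
    rw [coeff_zero_eq_constantCoeff_apply] at h1
    rw [coeff_zero_eq_constantCoeff_apply, map_mul, h1, mul_zero]
  · have h1 : r * (ν ^ (k + 2) * W) + r * (ν ^ k * W) = 2 * (p * (ν ^ (k + 1) * W)) := by
      linear_combination ν ^ k * W * hquad
    have h2 := congrArg (coeff (m + 1)) h1
    rw [two_mul, map_add, map_add, hr', hp, coeff_succ_linear_mul, coeff_succ_linear_mul,
      coeff_succ_linear_mul] at h2
    beta_reduce
    generalize coeff (m + 1) (ν ^ (k + 2) * W) = x2 at *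
    generalize coeff (m + 1) (ν ^ (k + 1) * W) = x1 at *
    generalize coeff (m + 1) (ν ^ k * W) = x0 at *
    generalize coeff m (ν ^ (k + 2) * W) = y2 at *
    generalize coeff m (ν ^ (k + 1) * W) = y1 at *
    generalize coeff m (ν ^ k * W) = y0 at *
    have h3 : (x2 + y2 - 2 * (x1 + y1) + (x0 + y0)) / (2 * D.h 0)
        = D.h 0 / 12 * (conj (D.aCoef v) * (x2 + 10 * x1 + x0)
          + D.aCoef v * (y2 + 10 * y1 + y0)) := by
      linear_combination h2
    have h4 : (D.c : ℂ) * ((x2 + y2 - 2 * (x1 + y1) + (x0 + y0)) / (2 * D.h 0)) / D.h 0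
        = 1 / 12 * ((D.c * conj (D.aCoef v)) * (x2 + 10 * x1 + x0)
          + (D.c * D.aCoef v) * (y2 + 10 * y1 + y0)) := by
      rw [h3]; field_simp
    rw [ha1, ha2] at h4
    linear_combination h4

end

end SplittingData

/-! ### Energy of one mode with the transparent boundary condition. -/

theorem tsum_norm_sq_split {φ : ℤ → ℂ} {s : ℕ → ℂ} {J : ℕ} (hs : Summable fun i => ‖s i‖ ^ 2)
    (h : ∀ i : ℕ, φ (i + J + 1) = s i) :
    (Summable fun i : ℕ => ‖φ (i + 1)‖ ^ 2) ∧
      ∑' i : ℕ, ‖φ (i + 1)‖ ^ 2 = ∑ j ∈ Finset.Icc (1 : ℤ) J, ‖φ j‖ ^ 2 + ∑' i, ‖s i‖ ^ 2 := by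
  have h1 : ∀ i : ℕ, ‖φ (((i + J : ℕ) : ℤ) + 1)‖ ^ 2 = ‖s i‖ ^ 2 := fun i => by
    rw [← h]; push_cast; rfl
  have h2 : Summable fun i : ℕ => ‖φ (i + 1)‖ ^ 2 :=
    (summable_nat_add_iff J).mp (hs.congr fun i => (h1 i).symm)
  refine ⟨h2, ?_⟩
  rw [← h2.sum_add_tsum_nat_add J, sum_Icc_one_eq_sum_range]
  simp only [h1]

namespace SplittingData

variable {n : ℕ} [NeZero n] (D : SplittingData n)

/-- Energy estimate for the one-dimensional problem with the discrete TBC: the norm on the finite mesh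
is complemented by the energy of the continuation. -/
theorem ModeTBC.exists_tail_energy {vinf : ℝ} {J : ℕ} (hJ : 1 ≤ J) {f g : ℕ → ℤ → ℂ}
    (hhbar : 0 < D.hbar) (hc : 0 < D.c) (htau : 0 < D.tau) (hh : 0 < D.h 0)
    (hf0 : f 0 J = 0 ∧ f 0 (J - 1) = 0) :
    ∃ T : ℕ → ℝ, (∀ m, 0 ≤ T m) ∧ T 0 = 0 ∧ ∀ (m : ℕ) (v : ℤ → ℝ) (G : ℤ → ℂ),
      (∀ l < m + 1, g (l + 1) J = f l J ∧ g (l + 1) (J - 1) = f l (J - 1) ∧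
        D.ModeTBC vinf J f g (l + 1)) →
      (∀ j ≥ (J : ℤ) - 1, v j = vinf) → f (m + 1) 0 = 0 → g (m + 1) 0 = 0 →
      (∀ j ∈ Finset.Icc (1 : ℤ) (J - 1),
        StepEq D.hbar D.tau D.c (D.h 0) v (f (m + 1)) (g (m + 1)) G j) →
      Real.sqrt (∑ j ∈ Finset.Icc (1 : ℤ) J, ‖f (m + 1) j‖ ^ 2 + T (m + 1))
        ≤ Real.sqrt (∑ j ∈ Finset.Icc (1 : ℤ) J, ‖g (m + 1) j‖ ^ 2 + T m)
          + 3 * D.tau / (2 * D.hbar) *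
            Real.sqrt (∑ j ∈ Finset.Icc (1 : ℤ) (J - 1), ‖G j‖ ^ 2) := by
  obtain ⟨t, ht0, ht1, htz, hts, heq⟩ :=
    ModeTBC.exists_continuation D hhbar hc htau (g := g) (v := vinf) hh hf0
  -- The tail energy counts the nodes from `J + 1` on, which are the indices `k ≥ 2` of the
  -- continuation.
  refine ⟨fun m => ∑' i : ℕ, ‖t m (i + 2)‖ ^ 2, fun m => tsum_nonneg fun i => by positivity,
    by simp [htz], fun m v G hl hv hfz hgz hstep => ?_⟩
  have ht0' := ht0 m fun l hlm => hl l (by omega)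
  replace ht0 := ht0 (m + 1) hl
  have hg := hl m (by omega)
  -- Gluing with the continuation. The lower level `ge` takes the tail of level `m`, because `g (m +
  -- 1) = f m` at the nodes `J - 1` and `J`.
  let fe : ℤ → ℂ := fun j => if j ≤ J then f (m + 1) j else t (m + 1) (j - J + 1).toNat
  let ge : ℤ → ℂ := fun j => if j ≤ J then g (m + 1) j else t m (j - J + 1).toNat
  let Ge : ℤ → ℂ := fun j => if j ∈ Finset.Icc (1 : ℤ) (J - 1) then G j else 0
  -- The potential is changed outside `[0, J]` so that it is bounded.
  let ve : ℤ → ℝ := fun j => if j ∈ Finset.Icc (0 : ℤ) J then v j else vinf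
  have hfe : ∀ j : ℤ, j ≤ J → fe j = f (m + 1) j := fun j hj => if_pos hj
  have hge : ∀ j : ℤ, j ≤ J → ge j = g (m + 1) j := fun j hj => if_pos hj
  have hfet : ∀ k : ℕ, fe (J - 1 + k) = t (m + 1) k := by
    rintro (_ | _ | k)
    · rw [hfe _ (by push_cast; omega), ht0]; simp
    · rw [hfe _ (by push_cast; omega), ht1]; congr 1; push_cast; ring
    · simp only [fe]; rw [if_neg (by push_cast; omega)]; congr 1; push_cast; omega
  have hget : ∀ k : ℕ, ge (J - 1 + k) = t m k := by
    rintro (_ | _ | k)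
    · rw [hge _ (by push_cast; omega), ht0', ← hg.2.1]; simp
    · rw [hge _ (by push_cast; omega), ht1, ← hg.1]; congr 1; push_cast; ring
    · simp only [ge]; rw [if_neg (by push_cast; omega)]; congr 1; push_cast; omega
  have hsf := tsum_norm_sq_split (φ := fe) (J := J) ((summable_nat_add_iff 2).mpr (hts (m + 1)))
    fun i => by rw [← hfet]; congr 1; push_cast; ring
  have hsg := tsum_norm_sq_split (φ := ge) (J := J) ((summable_nat_add_iff 2).mpr (hts m))
    fun i => by rw [← hget]; congr 1; push_cast; ring
  have hsG := tsum_norm_sq_split (φ := Ge) (J := J) (s := fun _ => 0) (by simp)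
    fun i => if_neg (by simp only [Finset.mem_Icc]; omega)
  have hbound : ∀ j, |ve j| ≤ ∑ i ∈ Finset.Icc (0 : ℤ) J, |v i| + |vinf| := by
    intro j
    simp only [ve]
    split_ifs with hj
    · have := Finset.single_le_sum (f := fun i => |v i|) (fun i _ => abs_nonneg _) hj
      have := abs_nonneg vinf
      linarith
    · have : 0 ≤ ∑ i ∈ Finset.Icc (0 : ℤ) J, |v i| := Finset.sum_nonneg fun i _ => abs_nonneg _
      linarith
  have hve : ∀ j : ℤ, 0 ≤ j → j ≤ J → ve j = v j := fun j h0 h1 =>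
    if_pos (Finset.mem_Icc.mpr ⟨h0, h1⟩)
  have hvet : ∀ j : ℤ, (J : ℤ) - 1 ≤ j → ve j = vinf := fun j h0 => by
    simp only [ve]; split_ifs
    · exact hv j h0
    · rfl
  have key := StepEq.norm_le (c := D.c) hhbar htau hh hbound (f := fe) (g := ge) (G := Ge)
    ((hfe 0 (by omega)).trans hfz) ((hge 0 (by omega)).trans hgz) hsf.1 hsg.1 hsG.1 ?_
  · rw [hsf.2, hsg.2, hsG.2] at key
    have e1 : ∑ j ∈ Finset.Icc (1 : ℤ) J, ‖fe j‖ ^ 2 = ∑ j ∈ Finset.Icc (1 : ℤ) J, ‖f (m + 1) j‖ ^ 2 :=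
      Finset.sum_congr rfl fun j hj => by rw [hfe j (Finset.mem_Icc.mp hj).2]
    have e2 : ∑ j ∈ Finset.Icc (1 : ℤ) J, ‖ge j‖ ^ 2 = ∑ j ∈ Finset.Icc (1 : ℤ) J, ‖g (m + 1) j‖ ^ 2 :=
      Finset.sum_congr rfl fun j hj => by rw [hge j (Finset.mem_Icc.mp hj).2]
    have e3 : ∑ j ∈ Finset.Icc (1 : ℤ) J, ‖Ge j‖ ^ 2
        = ∑ j ∈ Finset.Icc (1 : ℤ) (J - 1), ‖G j‖ ^ 2 := by
      rw [← Finset.sum_subset (Finset.Icc_subset_Icc_right (by omega : (J : ℤ) - 1 ≤ J))]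
      · exact Finset.sum_congr rfl fun j hj => by simp only [Ge]; rw [if_pos hj]
      · intro j _ hj
        simp only [Ge]; rw [if_neg hj]; simp
    rw [e1, e2, e3] at key
    simp only [norm_zero, ne_eq, OfNat.ofNat_ne_zero, not_false_eq_true, zero_pow, tsum_zero,
      add_zero] at key
    exact key
  · intro j hj
    -- Below `J` this is the given equation; from `J` on it is the equation of the continuation,
    -- whose stencil at `J` starts at `J - 1`.
    rcases lt_or_ge j J with hjJ | hjJ
    · have h1 := hstep j (Finset.mem_Icc.mpr ⟨hj, by omega⟩)
      simp only [StepEq, numerov, secondDiff] at h1 ⊢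
      rw [hfe _ (by omega : j ≤ J), hfe _ (by omega : j - 1 ≤ J), hfe _ (by omega : j + 1 ≤ J),
        hge _ (by omega : j ≤ J), hge _ (by omega : j - 1 ≤ J), hge _ (by omega : j + 1 ≤ J),
        hve _ (by omega) (by omega : j ≤ J), hve _ (by omega) (by omega : j - 1 ≤ J),
        hve _ (by omega) (by omega : j + 1 ≤ J), h1]
      simp only [Ge]
      rw [if_pos (Finset.mem_Icc.mpr ⟨hj, by omega⟩)]
    · obtain ⟨k, rfl⟩ : ∃ k : ℕ, j = J - 1 + (k + 1 : ℕ) := ⟨(j - J).toNat, by push_cast; omega⟩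
      have h1 := heq m k
      have e1 : (J : ℤ) - 1 + (k + 1 : ℕ) - 1 = J - 1 + k := by push_cast; ring
      have e2 : (J : ℤ) - 1 + (k + 1 : ℕ) + 1 = J - 1 + (k + 2 : ℕ) := by push_cast; ring
      have e3 : Ge (J - 1 + (k + 1 : ℕ)) = 0 :=
        if_neg (by simp only [Finset.mem_Icc]; push_cast; omega)
      simp only [StepEq, numerov, secondDiff, e1, e2, e3, hfet, hget]
      rw [hvet _ (by omega), hvet _ (by omega), hvet _ (by omega), h1]
      ring

end SplittingData

/-! ### Solvability of one mode at one time level. -/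

/-- Extension by zero of a vector of values at the nodes `1, …, J`. -/
def extendNodes (J : ℕ) : (Fin J → ℂ) →ₗ[ℂ] (ℤ → ℂ) where
  toFun x j := if h : 1 ≤ j ∧ j ≤ J then x ⟨(j - 1).toNat, by omega⟩ else 0
  map_add' x y := by funext j; simp only [Pi.add_apply]; split_ifs <;> simp
  map_smul' a x := by
    funext j; simp only [Pi.smul_apply, smul_eq_mul, RingHom.id_apply]; split_ifs <;> simp

theorem extendNodes_zero_index (J : ℕ) (x : Fin J → ℂ) : extendNodes J x 0 = 0 :=
  by simp [extendNodes]

theorem extendNodes_succ (J : ℕ) (x : Fin J → ℂ) (i : Fin J) :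
    extendNodes J x ((i : ℤ) + 1) = x i := by
  refine (dif_pos (by omega)).trans ?_
  congr 1; ext; simp

namespace SplittingData

noncomputable section

variable {n : ℕ} [NeZero n] (D : SplittingData n)

/-- The part of the one-dimensional equation which is linear in the upper level. -/
def stepLin (v : ℤ → ℝ) (f : ℤ → ℂ) (j : ℤ) : ℂ :=
  Complex.I * (D.hbar : ℂ) * numerov (fun i => f i / (D.tau : ℂ)) j
    + (D.c : ℂ) * secondDiff (D.h 0) (fun i => f i / 2) j - numerov (fun i => (v i : ℂ) * (f i / 2)) j

/-- The matrix of the one-dimensional problem at one time level. -/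
def levelMap (J : ℕ) (vinf : ℝ) (v : ℤ → ℝ) : (Fin J → ℂ) →ₗ[ℂ] (Fin J → ℂ) where
  -- The row of the last node carries the boundary condition, in which only the kernel term of index
  -- `0` meets the unknown level.
  toFun x i := if (i : ℤ) + 1 < J then D.stepLin v (extendNodes J x) (i + 1) else
    D.modeLeft vinf J (extendNodes J x) 0 - D.c * (D.kernelR vinf 0 * extendNodes J x J)
  map_add' x y := by
    funext i
    simp only [map_add, Pi.add_apply, stepLin, modeLeft, numerov, secondDiff, Pi.zero_apply]
    split_ifs <;> ring
  map_smul' a x := by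
    funext i
    simp only [map_smul, Pi.smul_apply, smul_eq_mul, stepLin, modeLeft, numerov, secondDiff,
      RingHom.id_apply, Pi.zero_apply]
    split_ifs <;> ring

/-- A kernel vector is the first level of a solution with zero past and zero free term, so the
energy estimate with `T 0 = 0` kills it. -/
theorem levelMap_injective {J : ℕ} (hJ : 1 ≤ J) (hhbar : 0 < D.hbar) (hc : 0 < D.c)
    (htau : 0 < D.tau) (hh : 0 < D.h 0) {vinf : ℝ} {v : ℤ → ℝ}
    (hv : ∀ j ≥ (J : ℤ) - 1, v j = vinf) : Function.Injective (D.levelMap J vinf v) := by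
  rw [injective_iff_map_eq_zero]
  intro x hx
  have hcomp : ∀ i : Fin J, D.levelMap J vinf v x i = 0 := fun i => congrFun hx i
  let fs : ℕ → ℤ → ℂ := fun m => if m = 1 then extendNodes J x else 0
  have hfs1 : fs 1 = extendNodes J x := rfl
  have hfs0 : fs 0 = 0 := rfl
  obtain ⟨T, hT, hT0, henergy⟩ := ModeTBC.exists_tail_energy D (vinf := vinf) hJ (f := fs)
    (g := fun _ => 0) hhbar hc htau hh (by simp [hfs0])
  have h1 := henergy 0 v 0 ?_ hv (by rw [zero_add, hfs1, extendNodes_zero_index]) rfl ?_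
  · rw [zero_add, hfs1, hT0] at h1
    simp only [Pi.zero_apply, norm_zero, ne_eq, OfNat.ofNat_ne_zero, not_false_eq_true, zero_pow,
      Finset.sum_const_zero, add_zero, Real.sqrt_zero, mul_zero] at h1
    have h2 := Real.sqrt_eq_zero'.mp (le_antisymm h1 (Real.sqrt_nonneg _))
    have h3 : ∑ j ∈ Finset.Icc (1 : ℤ) J, ‖extendNodes J x j‖ ^ 2 = 0 := by
      have := hT 1
      have : 0 ≤ ∑ j ∈ Finset.Icc (1 : ℤ) J, ‖extendNodes J x j‖ ^ 2 := by positivity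
      linarith
    rw [Finset.sum_eq_zero_iff_of_nonneg fun j _ => by positivity] at h3
    funext i
    have h4 := h3 (i + 1) (Finset.mem_Icc.mpr ⟨by omega, by omega⟩)
    rw [extendNodes_succ] at h4
    simpa using h4
  · intro l hl
    obtain rfl : l = 0 := by omega
    refine ⟨by simp [hfs0], by simp [hfs0], ?_⟩
    have h2 := hcomp ⟨J - 1, by omega⟩
    simp only [levelMap, LinearMap.coe_mk, AddHom.coe_mk] at h2
    rw [if_neg (by push_cast [Nat.cast_sub hJ]; omega), sub_eq_zero] at h2
    rw [ModeTBC, zero_add, hfs1, h2]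
    simp [Finset.sum_range_succ, hfs1, hfs0]
  · intro j hj
    rw [Finset.mem_Icc] at hj
    have h2 := hcomp ⟨(j - 1).toNat, by omega⟩
    have e1 : (((j - 1).toNat : ℕ) : ℤ) + 1 = j := by omega
    simp only [levelMap, LinearMap.coe_mk, AddHom.coe_mk, e1] at h2
    rw [if_pos (by omega)] at h2
    rw [zero_add, hfs1]
    simp only [StepEq, stepLin, numerov, secondDiff, Pi.zero_apply, sub_zero, add_zero] at h2 ⊢
    linear_combination h2

/-- Solvability of the one-dimensional problem at one time level. -/
theorem exists_mode_step {J : ℕ} (hJ : 1 ≤ J) (hhbar : 0 < D.hbar) (hc : 0 < D.c)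
    (htau : 0 < D.tau) (hh : 0 < D.h 0) {vinf : ℝ} {v : ℤ → ℝ}
    (hv : ∀ j ≥ (J : ℤ) - 1, v j = vinf) (g G : ℤ → ℂ) (K : ℂ) :
    ∃ f : ℤ → ℂ, f 0 = 0 ∧
      (∀ j ∈ Finset.Icc (1 : ℤ) (J - 1), StepEq D.hbar D.tau D.c (D.h 0) v f g G j) ∧
      D.modeLeft vinf J f g = D.c * (D.kernelR vinf 0 * f J + K) := by
  -- The system is square: `J` unknowns, `J - 1` interior equations and one boundary condition.
  have hsurj := LinearMap.injective_iff_surjective.mp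
    (D.levelMap_injective hJ hhbar hc htau hh hv)
  obtain ⟨x, hx⟩ := hsurj fun i => if (i : ℤ) + 1 < J then
      Complex.I * (D.hbar : ℂ) * numerov (fun i => g i / (D.tau : ℂ)) (i + 1)
        - (D.c : ℂ) * secondDiff (D.h 0) (fun i => g i / 2) (i + 1)
        + numerov (fun i => (v i : ℂ) * (g i / 2)) (i + 1) + G (i + 1)
    else D.c * K - D.modeLeft vinf J 0 g
  refine ⟨extendNodes J x, extendNodes_zero_index J x, fun j hj => ?_, ?_⟩
  · rw [Finset.mem_Icc] at hj
    have h2 := congrFun hx ⟨(j - 1).toNat, by omega⟩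
    have e1 : (((j - 1).toNat : ℕ) : ℤ) + 1 = j := by omega
    simp only [levelMap, LinearMap.coe_mk, AddHom.coe_mk, e1] at h2
    rw [if_pos (by omega), if_pos (by omega)] at h2
    simp only [StepEq, stepLin, numerov, secondDiff] at h2 ⊢
    linear_combination h2
  · have h2 := congrFun hx ⟨J - 1, by omega⟩
    simp only [levelMap, LinearMap.coe_mk, AddHom.coe_mk] at h2
    rw [if_neg (by push_cast [Nat.cast_sub hJ]; omega),
      if_neg (by push_cast [Nat.cast_sub hJ]; omega)] at h2
    simp only [modeLeft, Pi.zero_apply] at h2 ⊢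
    linear_combination h2

end

end SplittingData

/-! ### Orthogonality of the discrete sines. -/

theorem two_sin_half_mul_sum_cos (θ : ℝ) (N : ℕ) :
    2 * Real.sin (θ / 2) * ∑ i ∈ Finset.range N, Real.cos (((i : ℝ) + 1) * θ)
      = Real.sin ((N + 1 / 2) * θ) - Real.sin (θ / 2) := by
  induction N with
  | zero => simp; ring_nf
  | succ N ih =>
    rw [Finset.sum_range_succ, mul_add, ih]
    have h := Real.sin_sub_sin ((((N + 1 : ℕ) : ℝ) + 1 / 2) * θ) ((N + 1 / 2) * θ)
    have e1 : ((((N + 1 : ℕ) : ℝ) + 1 / 2) * θ - (N + 1 / 2) * θ) / 2 = θ / 2 := by push_cast; ring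
    have e2 : ((((N + 1 : ℕ) : ℝ) + 1 / 2) * θ + (N + 1 / 2) * θ) / 2 = ((N : ℝ) + 1) * θ := by
      push_cast; ring
    rw [e1, e2] at h
    linarith

/-- The sum telescopes after multiplication by `2 sin(θ/2)` with `θ = πk/J`; the divisibility
hypothesis says exactly that this factor is nonzero. -/
theorem sum_cos_pi_mul_div {J : ℕ} {k : ℤ} (h : ¬ (2 * (J : ℤ) ∣ k)) (hJ : 1 ≤ J) :
    ∑ j ∈ Finset.Icc (1 : ℤ) (J - 1), Real.cos (Real.pi * k * j / J)
      = -(1 + Real.cos (Real.pi * k)) / 2 := by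
  have hJ' : (J : ℝ) ≠ 0 := by positivity
  have hs : Real.sin (Real.pi * k / J / 2) ≠ 0 := by
    rw [Ne, Real.sin_eq_zero_iff]
    rintro ⟨m, hm⟩
    apply h
    refine ⟨m, ?_⟩
    have h1 : (k : ℝ) = 2 * J * m := by
      field_simp at hm
      linarith
    exact_mod_cast h1
  have h1 := two_sin_half_mul_sum_cos (Real.pi * k / J) (J - 1)
  have e1 : (((J - 1 : ℕ) : ℝ) + 1 / 2) * (Real.pi * k / J)
      = k * Real.pi - Real.pi * k / J / 2 := by
    push_cast [Nat.cast_sub hJ]; field_simp; ring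
  rw [e1, Real.sin_sub, Real.sin_int_mul_pi, zero_mul, zero_sub] at h1
  have e2 : ((J : ℤ) - 1) = ((J - 1 : ℕ) : ℤ) := by push_cast [Nat.cast_sub hJ]; rfl
  rw [e2, sum_Icc_one_eq_sum_range]
  have e3 : ∀ i : ℕ, Real.cos (Real.pi * k * ((i + 1 : ℤ) : ℝ) / J)
    = Real.cos (((i : ℝ) + 1) * (Real.pi * k / J)) := fun i => by congr 1; push_cast; ring
  simp only [e3]
  apply mul_left_cancel₀ (mul_ne_zero two_ne_zero hs)
  rw [h1, mul_comm (k : ℝ)]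
  ring

/-- Product-to-sum formula: `q - p` and `q + p` have the same parity, so for `q ≠ p` the two cosine
sums coincide and cancel. -/
theorem sum_sin_mul_sin {J : ℕ} {q p : ℤ} (hq : q ∈ Finset.Icc (1 : ℤ) (J - 1))
    (hp : p ∈ Finset.Icc (1 : ℤ) (J - 1)) :
    ∑ j ∈ Finset.Icc (1 : ℤ) (J - 1), Real.sin (Real.pi * q * j / J) * Real.sin (Real.pi * p * j / J)
      = if q = p then (J : ℝ) / 2 else 0 := by
  rw [Finset.mem_Icc] at hq hp
  have hJ : 1 ≤ J := by omega
  have h1 : ∀ j : ℤ, Real.sin (Real.pi * q * j / J) * Real.sin (Real.pi * p * j / J)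
      = (Real.cos (Real.pi * ((q - p : ℤ) : ℝ) * j / J)
        - Real.cos (Real.pi * ((q + p : ℤ) : ℝ) * j / J)) / 2 := by
    intro j
    have e1 : Real.pi * ((q - p : ℤ) : ℝ) * j / J = Real.pi * q * j / J - Real.pi * p * j / J := by
      push_cast; ring
    have e2 : Real.pi * ((q + p : ℤ) : ℝ) * j / J = Real.pi * q * j / J + Real.pi * p * j / J := by
      push_cast; ring
    rw [e1, e2, Real.cos_sub, Real.cos_add]; ring
  simp only [h1]
  rw [← Finset.sum_div, Finset.sum_sub_distrib]
  have hnd : ∀ k : ℤ, k ≠ 0 → |k| < 2 * J → ¬ (2 * (J : ℤ) ∣ k) := fun k h0 hk hd =>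
    h0 (Int.eq_zero_of_abs_lt_dvd hd hk)
  rw [sum_cos_pi_mul_div (hnd (q + p) (by omega) (by rw [abs_lt]; omega)) hJ]
  split_ifs with h
  · subst h
    have : Real.cos (Real.pi * ((q + q : ℤ) : ℝ)) = 1 := by
      have : Real.pi * ((q + q : ℤ) : ℝ) = q * (2 * Real.pi) := by push_cast; ring
      rw [this, Real.cos_int_mul_two_pi]
    rw [this]
    have hcard : ((Finset.Icc (1 : ℤ) (J - 1)).card : ℝ) = J - 1 := by
      rw [Int.card_Icc]
      have : ((J : ℤ) - 1 + 1 - 1).toNat = J - 1 := by omega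
      rw [this, Nat.cast_sub hJ]; simp
    simp only [sub_self, Int.cast_zero, mul_zero, zero_mul, zero_div, Real.cos_zero,
      Finset.sum_const, nsmul_eq_mul, hcard]
    ring
  · rw [sum_cos_pi_mul_div (hnd (q - p) (by omega) (by rw [abs_lt]; omega)) hJ]
    have : Real.cos (Real.pi * ((q - p : ℤ) : ℝ)) = Real.cos (Real.pi * ((q + p : ℤ) : ℝ)) := by
      push_cast
      rw [mul_sub, mul_add, Real.cos_sub, Real.cos_add, mul_comm Real.pi (p : ℝ),
        Real.sin_int_mul_pi]
      ring
    rw [this]; ring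

/-! ### Slabs of the mesh and Fourier coefficients. -/

namespace SplittingData

noncomputable section

variable {n : ℕ} [NeZero n] (D : SplittingData n)

/-- The nodes with the first index `t` and the other indices internal. -/
def slab (t : ℤ) : Finset (Fin n → ℤ) :=
  Fintype.piFinset fun k => if k = 0 then {t} else Finset.Icc (1 : ℤ) ((D.J k : ℤ) - 1)

theorem mem_slab {t : ℤ} {j : Fin n → ℤ} :
    j ∈ D.slab t ↔ j 0 = t ∧ ∀ k ≠ 0, j k ∈ Finset.Icc (1 : ℤ) ((D.J k : ℤ) - 1) := by
  rw [slab, Fintype.mem_piFinset]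
  constructor
  · intro h
    exact ⟨by simpa using h 0, fun k hk => by simpa [hk] using h k⟩
  · rintro ⟨h0, h⟩ k
    by_cases hk : k = 0
    · subst hk; simp [h0]
    · simpa [hk] using h k hk

theorem meshGamma1_eq : D.meshGamma1 = D.slab (D.J 0) := by
  ext j
  rw [mem_slab, meshGamma1, Fintype.mem_piFinset]
  constructor
  · intro h
    exact ⟨by simpa using h 0, fun k hk => by simpa [hk] using h k⟩
  · rintro ⟨h0, h⟩ k
    by_cases hk : k = 0
    · subst hk; simp [h0]
    · simpa [hk] using h k hk

theorem mem_meshInner_iff {j : Fin n → ℤ} : j ∈ D.meshInner ↔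
    j 0 ∈ Finset.Icc (1 : ℤ) ((D.J 0 : ℤ) - 1) ∧ j ∈ D.slab (j 0) := by
  rw [mem_slab, meshInner, Fintype.mem_piFinset]
  constructor
  · intro h
    exact ⟨h 0, rfl, fun k _ => h k⟩
  · rintro ⟨h0, -, h⟩ k
    by_cases hk : k = 0
    · subst hk; exact h0
    · exact h k hk

theorem update_mem_slab {s t : ℤ} {b : Fin n → ℤ} (hb : b ∈ D.slab s) :
    Function.update b 0 t ∈ D.slab t := by
  rw [mem_slab] at hb ⊢
  exact ⟨by simp, fun k hk => by rw [Function.update_of_ne hk]; exact hb.2 k hk⟩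

theorem sum_slab {M : Type*} [AddCommMonoid M] (φ : (Fin n → ℤ) → M) (s t : ℤ) :
    ∑ j ∈ D.slab t, φ j = ∑ b ∈ D.slab s, φ (Function.update b 0 t) := by
  refine Finset.sum_nbij' (fun j => Function.update j 0 s) (fun b => Function.update b 0 t)
    (fun j hj => D.update_mem_slab hj) (fun j hj => D.update_mem_slab hj) ?_ ?_ ?_
  · intro j hj
    rw [Function.update_idem, ← (D.mem_slab.mp hj).1, Function.update_eq_self]
  · intro j hj
    rw [Function.update_idem, ← (D.mem_slab.mp hj).1, Function.update_eq_self]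
  · intro j hj
    rw [Function.update_idem, ← (D.mem_slab.mp hj).1, Function.update_eq_self]

theorem sum_meshInner {M : Type*} [AddCommMonoid M] (φ : (Fin n → ℤ) → M) :
    ∑ j ∈ D.meshInner, φ j = ∑ t ∈ Finset.Icc (1 : ℤ) ((D.J 0 : ℤ) - 1),
      ∑ b ∈ D.slab 0, φ (Function.update b 0 t) := by
  rw [← Finset.sum_fiberwise_of_maps_to (g := fun j : Fin n → ℤ => j 0)
    fun j hj => (D.mem_meshInner_iff.mp hj).1]
  refine Finset.sum_congr rfl fun t ht => ?_
  rw [← D.sum_slab φ 0 t]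
  refine Finset.sum_congr ?_ fun _ _ => rfl
  ext j
  rw [Finset.mem_filter, mem_meshInner_iff]
  constructor
  · rintro ⟨⟨-, h⟩, rfl⟩; exact h
  · intro h
    have := (D.mem_slab.mp h).1
    subst this
    exact ⟨⟨ht, h⟩, rfl⟩

/-- The directions perpendicular to the leading axis, as a finite set. -/
abbrev perpSet (n : ℕ) [NeZero n] : Finset (Fin n) := Finset.univ.filter fun k : Fin n => k ≠ 0

/-- The product of sines, as a function of the frequencies `q` and the node `j`. -/
def sinMode (q j : Fin n → ℤ) : ℝ :=
  ∏ k ∈ perpSet n, Real.sin (Real.pi * q k * j k / D.J k)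

theorem sinMode_comm (q j : Fin n → ℤ) : D.sinMode q j = D.sinMode j q :=
  Finset.prod_congr rfl fun k _ => by congr 1; ring

theorem sinMode_update_zero (q j : Fin n → ℤ) (t : ℤ) :
    D.sinMode q (Function.update j 0 t) = D.sinMode q j :=
  Finset.prod_congr rfl fun k hk => by rw [Function.update_of_ne (Finset.mem_filter.mp hk).2]

theorem sinMode_eq_zero {q j : Fin n → ℤ} {k : Fin n} (hk : k ≠ 0) (hJ : D.J k ≠ 0)
    (h : j k = 0 ∨ j k = D.J k) : D.sinMode q j = 0 := by
  refine Finset.prod_eq_zero (Finset.mem_filter.mpr ⟨Finset.mem_univ k, hk⟩) ?_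
  rcases h with h | h
  · simp [h]
  · have hJ' : (D.J k : ℝ) ≠ 0 := by exact_mod_cast hJ
    have : Real.pi * q k * (j k : ℝ) / D.J k = q k * Real.pi := by
      rw [h]; push_cast; field_simp
    rw [this, Real.sin_int_mul_pi]

/-- The square of the norm of a product of sines. -/
def modeWeight : ℝ := ∏ k ∈ perpSet n, ((D.J k : ℝ) / 2)

/-- `slab 0` also serves as the set of frequencies, with a dummy first index `0`. The sum over a
slab factors into one-dimensional sums, the leading direction contributing `1`. -/
theorem sum_sinMode_mul_sinMode {q p : Fin n → ℤ} (hq : q ∈ D.slab 0) (hp : p ∈ D.slab 0) :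
    ∑ b ∈ D.slab 0, D.sinMode q b * D.sinMode p b = if q = p then D.modeWeight else 0 := by
  have h1 : ∀ b : Fin n → ℤ, D.sinMode q b * D.sinMode p b = ∏ k, if k ≠ 0 then
      Real.sin (Real.pi * q k * b k / D.J k) * Real.sin (Real.pi * p k * b k / D.J k) else 1 := by
    intro b
    rw [sinMode, sinMode, ← Finset.prod_mul_distrib, Finset.prod_filter]
  simp only [h1]
  rw [slab, ← Finset.prod_univ_sum (f := fun k (x : ℤ) => if k ≠ 0 then
      Real.sin (Real.pi * q k * x / D.J k) * Real.sin (Real.pi * p k * x / D.J k) else 1)]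
  have h2 : ∀ k : Fin n, (∑ x ∈ (if k = 0 then {(0 : ℤ)} else Finset.Icc (1 : ℤ) ((D.J k : ℤ) - 1)),
      if k ≠ 0 then
        Real.sin (Real.pi * q k * x / D.J k) * Real.sin (Real.pi * p k * x / D.J k) else 1)
      = if k ≠ 0 then (if q k = p k then (D.J k : ℝ) / 2 else 0) else 1 := by
    intro k
    by_cases hk : k = 0
    · simp [hk]
    · simp only [hk, if_false, ne_eq, not_false_eq_true, if_true]
      exact sum_sin_mul_sin ((D.mem_slab.mp hq).2 k hk) ((D.mem_slab.mp hp).2 k hk)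
  simp only [h2]
  rw [← Finset.prod_filter]
  split_ifs with h
  · subst h; simp [modeWeight]
  · obtain ⟨k, hk⟩ := Function.ne_iff.mp h
    have hk0 : k ≠ 0 := by
      rintro rfl
      exact hk ((D.mem_slab.mp hq).1.trans (D.mem_slab.mp hp).1.symm)
    exact Finset.prod_eq_zero (Finset.mem_filter.mpr ⟨Finset.mem_univ k, hk0⟩) (if_neg hk)

/-- The Fourier coefficients of a mesh function on the slab with the first index `t`. -/
def coef (W : GridFun n) (q : Fin n → ℤ) (t : ℤ) : ℂ :=
  ((D.modeWeight)⁻¹ : ℂ) * ∑ b ∈ D.slab 0, W (Function.update b 0 t) * (D.sinMode q b : ℂ)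

theorem modeWeight_pos (hJ : ∀ k, 1 ≤ D.J k) : 0 < D.modeWeight :=
  Finset.prod_pos fun k _ => by have : (1 : ℝ) ≤ D.J k := by exact_mod_cast hJ k
                                positivity

/-- By orthogonality a sine expansion determines its coefficients. -/
theorem coef_eq (hJ : ∀ k, 1 ≤ D.J k) {W : GridFun n} {A : (Fin n → ℤ) → ℂ} {t : ℤ}
    (h : ∀ b ∈ D.slab 0, W (Function.update b 0 t) = ∑ q ∈ D.slab 0, A q * (D.sinMode q b : ℂ))
    {q : Fin n → ℤ} (hq : q ∈ D.slab 0) : D.coef W q t = A q := by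
  have hw : (D.modeWeight : ℂ) ≠ 0 := by exact_mod_cast (D.modeWeight_pos hJ).ne'
  rw [coef, Finset.sum_congr rfl fun b hb => by rw [h b hb, Finset.sum_mul], Finset.sum_comm]
  have h1 : ∀ p ∈ D.slab 0, ∑ b ∈ D.slab 0, A p * (D.sinMode p b : ℂ) * (D.sinMode q b : ℂ)
      = if p = q then A p * D.modeWeight else 0 := by
    intro p hp
    simp only [mul_assoc]
    rw [← Finset.mul_sum]
    have := congrArg (fun x : ℝ => (x : ℂ)) (D.sum_sinMode_mul_sinMode hp hq)
    push_cast at this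
    rw [this]
    split_ifs <;> simp
  rw [Finset.sum_congr rfl h1, Finset.sum_ite_eq' _ q, if_pos hq]
  field_simp

/-- Nodes and frequencies range over the same set and `sinMode` is symmetric in them. So the
inversion formula is `coef_eq` with their roles exchanged. -/
theorem sum_coef_mul_sinMode (hJ : ∀ k, 1 ≤ D.J k) (W : GridFun n) {j : Fin n → ℤ}
    (hj : j ∈ D.slab (j 0)) :
    ∑ q ∈ D.slab 0, D.coef W q (j 0) * (D.sinMode q j : ℂ) = W j := by
  have hb : Function.update j 0 0 ∈ D.slab 0 := D.update_mem_slab hj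
  have h1 := D.coef_eq hJ (t := 0) (q := Function.update j 0 0) (A := fun b =>
      W (Function.update b 0 (j 0))) (W := fun q => ∑ b ∈ D.slab 0,
        W (Function.update b 0 (j 0)) * (D.sinMode b q : ℂ))
    (fun b hb => by
      refine Finset.sum_congr rfl fun q _ => ?_
      rw [sinMode_update_zero]) hb
  simp only [Function.update_idem, Function.update_eq_self] at h1
  rw [← h1, coef, Finset.mul_sum]
  refine Finset.sum_congr rfl fun q hq => ?_
  rw [coef, mul_assoc, Finset.sum_mul, Finset.sum_mul]
  congr 1
  refine Finset.sum_congr rfl fun b _ => ?_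
  rw [sinMode_update_zero, D.sinMode_comm b q, D.sinMode_comm _ q, sinMode_update_zero]

/-- Parseval's identity, obtained by expanding one of the two factors of `W W̄`. -/
theorem sum_norm_sq_slab (hJ : ∀ k, 1 ≤ D.J k) (W : GridFun n) (t : ℤ) :
    ∑ b ∈ D.slab 0, ‖W (Function.update b 0 t)‖ ^ 2
      = D.modeWeight * ∑ q ∈ D.slab 0, ‖D.coef W q t‖ ^ 2 := by
  have hw : (D.modeWeight : ℂ) ≠ 0 := by exact_mod_cast (D.modeWeight_pos hJ).ne'
  have h : ((∑ b ∈ D.slab 0, ‖W (Function.update b 0 t)‖ ^ 2 : ℝ) : ℂ)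
      = ((D.modeWeight * ∑ q ∈ D.slab 0, ‖D.coef W q t‖ ^ 2 : ℝ) : ℂ) := by
    push_cast
    simp only [← Complex.mul_conj']
    have h1 : ∀ b ∈ D.slab 0, W (Function.update b 0 t) * conj (W (Function.update b 0 t))
        = ∑ q ∈ D.slab 0, W (Function.update b 0 t) * (conj (D.coef W q t) * D.sinMode q b) := by
      intro b hb
      have h2 := D.sum_coef_mul_sinMode hJ W (j := Function.update b 0 t)
        (by rw [Function.update_self]; exact D.update_mem_slab hb)
      rw [← Finset.mul_sum]
      congr 1
      conv_lhs => rw [← h2]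
      simp [sinMode_update_zero]
    rw [Finset.sum_congr rfl h1, Finset.sum_comm, Finset.mul_sum]
    refine Finset.sum_congr rfl fun q _ => ?_
    conv_rhs => arg 2; arg 1; rw [coef]
    rw [← mul_assoc, ← mul_assoc, mul_inv_cancel₀ hw, one_mul, Finset.sum_mul]
    exact Finset.sum_congr rfl fun b _ => by ring
  exact_mod_cast h

end

end SplittingData

/-! ### The sine transforms and the separated form of the operators. -/

namespace SplittingData

noncomputable section

variable {n : ℕ} (D : SplittingData n)

theorem prod_map_idst_apply (L : List (Fin n)) (hL : L.Nodup) (Q : GridFun n) (j : Fin n → ℤ) :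
    (L.map D.idst).prod Q j = ∑ q ∈ Fintype.piFinset fun k => if k ∈ L then
      Finset.Icc (1 : ℤ) ((D.J k : ℤ) - 1) else {j k},
        Q q * ∏ k ∈ L.toFinset, (Real.sin (Real.pi * q k * j k / D.J k) : ℂ) := by
  induction L generalizing j with
  | nil =>
    have : (Fintype.piFinset fun k => if k ∈ ([] : List (Fin n)) then
        Finset.Icc (1 : ℤ) ((D.J k : ℤ) - 1) else {j k}) = {j} := by
      simp [Fintype.piFinset_singleton]
    rw [this]; simp
  | cons k L ih =>
    rw [List.nodup_cons] at hL
    rw [List.map_cons, List.prod_cons, Module.End.mul_apply]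
    have e1 : D.idst k ((L.map D.idst).prod Q) j = ∑ q ∈ Finset.Icc (1 : ℤ) ((D.J k : ℤ) - 1),
      (L.map D.idst).prod Q (Function.update j k q)
        * (Real.sin (Real.pi * q * j k / D.J k) : ℂ) := rfl
    rw [e1]
    simp only [ih hL.2, Finset.sum_mul]
    -- In the merged sum the multi-index `q` determines the outer index as `q k`; directions outside
    -- the list stay frozen at `j`.
    rw [Finset.sum_comm' (t' := Fintype.piFinset fun l => if l ∈ k :: L then
      Finset.Icc (1 : ℤ) ((D.J l : ℤ) - 1) else {j l}) (s' := fun q => {q k})]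
    · refine Finset.sum_congr rfl fun q hq => ?_
      rw [Finset.sum_singleton, List.toFinset_cons, Finset.prod_insert (by simpa using hL.1),
        mul_assoc, mul_comm (∏ l ∈ L.toFinset, _)]
      congr 2
      refine Finset.prod_congr rfl fun l hl => ?_
      have : l ≠ k := by rintro rfl; exact hL.1 (by simpa using hl)
      rw [Function.update_of_ne this]
    · intro i q
      simp only [Fintype.mem_piFinset, Finset.mem_singleton]
      constructor
      · rintro ⟨hi, hq⟩
        have hk : q k = i := by have := hq k; simpa [hL.1] using this
        refine ⟨hk.symm, fun l => ?_⟩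
        by_cases hlk : l = k
        · subst hlk; simpa [hk] using hi
        · have := hq l
          by_cases hlL : l ∈ L
          · simpa [hlL] using this
          · simpa [hlL, hlk] using this
      · rintro ⟨rfl, hq⟩
        refine ⟨by simpa using hq k, fun l => ?_⟩
        by_cases hlk : l = k
        · subst hlk; simp [hL.1]
        · have := hq l
          by_cases hlL : l ∈ L
          · simpa [hlL] using this
          · simpa [hlL, hlk] using this

theorem dst_eq_smul_idst (k : Fin n) : D.dst k = (2 / (D.J k : ℂ)) • D.idst k := by
  ext P q
  simp only [dst, idst, LinearMap.smul_apply, LinearMap.coe_mk, AddHom.coe_mk, Pi.smul_apply,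
    smul_eq_mul]
  congr 1
  refine Finset.sum_congr rfl fun i _ => ?_
  congr 3
  ring

theorem prod_map_dst (L : List (Fin n)) (hL : L.Nodup) : (L.map D.dst).prod =
    (∏ k ∈ L.toFinset, (2 / (D.J k : ℂ))) • (L.map D.idst).prod := by
  induction L with
  | nil => simp
  | cons k L ih =>
    rw [List.nodup_cons] at hL
    rw [List.map_cons, List.prod_cons, List.map_cons, List.prod_cons, ih hL.2, dst_eq_smul_idst,
      List.toFinset_cons, Finset.prod_insert (by simpa using hL.1), smul_mul_smul_comm]

variable [NeZero n]

theorem mem_perp {k : Fin n} : k ∈ perp n ↔ k ≠ 0 := by simp [perp]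

theorem perp_nodup : (perp n).Nodup := (List.nodup_finRange n).filter _

theorem perp_toFinset : (perp n).toFinset = perpSet n := by
  ext k; simp [mem_perp]

theorem prod_map_idst_eq_sum (L : List (Fin n)) (hL : L.Nodup) (hmem : ∀ k, k ∈ L ↔ k ≠ 0)
    (Q : GridFun n) (j : Fin n → ℤ) :
    (L.map D.idst).prod Q j =
      ∑ q ∈ D.slab 0, Q (Function.update q 0 (j 0)) * (D.sinMode q j : ℂ) := by
  have e1 : (Fintype.piFinset fun k => if k ∈ L then
      Finset.Icc (1 : ℤ) ((D.J k : ℤ) - 1) else {j k}) = D.slab (j 0) := by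
    rw [slab]
    congr 1
    funext k
    by_cases hk : k = 0
    · subst hk; simp [hmem]
    · simp [hmem, hk]
  have e2 : L.toFinset = perpSet n := by ext k; simp [hmem]
  rw [prod_map_idst_apply D L hL, e1, e2, D.sum_slab _ 0]
  refine Finset.sum_congr rfl fun q _ => ?_
  congr 1
  rw [D.sinMode_comm, ← D.sinMode_update_zero j q (j 0), D.sinMode_comm, sinMode]
  push_cast
  rfl

theorem prod_map_dst_eq_coef (W : GridFun n) (q : Fin n → ℤ) :
    ((perp n).reverse.map D.dst).prod W q = D.coef W q (q 0) := by
  have hw : (∏ k ∈ perpSet n, (2 / (D.J k : ℂ))) = ((D.modeWeight : ℂ))⁻¹ := by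
    rw [modeWeight]
    push_cast
    rw [← Finset.prod_inv_distrib]
    exact Finset.prod_congr rfl fun k _ => by rw [inv_div]
  rw [prod_map_dst _ _ (List.nodup_reverse.mpr perp_nodup), List.toFinset_reverse, perp_toFinset, hw,
    LinearMap.smul_apply, Pi.smul_apply, smul_eq_mul, coef,
    D.prod_map_idst_eq_sum _ (List.nodup_reverse.mpr perp_nodup) (fun k => by simp [mem_perp])]
  congr 1
  exact Finset.sum_congr rfl fun b _ => by rw [D.sinMode_comm]

theorem coef_update_zero (W : GridFun n) (q : Fin n → ℤ) (s t : ℤ) :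
    D.coef W (Function.update q 0 s) t = D.coef W q t := by
  rw [coef, coef]
  congr 1
  exact Finset.sum_congr rfl fun b _ => by
    rw [D.sinMode_comm, sinMode_update_zero, D.sinMode_comm]

/-- The product of the factors `σ` over the perpendicular directions. -/
def sigProd (q : Fin n → ℤ) : ℝ := ∏ k ∈ perpSet n, D.sig k (q k)

theorem sigProd_update_zero (q : Fin n → ℤ) (s : ℤ) :
    D.sigProd (Function.update q 0 s) = D.sigProd q :=
  Finset.prod_congr rfl fun k hk => by rw [Function.update_of_ne (Finset.mem_filter.mp hk).2]

/-- The sum of `λ / σ` over the perpendicular directions. -/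
def lamSum (q : Fin n → ℤ) : ℝ := ∑ k ∈ perpSet n, D.lam k (q k) / D.sig k (q k)

theorem lamSum_update_zero (q : Fin n → ℤ) (s : ℤ) :
    D.lamSum (Function.update q 0 s) = D.lamSum q :=
  Finset.sum_congr rfl fun k hk => by rw [Function.update_of_ne (Finset.mem_filter.mp hk).2]

theorem VinfQ_eq (q : Fin n → ℤ) : D.VinfQ q = D.Vinf + D.c * D.lamSum q := rfl

/-- The boundary operator is diagonal in the sine modes: `σ`-weights times one scalar convolution
per frequency, with coefficients taken on the slab of `j`. -/
theorem Sref_eq (m : ℕ) (Φ : ℕ → GridFun n) (j : Fin n → ℤ) :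
    D.Sref m Φ j = ∑ q ∈ D.slab 0, ((D.sigProd q : ℂ) * ∑ p ∈ Finset.range (m + 1),
      D.kernelR (D.VinfQ q) p * D.coef (Φ (m - p)) q (j 0)) * (D.sinMode q j : ℂ) := by
  rw [Sref, D.prod_map_idst_eq_sum _ perp_nodup fun k => mem_perp]
  refine Finset.sum_congr rfl fun q _ => ?_
  congr 1
  have e1 : ∀ s, (∏ k ∈ perpSet n, (D.sig k (Function.update q 0 s k) : ℂ)) = (D.sigProd q : ℂ) := by
    intro s
    rw [← D.sigProd_update_zero q s, sigProd]
    push_cast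
    rfl
  rw [e1]
  congr 1
  refine Finset.sum_congr rfl fun p _ => ?_
  rw [D.prod_map_dst_eq_coef, coef_update_zero, Function.update_self, VinfQ_eq, VinfQ_eq,
    lamSum_update_zero]

/-! ### Action of the difference operators on separated functions -/

/-- A function with separated variables. -/
def modeFun (q : Fin n → ℤ) (f : ℤ → ℂ) : GridFun n := fun j => f (j 0) * (D.sinMode q j : ℂ)

theorem sinMode_shift_zero (q j e : Fin n → ℤ) (he : ∀ k ≠ 0, e k = j k) :
    D.sinMode q e = D.sinMode q j :=
  Finset.prod_congr rfl fun k hk => by rw [he k (Finset.mem_filter.mp hk).2]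

theorem sinMode_shift (q j : Fin n → ℤ) {k : Fin n} (hk : k ≠ 0) :
    D.sinMode q (j + Pi.single k 1) + D.sinMode q (j - Pi.single k 1)
      = 2 * Real.cos (Real.pi * q k / D.J k) * D.sinMode q j := by
  have hmem : k ∈ perpSet n := Finset.mem_filter.mpr ⟨Finset.mem_univ k, hk⟩
  simp only [sinMode, ← Finset.mul_prod_erase _ _ hmem]
  have h1 : ∀ i : Fin n → ℤ, (∀ l ≠ k, i l = j l) →
      ∏ l ∈ (perpSet n).erase k, Real.sin (Real.pi * q l * i l / D.J l)
        = ∏ l ∈ (perpSet n).erase k, Real.sin (Real.pi * q l * j l / D.J l) := fun i hi =>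
    Finset.prod_congr rfl fun l hl => by rw [hi l (Finset.ne_of_mem_erase hl)]
  rw [h1 (j + Pi.single k 1) fun l hl => by simp [hl], h1 (j - Pi.single k 1) fun l hl => by simp [hl]]
  have e1 : Real.pi * q k * ((j + Pi.single k 1 : Fin n → ℤ) k : ℤ) / D.J k
      = Real.pi * q k * j k / D.J k + Real.pi * q k / D.J k := by simp; ring
  have e2 : Real.pi * q k * ((j - Pi.single k 1 : Fin n → ℤ) k : ℤ) / D.J k
      = Real.pi * q k * j k / D.J k - Real.pi * q k / D.J k := by simp; ring
  rw [e1, e2, Real.sin_add, Real.sin_sub]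
  ring

omit [NeZero n] in
theorem half_angle (hX : ∀ k, 0 < D.X k) (k : Fin n) (q : ℤ) :
    Real.pi * q * D.h k / (2 * D.X k) = Real.pi * q / D.J k / 2 := by
  have := (hX k).ne'
  rw [h]; field_simp

omit [NeZero n] in
theorem cos_eq_of_half_angle (hX : ∀ k, 0 < D.X k) (k : Fin n) (q : ℤ) :
    Real.cos (Real.pi * q / D.J k) = 1 - 2 * Real.sin (Real.pi * q * D.h k / (2 * D.X k)) ^ 2 := by
  rw [half_angle D hX]
  have h1 := Real.cos_two_mul (Real.pi * q / D.J k / 2)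
  have h2 := Real.sin_sq_add_cos_sq (Real.pi * q / D.J k / 2)
  rw [mul_div_cancel₀ _ (two_ne_zero' ℝ)] at h1
  linarith

/-- The eigenvalue is `5/6 + (1/6) cos(πq/J) = 1 - (1/3) sin²(πq/(2J))`. -/
theorem sN_modeFun (hX : ∀ k, 0 < D.X k) {k : Fin n} (hk : k ≠ 0) (q : Fin n → ℤ) (f : ℤ → ℂ) :
    sN k (D.modeFun q f) = (D.sig k (q k) : ℂ) • D.modeFun q f := by
  funext j
  have h1 := congrArg (fun x : ℝ => (x : ℂ)) (D.sinMode_shift q j hk)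
  rw [D.cos_eq_of_half_angle hX] at h1
  push_cast at h1
  simp only [sN, modeFun, LinearMap.coe_mk, AddHom.coe_mk, Pi.smul_apply, smul_eq_mul, sig]
  have e1 : (j - Pi.single k 1 : Fin n → ℤ) 0 = j 0 := by simp [hk.symm]
  have e2 : (j + Pi.single k 1 : Fin n → ℤ) 0 = j 0 := by simp [hk.symm]
  rw [e1, e2]
  push_cast
  linear_combination f (j 0) / 12 * h1

theorem fdiff_bdiff_modeFun (hX : ∀ k, 0 < D.X k) (hJ : ∀ k, 1 ≤ D.J k) {k : Fin n} (hk : k ≠ 0)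
    (q : Fin n → ℤ) (f : ℤ → ℂ) :
    D.fdiff k (D.bdiff k (D.modeFun q f)) = (-(D.lam k (q k)) : ℂ) • D.modeFun q f := by
  funext j
  have h1 := congrArg (fun x : ℝ => (x : ℂ)) (D.sinMode_shift q j hk)
  rw [D.cos_eq_of_half_angle hX] at h1
  push_cast at h1
  have hh : (D.h k : ℂ) ≠ 0 := by
    have : (0 : ℝ) < D.J k := by exact_mod_cast hJ k
    have : 0 < D.h k := div_pos (hX k) this
    exact_mod_cast this.ne'
  simp only [fdiff, bdiff, modeFun, LinearMap.coe_mk, AddHom.coe_mk, Pi.smul_apply, smul_eq_mul, lam]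
  have e1 : (j - Pi.single k 1 : Fin n → ℤ) 0 = j 0 := by simp [hk.symm]
  have e2 : (j + Pi.single k 1 : Fin n → ℤ) 0 = j 0 := by simp [hk.symm]
  rw [add_sub_cancel_right, e1, e2]
  push_cast
  generalize Complex.sin (Real.pi * q k * D.h k / (2 * D.X k)) = s at *
  field_simp
  linear_combination f (j 0) * h1

theorem sN_zero_modeFun (q : Fin n → ℤ) (f : ℤ → ℂ) :
    sN 0 (D.modeFun q f) = D.modeFun q (numerov f) := by
  funext j
  simp only [sN, modeFun, LinearMap.coe_mk, AddHom.coe_mk, numerov]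
  rw [D.sinMode_shift_zero q j (j - Pi.single 0 1) fun k hk => by simp [hk],
    D.sinMode_shift_zero q j (j + Pi.single 0 1) fun k hk => by simp [hk]]
  simp
  ring

theorem bdiff_zero_modeFun (q : Fin n → ℤ) (f : ℤ → ℂ) :
    D.bdiff 0 (D.modeFun q f) = D.modeFun q fun t => (f t - f (t - 1)) / D.h 0 := by
  funext j
  simp only [bdiff, modeFun, LinearMap.coe_mk, AddHom.coe_mk]
  rw [D.sinMode_shift_zero q j (j - Pi.single 0 1) fun k hk => by simp [hk]]
  simp
  ring

theorem fdiff_bdiff_zero_modeFun (q : Fin n → ℤ) (f : ℤ → ℂ) :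
    D.fdiff 0 (D.bdiff 0 (D.modeFun q f)) = D.modeFun q (secondDiff (D.h 0) f) := by
  rw [bdiff_zero_modeFun]
  funext j
  simp only [fdiff, modeFun, LinearMap.coe_mk, AddHom.coe_mk, secondDiff]
  rw [D.sinMode_shift_zero q j (j + Pi.single 0 1) fun k hk => by simp [hk]]
  simp
  ring

theorem prod_map_sN_modeFun (hX : ∀ k, 0 < D.X k) (q : Fin n → ℤ) (f : ℤ → ℂ) (L : List (Fin n))
    (hL : L.Nodup) : (L.map sN).prod (D.modeFun q f) =
      (∏ k ∈ L.toFinset.erase 0, (D.sig k (q k) : ℂ)) •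
        D.modeFun q (if 0 ∈ L then numerov f else f) := by
  induction L with
  | nil => simp
  | cons k L ih =>
    rw [List.nodup_cons] at hL
    rw [List.map_cons, List.prod_cons, Module.End.mul_apply, ih hL.2, map_smul]
    by_cases hk : k = 0
    · subst hk
      rw [if_neg hL.1, sN_zero_modeFun, if_pos (by simp), List.toFinset_cons,
        Finset.erase_insert_eq_erase]
    · rw [D.sN_modeFun hX hk, List.toFinset_cons, Finset.erase_insert_of_ne hk,
        Finset.prod_insert (by simp [hL.1]), smul_smul, mul_comm]
      simp [List.mem_cons, Ne.symm hk]

theorem sNprod_modeFun (hX : ∀ k, 0 < D.X k) (q : Fin n → ℤ) (f : ℤ → ℂ) (E : Finset (Fin n)) :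
    sNprod E (D.modeFun q f) = (∏ k ∈ (perpSet n).filter fun k => k ∉ E, (D.sig k (q k) : ℂ)) •
        D.modeFun q (if 0 ∈ E then f else numerov f) := by
  rw [sNprod, D.prod_map_sN_modeFun hX q f _ ((List.nodup_finRange n).filter _)]
  congr 2
  · ext k
    simp
  · simp only [List.mem_filter, List.mem_finRange, true_and, decide_eq_true_eq]
    split_ifs <;> simp_all

omit [NeZero n] in
theorem sig_ge (k : Fin n) (q : ℤ) : 2 / 3 ≤ D.sig k q := by
  have := Real.sin_sq_le_one (Real.pi * q * D.h k / (2 * D.X k))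
  rw [sig]; linarith

omit [NeZero n] in
theorem sig_ne_zero (k : Fin n) (q : ℤ) : (D.sig k q : ℂ) ≠ 0 := by
  have := D.sig_ge k q
  exact_mod_cast (by linarith : (0 : ℝ) < D.sig k q).ne'

theorem sigProd_pos (q : Fin n → ℤ) : 0 < D.sigProd q :=
  Finset.prod_pos fun k _ => by have := D.sig_ge k (q k); linarith

/-- The hypothesis on `E` covers both `{k}`, needed for `lapN`, and `{0, k}`, needed for the
boundary condition. -/
theorem prod_sig_filter_ne (q : Fin n → ℤ) {k : Fin n} (hk : k ≠ 0) {E : Finset (Fin n)}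
    (hE : ∀ l ≠ 0, l ∈ E ↔ l = k) :
    (∏ l ∈ (perpSet n).filter fun l => l ∉ E, (D.sig l (q l) : ℂ))
      = (D.sigProd q : ℂ) / D.sig k (q k) := by
  have hmem : k ∈ perpSet n := Finset.mem_filter.mpr ⟨Finset.mem_univ k, hk⟩
  have e1 : ((perpSet n).filter fun l => l ∉ E) = (perpSet n).erase k := by
    ext l
    simp only [Finset.mem_filter, Finset.mem_univ, true_and, Finset.mem_erase]
    constructor
    · rintro ⟨h1, h2⟩; exact ⟨fun h => h2 ((hE l h1).mpr h), h1⟩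
    · rintro ⟨h1, h2⟩; exact ⟨h2, fun h => h1 ((hE l h2).mp h)⟩
  rw [e1, eq_div_iff (D.sig_ne_zero k _), Finset.prod_erase_mul _ _ hmem, sigProd]
  push_cast
  rfl

theorem prod_sig_filter_all (q : Fin n → ℤ) {E : Finset (Fin n)} (hE : ∀ l ≠ 0, l ∉ E) :
    (∏ l ∈ (perpSet n).filter fun l => l ∉ E, (D.sig l (q l) : ℂ)) = (D.sigProd q : ℂ) := by
  rw [Finset.filter_true_of_mem fun l hl => hE l (Finset.mem_filter.mp hl).2, sigProd]
  push_cast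
  rfl

theorem sNprod_empty_modeFun (hX : ∀ k, 0 < D.X k) (q : Fin n → ℤ) (f : ℤ → ℂ) :
    sNprod ∅ (D.modeFun q f) = (D.sigProd q : ℂ) • D.modeFun q (numerov f) := by
  rw [D.sNprod_modeFun hX, D.prod_sig_filter_all q (by simp)]; simp

theorem sNprod_zero_modeFun (hX : ∀ k, 0 < D.X k) (q : Fin n → ℤ) (f : ℤ → ℂ) :
    sNprod {0} (D.modeFun q f) = (D.sigProd q : ℂ) • D.modeFun q f := by
  rw [D.sNprod_modeFun hX, D.prod_sig_filter_all q fun l hl => by simpa using hl]; simp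

/-- Direction `k ≠ 0` contributes `-λ_k` times the product of the other `σ`, which is `-(∏ σ)
λ_k/σ_k`. Once `∏ σ` is factored out, the perpendicular part acts as a constant potential under the
Numerov average. -/
theorem lapN_modeFun (hX : ∀ k, 0 < D.X k) (hJ : ∀ k, 1 ≤ D.J k) (q : Fin n → ℤ) (f : ℤ → ℂ) :
    D.lapN (D.modeFun q f) = (D.sigProd q : ℂ) • (D.modeFun q (secondDiff (D.h 0) f)
      - (D.lamSum q : ℂ) • D.modeFun q (numerov f)) := by
  rw [lapN, LinearMap.sum_apply, ← Finset.add_sum_erase _ _ (Finset.mem_univ (0 : Fin n)),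
    Module.End.mul_apply, Module.End.mul_apply, fdiff_bdiff_zero_modeFun, D.sNprod_zero_modeFun hX,
    smul_sub, sub_eq_add_neg]
  congr 1
  have e1 : (Finset.univ.erase (0 : Fin n)) = perpSet n := by ext k; simp
  rw [e1, lamSum]
  push_cast
  rw [Finset.sum_smul, Finset.smul_sum, ← Finset.sum_neg_distrib]
  refine Finset.sum_congr rfl fun k hk => ?_
  have hk0 := (Finset.mem_filter.mp hk).2
  rw [Module.End.mul_apply, Module.End.mul_apply, D.fdiff_bdiff_modeFun hX hJ hk0, map_smul,
    D.sNprod_modeFun hX, D.prod_sig_filter_ne q hk0 (fun l _ => by simp),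
    if_neg (by simpa using hk0.symm), smul_smul, smul_smul, ← neg_smul]
  congr 1
  ring

theorem sum_sNprod_fdiff_bdiff_modeFun (hX : ∀ k, 0 < D.X k) (hJ : ∀ k, 1 ≤ D.J k) (q : Fin n → ℤ)
    (f : ℤ → ℂ) : ∑ k ∈ perpSet n, sNprod {0, k} (D.fdiff k (D.bdiff k (D.modeFun q f)))
      = (-(D.sigProd q * D.lamSum q) : ℂ) • D.modeFun q f := by
  rw [lamSum]
  push_cast
  rw [Finset.mul_sum, ← Finset.sum_neg_distrib, Finset.sum_smul]
  refine Finset.sum_congr rfl fun k hk => ?_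
  have hk0 := (Finset.mem_filter.mp hk).2
  rw [D.fdiff_bdiff_modeFun hX hJ hk0, map_smul, D.sNprod_modeFun hX,
    D.prod_sig_filter_ne q hk0 (fun l hl => by simp [hl]), if_pos (by simp), smul_smul]
  congr 1
  ring

end

end SplittingData

namespace SplittingData

noncomputable section

variable {n : ℕ} (D : SplittingData n)

/-! ### Locality of the difference operators -/

theorem prod_map_sN_eq_zero (L : List (Fin n)) (hL : L.Nodup) {Z : GridFun n} {j : Fin n → ℤ}
    (h : ∀ i : Fin n → ℤ, (∀ k ∈ L, |i k - j k| ≤ 1) → (∀ k ∉ L, i k = j k) → Z i = 0) :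
    (L.map sN).prod Z j = 0 := by
  induction L generalizing j with
  | nil => exact h j (by simp) (by simp)
  | cons k L ih =>
    rw [List.nodup_cons] at hL
    have key : ∀ i : Fin n → ℤ, |i k - j k| ≤ 1 → (∀ l ≠ k, i l = j l) →
        (L.map sN).prod Z i = 0 := by
      intro i hik hil
      refine ih hL.2 fun i' h1 h2 => h i' ?_ ?_
      · intro l hl
        rcases List.mem_cons.mp hl with rfl | hl
        · rw [h2 _ hL.1]; exact hik
        · have : l ≠ k := fun h => hL.1 (h ▸ hl)
          rw [← hil l this]; exact h1 l hl
      · intro l hl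
        simp only [List.mem_cons, not_or] at hl
        rw [h2 l hl.2, hil l hl.1]
    rw [List.map_cons, List.prod_cons, Module.End.mul_apply]
    change (1 / 12 : ℂ) * (L.map sN).prod Z (j - Pi.single k 1)
      + (5 / 6 : ℂ) * (L.map sN).prod Z j
      + (1 / 12 : ℂ) * (L.map sN).prod Z (j + Pi.single k 1) = 0
    have h1 := key (j - Pi.single k 1) (by simp) fun l hl => by simp [hl]
    have h2 := key j (by simp) fun l hl => rfl
    have h3 := key (j + Pi.single k 1) (by simp) fun l hl => by simp [hl]
    rw [h1, h2, h3]
    ring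

/-- Grid functions live on all integer indices, but a mesh function agrees with its sine expansion
only on the closed mesh. Locality shows that values elsewhere do not matter at the nodes in
question. -/
theorem sNprod_eq_zero {E : Finset (Fin n)} {Z : GridFun n} {j : Fin n → ℤ}
    (h : ∀ i : Fin n → ℤ, (∀ k, |i k - j k| ≤ 1) → (∀ k ∈ E, i k = j k) → Z i = 0) :
    sNprod E Z j = 0 := by
  refine prod_map_sN_eq_zero _ ((List.nodup_finRange n).filter _) fun i h1 h2 => h i ?_ ?_
  · intro k
    by_cases hk : k ∈ E
    · rw [h2 k (by simp [hk])]; simp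
    · exact h1 k (by simp [hk])
  · intro k hk
    exact h2 k (by simp [hk])

theorem fdiff_bdiff_eq_zero {Z : GridFun n} {j : Fin n → ℤ} {k : Fin n}
    (h : ∀ i : Fin n → ℤ, |i k - j k| ≤ 1 → (∀ l ≠ k, i l = j l) → Z i = 0) :
    D.fdiff k (D.bdiff k Z) j = 0 := by
  simp only [fdiff, bdiff, LinearMap.coe_mk, AddHom.coe_mk]
  rw [add_sub_cancel_right, h j (by simp) fun l _ => rfl,
    h (j - Pi.single k 1) (by simp) fun l hl => by simp [hl],
    h (j + Pi.single k 1) (by simp) fun l hl => by simp [hl]]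
  simp

theorem mem_meshClosed_iff {j : Fin n → ℤ} : j ∈ D.meshClosed ↔ ∀ k, 0 ≤ j k ∧ j k ≤ D.J k := by
  simp [meshClosed, Fintype.mem_piFinset]

variable [NeZero n]

theorem mem_meshClosed_of_near {i j : Fin n → ℤ} (hj : j ∈ D.slab (j 0))
    (h : ∀ k ≠ 0, |i k - j k| ≤ 1) (h0 : 0 ≤ i 0) (h1 : i 0 ≤ D.J 0) : i ∈ D.meshClosed := by
  rw [mem_meshClosed_iff]
  intro k
  by_cases hk : k = 0
  · subst hk; exact ⟨h0, h1⟩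
  · have h2 := Finset.mem_Icc.mp ((D.mem_slab.mp hj).2 k hk)
    have h3 := abs_le.mp (h k hk)
    omega

theorem sNprod_zero_eq_zero {Z : GridFun n} (hZ : ∀ i ∈ D.meshClosed, Z i = 0) {j : Fin n → ℤ}
    (hj : j ∈ D.slab (j 0)) (h0 : 0 ≤ j 0) (h1 : j 0 ≤ D.J 0) : sNprod {0} Z j = 0 :=
  sNprod_eq_zero fun i hi he => hZ i <| by
    have := he 0 (by simp)
    exact D.mem_meshClosed_of_near hj (fun k _ => hi k) (by omega) (by omega)

theorem sNprod_empty_eq_zero {Z : GridFun n} (hZ : ∀ i ∈ D.meshClosed, Z i = 0) {j : Fin n → ℤ}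
    (hj : j ∈ D.meshInner) : sNprod ∅ Z j = 0 :=
  sNprod_eq_zero fun i hi _ => hZ i <| by
    obtain ⟨h1, h2⟩ := D.mem_meshInner_iff.mp hj
    rw [Finset.mem_Icc] at h1
    have := abs_le.mp (hi 0)
    exact D.mem_meshClosed_of_near h2 (fun k _ => hi k) (by omega) (by omega)

theorem lapN_eq_zero {Z : GridFun n} (hZ : ∀ i ∈ D.meshClosed, Z i = 0) {j : Fin n → ℤ}
    (hj : j ∈ D.meshInner) : D.lapN Z j = 0 := by
  rw [lapN, LinearMap.sum_apply, Finset.sum_apply]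
  refine Finset.sum_eq_zero fun k _ => ?_
  refine sNprod_eq_zero fun i hi he => D.fdiff_bdiff_eq_zero fun i' h1 h2 => hZ i' ?_
  have hnear : ∀ l, |i' l - j l| ≤ 1 := fun l => by
    by_cases hl : l = k
    · subst hl; rw [← he l (by simp)]; exact h1
    · rw [h2 l hl]; exact hi l
  obtain ⟨h3, h4⟩ := D.mem_meshInner_iff.mp hj
  rw [Finset.mem_Icc] at h3
  have := abs_le.mp (hnear 0)
  exact D.mem_meshClosed_of_near h4 (fun k _ => hnear k) (by omega) (by omega)

theorem sNprod_bdiff_zero_eq_zero {Z : GridFun n} (hZ : ∀ i ∈ D.meshClosed, Z i = 0)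
    {j : Fin n → ℤ} (hj : j ∈ D.slab (j 0)) (h0 : 1 ≤ j 0) (h1 : j 0 ≤ D.J 0) :
    sNprod {0} (D.bdiff 0 Z) j = 0 :=
  sNprod_eq_zero fun i hi he => by
    have := he 0 (by simp)
    simp only [bdiff, LinearMap.coe_mk, AddHom.coe_mk]
    rw [hZ i (D.mem_meshClosed_of_near hj (fun k _ => hi k) (by omega) (by omega)),
      hZ (i - Pi.single 0 1) (D.mem_meshClosed_of_near hj (fun k hk => by simpa [hk] using hi k)
        (by simp; omega) (by simp; omega))]
    simp

theorem sum_sNprod_fdiff_bdiff_eq_zero {Z : GridFun n} (hZ : ∀ i ∈ D.meshClosed, Z i = 0)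
    {j : Fin n → ℤ} (hj : j ∈ D.slab (j 0)) (h0 : 0 ≤ j 0) (h1 : j 0 ≤ D.J 0) :
    (∑ k ∈ perpSet n, sNprod {0, k} (D.fdiff k (D.bdiff k Z))) j = 0 := by
  rw [Finset.sum_apply]
  refine Finset.sum_eq_zero fun k hk => ?_
  have hk0 := (Finset.mem_filter.mp hk).2
  refine sNprod_eq_zero fun i hi he => D.fdiff_bdiff_eq_zero fun i' h1 h2 => hZ i' ?_
  have hnear : ∀ l, |i' l - j l| ≤ 1 := fun l => by
    by_cases hl : l = k
    · subst hl; rw [← he l (by simp)]; exact h1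
    · rw [h2 l hl]; exact hi l
  have h3 := he 0 (by simp)
  have h4 := h2 0 hk0.symm
  exact D.mem_meshClosed_of_near hj (fun k _ => hnear k) (by omega) (by omega)

/-! ### Expansion in separated functions -/

/-- The expansion of a mesh function in products of sines. -/
def expand (W : GridFun n) : GridFun n := ∑ q ∈ D.slab 0, D.modeFun q (D.coef W q)

theorem expand_apply (W : GridFun n) (j : Fin n → ℤ) :
    D.expand W j = ∑ q ∈ D.slab 0, D.coef W q (j 0) * (D.sinMode q j : ℂ) := by
  rw [expand, Finset.sum_apply]; rfl

theorem mem_meshClosed_of_mem_slab {j : Fin n → ℤ} (hj : j ∈ D.slab (j 0)) (h0 : 0 ≤ j 0)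
    (h1 : j 0 ≤ D.J 0) : j ∈ D.meshClosed :=
  D.mem_meshClosed_of_near hj (fun k _ => by simp) h0 h1

theorem mem_meshGamma_of_boundary {j : Fin n → ℤ} (hj : j ∈ D.meshClosed)
    (h : j 0 = 0 ∧ D.J 0 ≠ 0 ∨ j ∉ D.slab (j 0)) : j ∈ D.meshGamma := by
  rw [meshGamma, Finset.mem_sdiff, Finset.mem_sdiff, mem_meshInner_iff, meshGamma1_eq]
  refine ⟨⟨hj, ?_⟩, ?_⟩
  · rintro ⟨h1, h2⟩
    rcases h with h | h
    · rw [h.1] at h1; simp at h1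
    · exact h h2
  · intro h1
    have h2 := (D.mem_slab.mp h1).1
    rcases h with h | h
    · omega
    · rw [h2] at h; exact h h1

theorem exists_boundary_index {j : Fin n → ℤ} (hj : j ∈ D.meshClosed) (h : j ∉ D.slab (j 0)) :
    ∃ k ≠ 0, j k = 0 ∨ j k = D.J k := by
  rw [mem_slab] at h
  push Not at h
  obtain ⟨k, hk, h1⟩ := h rfl
  have := D.mem_meshClosed_iff.mp hj k
  rw [Finset.mem_Icc] at h1
  exact ⟨k, hk, by omega⟩

/-- On slabs this is the inversion formula; at the remaining nodes some perpendicular index is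
extreme, and both `W` and all the sines vanish. -/
theorem sub_expand_eq_zero (hJ : ∀ k, 1 ≤ D.J k) {W : GridFun n} (hW : ∀ j ∈ D.meshGamma, W j = 0) :
    ∀ j ∈ D.meshClosed, (W - D.expand W) j = 0 := by
  intro j hj
  rw [Pi.sub_apply, expand_apply]
  by_cases h : j ∈ D.slab (j 0)
  · rw [D.sum_coef_mul_sinMode hJ W h, sub_self]
  · rw [hW j (D.mem_meshGamma_of_boundary hj (Or.inr h))]
    obtain ⟨k, hk, h1⟩ := D.exists_boundary_index hj h
    have := hJ k
    rw [Finset.sum_eq_zero fun q _ => by rw [D.sinMode_eq_zero hk (by omega) h1]; simp, sub_zero]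

theorem apply_eq_of_sub_expand (A : Module.End ℂ (GridFun n)) {W : GridFun n} {j : Fin n → ℤ}
    (h : A (W - D.expand W) j = 0) :
    A W j = ∑ q ∈ D.slab 0, A (D.modeFun q (D.coef W q)) j := by
  rw [map_sub, Pi.sub_apply, sub_eq_zero] at h
  rw [h, expand, map_sum, Finset.sum_apply]

theorem sNprod_empty_apply (hX : ∀ k, 0 < D.X k) (hJ : ∀ k, 1 ≤ D.J k) {W : GridFun n}
    (hW : ∀ j ∈ D.meshGamma, W j = 0) {j : Fin n → ℤ} (hj : j ∈ D.meshInner) :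
    sNprod ∅ W j = ∑ q ∈ D.slab 0,
      (D.sigProd q * numerov (D.coef W q) (j 0)) * (D.sinMode q j : ℂ) := by
  rw [D.apply_eq_of_sub_expand (sNprod ∅) (D.sNprod_empty_eq_zero (D.sub_expand_eq_zero hJ hW) hj)]
  refine Finset.sum_congr rfl fun q _ => ?_
  rw [D.sNprod_empty_modeFun hX, mul_assoc]
  rfl

theorem lapN_apply (hX : ∀ k, 0 < D.X k) (hJ : ∀ k, 1 ≤ D.J k) {W : GridFun n}
    (hW : ∀ j ∈ D.meshGamma, W j = 0) {j : Fin n → ℤ} (hj : j ∈ D.meshInner) :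
    D.lapN W j = ∑ q ∈ D.slab 0, (D.sigProd q * (secondDiff (D.h 0) (D.coef W q) (j 0)
      - D.lamSum q * numerov (D.coef W q) (j 0))) * (D.sinMode q j : ℂ) := by
  rw [D.apply_eq_of_sub_expand D.lapN (D.lapN_eq_zero (D.sub_expand_eq_zero hJ hW) hj)]
  refine Finset.sum_congr rfl fun q _ => ?_
  rw [D.lapN_modeFun hX hJ]
  simp only [Pi.smul_apply, Pi.sub_apply, smul_eq_mul, modeFun]
  ring

theorem sNprod_zero_apply (hX : ∀ k, 0 < D.X k) (hJ : ∀ k, 1 ≤ D.J k) {W : GridFun n}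
    (hW : ∀ j ∈ D.meshGamma, W j = 0) {j : Fin n → ℤ} (hj : j ∈ D.slab (j 0)) (h0 : 0 ≤ j 0)
    (h1 : j 0 ≤ D.J 0) : sNprod {0} W j = ∑ q ∈ D.slab 0,
      (D.sigProd q * D.coef W q (j 0)) * (D.sinMode q j : ℂ) := by
  rw [D.apply_eq_of_sub_expand (sNprod {0})
    (D.sNprod_zero_eq_zero (D.sub_expand_eq_zero hJ hW) hj h0 h1)]
  refine Finset.sum_congr rfl fun q _ => ?_
  rw [D.sNprod_zero_modeFun hX, mul_assoc]
  rfl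

theorem sNprod_bdiff_zero_apply (hX : ∀ k, 0 < D.X k) (hJ : ∀ k, 1 ≤ D.J k) {W : GridFun n}
    (hW : ∀ j ∈ D.meshGamma, W j = 0) {j : Fin n → ℤ} (hj : j ∈ D.slab (j 0)) (h0 : 1 ≤ j 0)
    (h1 : j 0 ≤ D.J 0) : sNprod {0} (D.bdiff 0 W) j = ∑ q ∈ D.slab 0,
      (D.sigProd q * ((D.coef W q (j 0) - D.coef W q (j 0 - 1)) / D.h 0))
        * (D.sinMode q j : ℂ) := by
  rw [← Module.End.mul_apply, D.apply_eq_of_sub_expand (sNprod {0} * D.bdiff 0)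
    (D.sNprod_bdiff_zero_eq_zero (D.sub_expand_eq_zero hJ hW) hj h0 h1)]
  refine Finset.sum_congr rfl fun q _ => ?_
  rw [Module.End.mul_apply, bdiff_zero_modeFun, D.sNprod_zero_modeFun hX, mul_assoc]
  rfl

theorem sum_sNprod_fdiff_bdiff_apply (hX : ∀ k, 0 < D.X k) (hJ : ∀ k, 1 ≤ D.J k) {W : GridFun n}
    (hW : ∀ j ∈ D.meshGamma, W j = 0) {j : Fin n → ℤ} (hj : j ∈ D.slab (j 0)) (h0 : 0 ≤ j 0)
    (h1 : j 0 ≤ D.J 0) :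
    (∑ k ∈ perpSet n, sNprod {0, k} (D.fdiff k (D.bdiff k W))) j = ∑ q ∈ D.slab 0,
      (-(D.sigProd q * D.lamSum q) * D.coef W q (j 0)) * (D.sinMode q j : ℂ) := by
  have e1 : ∀ Z : GridFun n, ∑ k ∈ perpSet n, sNprod {0, k} (D.fdiff k (D.bdiff k Z))
      = (∑ k ∈ perpSet n, sNprod {0, k} * (D.fdiff k * D.bdiff k)) Z := fun Z => by
    rw [LinearMap.sum_apply]; rfl
  have h2 := D.sum_sNprod_fdiff_bdiff_eq_zero (D.sub_expand_eq_zero hJ hW) hj h0 h1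
  rw [e1] at h2 ⊢
  rw [D.apply_eq_of_sub_expand _ h2]
  refine Finset.sum_congr rfl fun q _ => ?_
  rw [← e1, D.sum_sNprod_fdiff_bdiff_modeFun hX hJ, mul_assoc]
  rfl

theorem coef_mul_left (a : ℤ → ℂ) (W : GridFun n) (q : Fin n → ℤ) :
    D.coef (fun i => a (i 0) * W i) q = fun t => a t * D.coef W q t := by
  funext t
  rw [coef, coef, mul_left_comm]
  congr 1
  rw [Finset.mul_sum]
  exact Finset.sum_congr rfl fun b _ => by rw [Function.update_self, mul_assoc]

theorem coef_avg (U W : GridFun n) (q : Fin n → ℤ) :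
    D.coef (avg U W) q = fun t => (D.coef U q t + D.coef W q t) / 2 := by
  funext t
  simp only [coef, avg]
  rw [← mul_add, ← Finset.sum_add_distrib, mul_div_assoc, Finset.sum_div]
  congr 1
  exact Finset.sum_congr rfl fun b _ => by ring

theorem coef_tdiff (U W : GridFun n) (q : Fin n → ℤ) :
    D.coef (D.tdiff U W) q = fun t => (D.coef U q t - D.coef W q t) / D.tau := by
  funext t
  simp only [coef, tdiff]
  rw [← mul_sub, ← Finset.sum_sub_distrib, mul_div_assoc, Finset.sum_div]
  congr 1
  exact Finset.sum_congr rfl fun b _ => by ring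

theorem coef_congr_slab {U W : GridFun n} {t : ℤ} (h : ∀ j ∈ D.slab t, U j = W j)
    (q : Fin n → ℤ) : D.coef U q t = D.coef W q t := by
  rw [coef, coef]
  congr 1
  exact Finset.sum_congr rfl fun b hb => by rw [h _ (D.update_mem_slab hb)]

theorem coef_eq_zero {W : GridFun n} {t : ℤ} (h : ∀ j ∈ D.slab t, W j = 0) (q : Fin n → ℤ) :
    D.coef W q t = 0 := by
  rw [coef, Finset.sum_eq_zero fun b hb => by rw [h _ (D.update_mem_slab hb), zero_mul], mul_zero]

theorem eq_of_sum_mul_sinMode_eq (hJ : ∀ k, 1 ≤ D.J k) {A B : (Fin n → ℤ) → ℂ}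
    (h : ∀ b ∈ D.slab 0, ∑ q ∈ D.slab 0, A q * (D.sinMode q b : ℂ)
      = ∑ q ∈ D.slab 0, B q * (D.sinMode q b : ℂ)) {q : Fin n → ℤ} (hq : q ∈ D.slab 0) :
    A q = B q := by
  have h1 : ∀ b ∈ D.slab 0, ∀ A : (Fin n → ℤ) → ℂ, ∑ q ∈ D.slab 0,
      A q * (D.sinMode q (Function.update b 0 0) : ℂ)
        = ∑ q ∈ D.slab 0, A q * (D.sinMode q b : ℂ) := fun b _ A =>
    Finset.sum_congr rfl fun q _ => by rw [sinMode_update_zero]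
  rw [← D.coef_eq hJ (W := fun b => ∑ q ∈ D.slab 0, A q * (D.sinMode q b : ℂ)) (A := A) (t := 0)
    (fun b hb => h1 b hb A) hq]
  exact D.coef_eq hJ (fun b hb => (h1 b hb A).trans (h b hb)) hq

end

end SplittingData

/-! ### Decoupling of the scheme into one-dimensional modes. -/

namespace SplittingData

noncomputable section

variable {n : ℕ} [NeZero n] (D : SplittingData n)

/-- The assumptions on the data of the problem and of the meshes. -/
structure Admissible : Prop where
  hbar_pos : 0 < D.hbar
  m0_pos : 0 < D.m0
  tau_pos : 0 < D.tau
  X_pos : ∀ k, 0 < D.X k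
  J_pos : ∀ k, 1 ≤ D.J k
  two_le_J : 2 ≤ D.J 0
  X0_le : D.X0 ≤ D.X 0 - D.h 0
  V_eq : ∀ x : Fin n → ℝ, D.X0 ≤ x 0 → (∀ k, k ≠ 0 → 0 < x k ∧ x k < D.X k) → D.V x = D.Vinf
  Vaux_eq : ∀ x₁ : ℝ, D.X0 ≤ x₁ → D.Vaux x₁ = D.Vinf

variable {D}

namespace Admissible

theorem c_pos (hD : D.Admissible) : 0 < D.c :=
  div_pos (pow_pos hD.hbar_pos 2) (mul_pos two_pos hD.m0_pos)

theorem h_pos (hD : D.Admissible) (k : Fin n) : 0 < D.h k :=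
  div_pos (hD.X_pos k) (by exact_mod_cast hD.J_pos k)

theorem J_mul_h (hD : D.Admissible) (k : Fin n) : (D.J k : ℝ) * D.h k = D.X k := by
  have : (D.J k : ℝ) ≠ 0 := by have := hD.J_pos k; positivity
  rw [h]; field_simp

theorem X0_le_mul_h (hD : D.Admissible) {t : ℤ} (ht : (D.J 0 : ℤ) - 1 ≤ t) :
    D.X0 ≤ (t : ℝ) * D.h 0 := by
  have h1 : ((D.J 0 : ℝ) - 1) ≤ t := by exact_mod_cast ht
  have h2 := mul_le_mul_of_nonneg_right h1 (hD.h_pos 0).le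
  have h3 := hD.J_mul_h 0
  have h4 := hD.X0_le
  linarith

/-- The layers `J₁ - 1` and `J₁`, the only ones seen by the boundary condition, lie in `x₁ ≥ X₀`;
the half-steps do nothing there. -/
theorem dV_eq_zero (hD : D.Admissible) {j : Fin n → ℤ} (hj : j ∈ D.slab (j 0))
    (h0 : (D.J 0 : ℤ) - 1 ≤ j 0) : D.dV j = 0 := by
  have h1 := hD.X0_le_mul_h h0
  rw [dV, hD.V_eq (D.node j) h1 fun k hk => ?_, hD.Vaux_eq (D.node j 0) h1, sub_self]
  obtain ⟨h2, h3⟩ := Finset.mem_Icc.mp ((D.mem_slab.mp hj).2 k hk)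
  have h4 := hD.h_pos k
  have h5 : (0 : ℝ) < j k := by exact_mod_cast h2
  have h6 : (j k : ℝ) < D.J k := by exact_mod_cast (by omega : j k < D.J k)
  exact ⟨mul_pos h5 h4, by rw [← hD.J_mul_h]; exact mul_lt_mul_of_pos_right h6 h4⟩

end Admissible

variable (D)

/-- The potential of the one-dimensional problem for the mode `q`. -/
def modePot (q : Fin n → ℤ) (t : ℤ) : ℝ := D.Vaux (t * D.h 0) + D.c * D.lamSum q

theorem Admissible.modePot_eq {D : SplittingData n} (hD : D.Admissible) (q : Fin n → ℤ) {t : ℤ}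
    (ht : (D.J 0 : ℤ) - 1 ≤ t) : D.modePot q t = D.VinfQ q := by
  rw [modePot, hD.Vaux_eq _ (hD.X0_le_mul_h ht), VinfQ_eq]

/-- Both sides are sine expansions with the common factor `sigProd q`, and `Vaux` depends only on
the leading index, so it commutes with the expansion. The equivalence serves stability in one
direction and existence in the other. -/
theorem main_equation_iff (hX : ∀ k, 0 < D.X k) (hJ : ∀ k, 1 ≤ D.J k) {U W F : GridFun n}
    (hU : ∀ j ∈ D.meshGamma, U j = 0) (hW : ∀ j ∈ D.meshGamma, W j = 0) :
    (∀ j ∈ D.meshInner, Complex.I * (D.hbar : ℂ) * sNprod ∅ (D.tdiff U W) j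
      = -(D.c : ℂ) * D.lapN (avg U W) j
        + sNprod ∅ (fun i => (D.Vaux (D.node i 0) : ℂ) * avg U W i) j + F j) ↔
    ∀ t ∈ Finset.Icc (1 : ℤ) ((D.J 0 : ℤ) - 1), ∀ q ∈ D.slab 0,
      StepEq D.hbar D.tau D.c (D.h 0) (D.modePot q) (D.coef U q) (D.coef W q)
        (fun t => D.coef F q t / D.sigProd q) t := by
  have hA : ∀ j ∈ D.meshGamma, avg U W j = 0 := fun j hj => by simp [avg, hU j hj, hW j hj]
  have hT : ∀ j ∈ D.meshGamma, D.tdiff U W j = 0 := fun j hj => by simp [tdiff, hU j hj, hW j hj]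
  have hV : ∀ j ∈ D.meshGamma, (D.Vaux (D.node j 0) : ℂ) * avg U W j = 0 := fun j hj => by
    simp [hA j hj]
  have hcV : ∀ q, D.coef (fun i => (D.Vaux (D.node i 0) : ℂ) * avg U W i) q
      = fun t : ℤ => (D.Vaux (t * D.h 0) : ℂ) * D.coef (avg U W) q t := fun q =>
    D.coef_mul_left (fun t : ℤ => (D.Vaux (t * D.h 0) : ℂ)) (avg U W) q
  have hL : ∀ j ∈ D.meshInner, Complex.I * (D.hbar : ℂ) * sNprod ∅ (D.tdiff U W) j
      = ∑ q ∈ D.slab 0, (D.sigProd q * (Complex.I * (D.hbar : ℂ)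
        * numerov (fun i => (D.coef U q i - D.coef W q i) / (D.tau : ℂ)) (j 0)))
          * (D.sinMode q j : ℂ) := fun j hj => by
    rw [D.sNprod_empty_apply hX hJ hT hj, Finset.mul_sum]
    refine Finset.sum_congr rfl fun q _ => ?_
    rw [coef_tdiff]; ring
  have hR : ∀ j ∈ D.meshInner, -(D.c : ℂ) * D.lapN (avg U W) j
        + sNprod ∅ (fun i => (D.Vaux (D.node i 0) : ℂ) * avg U W i) j + F j
      = ∑ q ∈ D.slab 0, (D.sigProd q *
        (-(D.c : ℂ) * secondDiff (D.h 0) (fun i => (D.coef U q i + D.coef W q i) / 2) (j 0)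
          + numerov (fun i => (D.modePot q i : ℂ) * ((D.coef U q i + D.coef W q i) / 2)) (j 0)
          + D.coef F q (j 0) / D.sigProd q)) * (D.sinMode q j : ℂ) := fun j hj => by
    rw [D.lapN_apply hX hJ hA hj, D.sNprod_empty_apply hX hJ hV hj,
      ← D.sum_coef_mul_sinMode hJ F (D.mem_meshInner_iff.mp hj).2, Finset.mul_sum,
      ← Finset.sum_add_distrib, ← Finset.sum_add_distrib]
    refine Finset.sum_congr rfl fun q _ => ?_
    have hs : (D.sigProd q : ℂ) ≠ 0 := by exact_mod_cast (D.sigProd_pos q).ne'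
    rw [hcV, coef_avg]
    simp only [numerov, modePot]
    push_cast
    field_simp
    ring
  constructor
  · intro h t ht q hq
    have hs : (D.sigProd q : ℂ) ≠ 0 := by exact_mod_cast (D.sigProd_pos q).ne'
    have h1 := D.eq_of_sum_mul_sinMode_eq hJ (A := fun q => D.sigProd q * (Complex.I * (D.hbar : ℂ)
        * numerov (fun i => (D.coef U q i - D.coef W q i) / (D.tau : ℂ)) t))
      (B := fun q => D.sigProd q *
        (-(D.c : ℂ) * secondDiff (D.h 0) (fun i => (D.coef U q i + D.coef W q i) / 2) t
          + numerov (fun i => (D.modePot q i : ℂ) * ((D.coef U q i + D.coef W q i) / 2)) t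
          + D.coef F q t / D.sigProd q)) (fun b hb => ?_) hq
    · exact mul_left_cancel₀ hs h1
    · have hj : Function.update b 0 t ∈ D.meshInner := D.mem_meshInner_iff.mpr
        ⟨by simpa using ht, by rw [Function.update_self]; exact D.update_mem_slab hb⟩
      have h1 := h _ hj
      rw [hL _ hj, hR _ hj] at h1
      simpa only [Function.update_self, sinMode_update_zero] using h1
  · intro h j hj
    rw [hL j hj, hR j hj]
    refine Finset.sum_congr rfl fun q hq => ?_
    congr 2
    exact h (j 0) (D.mem_meshInner_iff.mp hj).1 q hq

theorem tbcLeft_apply (hX : ∀ k, 0 < D.X k) (hJ : ∀ k, 1 ≤ D.J k) {U W : GridFun n}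
    (hU : ∀ j ∈ D.meshGamma, U j = 0) (hW : ∀ j ∈ D.meshGamma, W j = 0) {j : Fin n → ℤ}
    (hj : j ∈ D.slab (D.J 0)) :
    D.tbcLeft U W j = ∑ q ∈ D.slab 0,
      (D.sigProd q * D.modeLeft (D.VinfQ q) (D.J 0) (D.coef U q) (D.coef W q))
        * (D.sinMode q j : ℂ) := by
  have hA : ∀ j ∈ D.meshGamma, avg U W j = 0 := fun j hj => by simp [avg, hU j hj, hW j hj]
  have hT : ∀ j ∈ D.meshGamma, D.tdiff U W j = 0 := fun j hj => by simp [tdiff, hU j hj, hW j hj]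
  have hj0 : j 0 = D.J 0 := (D.mem_slab.mp hj).1
  have hJ0 := hJ 0
  have hinner : ∀ i : Fin n → ℤ, i ∈ D.slab (i 0) → 0 ≤ i 0 → i 0 ≤ D.J 0 →
      ((Complex.I * (D.hbar : ℂ)) • sNprod {0} (D.tdiff U W)
          + ((D.c : ℂ) • (∑ k ∈ perpSet n, sNprod {0, k} (D.fdiff k (D.bdiff k (avg U W))))
              - (D.Vinf : ℂ) • sNprod {0} (avg U W))) i
        = ∑ q ∈ D.slab 0, (D.sigProd q * (Complex.I * (D.hbar : ℂ)
            * ((D.coef U q (i 0) - D.coef W q (i 0)) / (D.tau : ℂ))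
          - (D.VinfQ q : ℂ) * ((D.coef U q (i 0) + D.coef W q (i 0)) / 2)))
            * (D.sinMode q i : ℂ) := by
    intro i hi h0 h1
    simp only [Pi.add_apply, Pi.sub_apply, Pi.smul_apply, smul_eq_mul]
    rw [D.sNprod_zero_apply hX hJ hT hi h0 h1, D.sNprod_zero_apply hX hJ hA hi h0 h1,
      D.sum_sNprod_fdiff_bdiff_apply hX hJ hA hi h0 h1, Finset.mul_sum, Finset.mul_sum,
      Finset.mul_sum, ← Finset.sum_sub_distrib, ← Finset.sum_add_distrib]
    refine Finset.sum_congr rfl fun q _ => ?_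
    rw [coef_avg, coef_tdiff, VinfQ_eq]
    push_cast
    ring
  have hsub : ∀ Z : GridFun n, sNminus Z j
      = (5 / 12 : ℂ) * Z j + (1 / 12 : ℂ) * Z (j - Pi.single 0 1) := fun Z => rfl
  have e0 : (j - Pi.single 0 1 : Fin n → ℤ) 0 = j 0 - 1 := by simp
  have hj' : j ∈ D.slab (j 0) := by rw [hj0]; exact hj
  have hj1 : (j - Pi.single 0 1 : Fin n → ℤ) ∈ D.slab ((j - Pi.single 0 1 : Fin n → ℤ) 0) :=
    D.mem_slab.mpr ⟨rfl, fun k hk => by simpa [hk] using (D.mem_slab.mp hj).2 k hk⟩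
  rw [tbcLeft, Pi.sub_apply, Pi.smul_apply, Pi.smul_apply, smul_eq_mul, smul_eq_mul, hsub,
    hinner j hj' (by omega) (by omega), hinner _ hj1 (by omega) (by omega),
    D.sNprod_bdiff_zero_apply hX hJ hA hj' (by omega) (by omega), Finset.mul_sum, Finset.mul_sum,
    Finset.mul_sum, ← Finset.sum_add_distrib, Finset.mul_sum, ← Finset.sum_sub_distrib]
  refine Finset.sum_congr rfl fun q _ => ?_
  rw [D.sinMode_shift_zero q j (j - Pi.single 0 1) fun k hk => by simp [hk], e0, hj0, coef_avg,
    modeLeft]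
  ring

/-- The same comparison of coefficients on the slab `j₁ = J₁`: the perpendicular differences turn
`V_∞` into `VinfQ q`, the argument of the kernel for that frequency. -/
theorem tbc_iff (hX : ∀ k, 0 < D.X k) (hJ : ∀ k, 1 ≤ D.J k) {U W : ℕ → GridFun n} {m : ℕ}
    (hU : ∀ j ∈ D.meshGamma, U m j = 0) (hW : ∀ j ∈ D.meshGamma, W m j = 0) :
    (∀ j ∈ D.meshGamma1, D.tbcLeft (U m) (W m) j = (D.c : ℂ) * D.Sref m U j) ↔
    ∀ q ∈ D.slab 0, D.ModeTBC (D.VinfQ q) (D.J 0) (fun m => D.coef (U m) q)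
      (fun m => D.coef (W m) q) m := by
  have hR : ∀ j ∈ D.slab (D.J 0), (D.c : ℂ) * D.Sref m U j = ∑ q ∈ D.slab 0,
      (D.sigProd q * ((D.c : ℂ) * ∑ p ∈ Finset.range (m + 1),
        D.kernelR (D.VinfQ q) p * D.coef (U (m - p)) q (D.J 0))) * (D.sinMode q j : ℂ) := by
    intro j hj
    rw [Sref_eq, Finset.mul_sum]
    refine Finset.sum_congr rfl fun q _ => ?_
    rw [(D.mem_slab.mp hj).1]; ring
  rw [meshGamma1_eq]
  constructor
  · intro h q hq
    have hs : (D.sigProd q : ℂ) ≠ 0 := by exact_mod_cast (D.sigProd_pos q).ne'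
    have h1 := D.eq_of_sum_mul_sinMode_eq hJ (A := fun q => D.sigProd q *
        D.modeLeft (D.VinfQ q) (D.J 0) (D.coef (U m) q) (D.coef (W m) q))
      (B := fun q => D.sigProd q * ((D.c : ℂ) * ∑ p ∈ Finset.range (m + 1),
        D.kernelR (D.VinfQ q) p * D.coef (U (m - p)) q (D.J 0))) (fun b hb => ?_) hq
    · exact mul_left_cancel₀ hs h1
    · have hj : Function.update b 0 (D.J 0 : ℤ) ∈ D.slab (D.J 0) := D.update_mem_slab hb
      have h1 := h _ hj
      rw [D.tbcLeft_apply hX hJ hU hW hj, hR _ hj] at h1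
      simpa only [sinMode_update_zero] using h1
  · intro h j hj
    rw [D.tbcLeft_apply hX hJ hU hW hj, hR j hj]
    refine Finset.sum_congr rfl fun q hq => ?_
    congr 2
    exact h q hq

end

end SplittingData

/-! ### Half-steps, mesh norms and stability. -/

theorem Real.sqrt_sum_sq_le_add {ι : Type*} {s : Finset ι} {a b c : ι → ℝ}
    (ha : ∀ i ∈ s, 0 ≤ a i) (h : ∀ i ∈ s, a i ≤ b i + c i) :
    Real.sqrt (∑ i ∈ s, a i ^ 2) ≤ Real.sqrt (∑ i ∈ s, b i ^ 2) + Real.sqrt (∑ i ∈ s, c i ^ 2) := by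
  rw [Real.sqrt_le_left (by positivity), add_sq, Real.sq_sqrt (by positivity),
    Real.sq_sqrt (by positivity)]
  have h1 := Real.sum_mul_le_sqrt_mul_sqrt s b c
  calc ∑ i ∈ s, a i ^ 2 ≤ ∑ i ∈ s, (b i + c i) ^ 2 :=
        Finset.sum_le_sum fun i hi => pow_le_pow_left₀ (ha i hi) (h i hi) 2
    _ = ∑ i ∈ s, b i ^ 2 + 2 * ∑ i ∈ s, b i * c i + ∑ i ∈ s, c i ^ 2 := by
        rw [Finset.mul_sum, ← Finset.sum_add_distrib, ← Finset.sum_add_distrib]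
        exact Finset.sum_congr rfl fun i _ => by ring
    _ ≤ _ := by linarith

namespace SplittingData

noncomputable section

variable {n : ℕ} [NeZero n] (D : SplittingData n)

/-! ### The half-steps in the potential -/

/-- The multiplier of a half-step with the real potential `d`. -/
def cayley (d : ℝ) : ℂ := (Complex.I * D.hbar / (D.tau / 2) + d / 2)
  / (Complex.I * D.hbar / (D.tau / 2) - d / 2)

variable {D}

omit [NeZero n] in
theorem cayley_den_ne_zero (hhbar : 0 < D.hbar) (htau : 0 < D.tau) (d : ℝ) :
    Complex.I * D.hbar / (D.tau / 2) - d / 2 ≠ 0 := by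
  have e1 : Complex.I * D.hbar / (D.tau / 2) - d / 2
      = ((-d / 2 : ℝ) : ℂ) + ((D.hbar / (D.tau / 2) : ℝ) : ℂ) * Complex.I := by push_cast; ring
  rw [e1]
  intro h
  have h1 := congrArg Complex.im h
  rw [Complex.add_im, Complex.ofReal_im, Complex.im_ofReal_mul, Complex.I_im] at h1
  have : 0 < D.hbar / (D.tau / 2) := by positivity
  simp at h1
  rcases h1 with h1 | h1 <;> linarith

omit [NeZero n] in
-- For real `d` the numerator is minus the conjugate of the denominator.
theorem norm_cayley (hhbar : 0 < D.hbar) (htau : 0 < D.tau) (d : ℝ) : ‖D.cayley d‖ = 1 := by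
  have h1 := cayley_den_ne_zero hhbar htau d
  have e1 : Complex.I * D.hbar / (D.tau / 2) + d / 2
      = -conj (Complex.I * D.hbar / (D.tau / 2) - d / 2) := by
    simp only [map_sub, map_div₀, map_mul, Complex.conj_I, Complex.conj_ofReal, map_ofNat]
    ring
  rw [cayley, e1, norm_div, norm_neg, Complex.norm_conj, div_self (norm_ne_zero_iff.mpr h1)]

omit [NeZero n] in
theorem cayley_zero (hhbar : 0 < D.hbar) (htau : 0 < D.tau) : D.cayley 0 = 1 := by
  have h1 := cayley_den_ne_zero hhbar htau 0
  rw [cayley, div_eq_one_iff_eq h1]; simp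

omit [NeZero n] in
theorem half_step_iff (hhbar : 0 < D.hbar) (htau : 0 < D.tau) (d : ℝ) (p w : ℂ) :
    Complex.I * (D.hbar : ℂ) * ((p - w) / ((D.tau : ℂ) / 2)) = (d : ℂ) * ((p + w) / 2) ↔
      p = D.cayley d * w := by
  have h1 := cayley_den_ne_zero hhbar htau d
  rw [cayley, div_mul_eq_mul_div, eq_div_iff h1]
  constructor <;> intro h <;> linear_combination h

/-! ### The mesh norms in terms of Fourier coefficients -/

variable (D)

/-- The weight in the representation of the mesh norms by Fourier coefficients. -/
def normWeight : ℝ := (∏ k, D.h k) * D.modeWeight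

variable {D}

theorem Admissible.normWeight_pos (hD : D.Admissible) : 0 < D.normWeight :=
  mul_pos (Finset.prod_pos fun k _ => hD.h_pos k) (D.modeWeight_pos hD.J_pos)

theorem sum_meshInner_norm_sq (hD : D.Admissible) (W : GridFun n) :
    ∑ j ∈ D.meshInner, ‖W j‖ ^ 2 * ∏ k, D.h k = D.normWeight *
      ∑ q ∈ D.slab 0, ∑ t ∈ Finset.Icc (1 : ℤ) ((D.J 0 : ℤ) - 1), ‖D.coef W q t‖ ^ 2 := by
  rw [← Finset.sum_mul, sum_meshInner, Finset.sum_congr rfl fun t _ => D.sum_norm_sq_slab hD.J_pos W t,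
    ← Finset.mul_sum, Finset.sum_comm, normWeight]
  ring

theorem normInner_eq (hD : D.Admissible) (W : GridFun n) : D.normInner W =
    Real.sqrt (D.normWeight *
      ∑ q ∈ D.slab 0, ∑ t ∈ Finset.Icc (1 : ℤ) ((D.J 0 : ℤ) - 1), ‖D.coef W q t‖ ^ 2) := by
  rw [normInner, sum_meshInner_norm_sq hD]

/-- The full weight `h₁` on `Γ_{1h}` makes the node `J₁` count like an interior one, matching the
sums up to `J` in the energy of a mode. -/
theorem normTilde_sq (hD : D.Admissible) (W : GridFun n) : D.normTilde W ^ 2 =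
    D.normWeight * ∑ q ∈ D.slab 0, ∑ t ∈ Finset.Icc (1 : ℤ) (D.J 0), ‖D.coef W q t‖ ^ 2 := by
  have hh : ∀ k, 0 ≤ D.h k := fun k => (hD.h_pos k).le
  have hprod : (∏ k ∈ perpSet n, D.h k) * D.h 0 = ∏ k, D.h k := by
    have : perpSet n = Finset.univ.erase 0 := by ext k; simp
    rw [this, Finset.prod_erase_mul _ _ (Finset.mem_univ 0)]
  rw [normTilde, Real.sq_sqrt (add_nonneg
    (Finset.sum_nonneg fun j _ => mul_nonneg (by positivity) (Finset.prod_nonneg fun k _ => hh k))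
    (mul_nonneg (Finset.sum_nonneg fun j _ => mul_nonneg (by positivity)
      (Finset.prod_nonneg fun k _ => hh k)) (hh 0))), sum_meshInner_norm_sq hD, ← Finset.sum_mul,
    mul_assoc, hprod, meshGamma1_eq, D.sum_slab (fun j => ‖W j‖ ^ 2) 0 (D.J 0), D.sum_norm_sq_slab hD.J_pos]
  have e1 : ∀ q, ∑ t ∈ Finset.Icc (1 : ℤ) (D.J 0), ‖D.coef W q t‖ ^ 2
      = ∑ t ∈ Finset.Icc (1 : ℤ) ((D.J 0 : ℤ) - 1), ‖D.coef W q t‖ ^ 2 + ‖D.coef W q (D.J 0)‖ ^ 2 := by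
    intro q
    have h2 := hD.two_le_J
    have : Finset.Icc (1 : ℤ) (D.J 0) = insert (D.J 0 : ℤ) (Finset.Icc (1 : ℤ) ((D.J 0 : ℤ) - 1)) := by
      ext t; simp only [Finset.mem_insert, Finset.mem_Icc]; omega
    rw [this, Finset.sum_insert (by simp), add_comm]
  simp only [e1]
  rw [Finset.sum_add_distrib, normWeight]
  ring

theorem normTilde_nonneg (W : GridFun n) : 0 ≤ D.normTilde W := Real.sqrt_nonneg _

theorem normTilde_congr {U W : GridFun n} (h : ∀ j ∈ D.meshInner ∪ D.meshGamma1, ‖U j‖ = ‖W j‖) :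
    D.normTilde U = D.normTilde W := by
  rw [normTilde, normTilde,
    Finset.sum_congr rfl fun j hj => by rw [h j (Finset.mem_union_left _ hj)],
    Finset.sum_congr (s₁ := D.meshGamma1) rfl fun j hj => by rw [h j (Finset.mem_union_right _ hj)]]

/-- Each `σ` is at least `2/3`. There are only `n - 1` factors, and the exponent is rounded up. -/
theorem inv_sigProd_le (q : Fin n → ℤ) : (D.sigProd q)⁻¹ ≤ (3 / 2 : ℝ) ^ n := by
  have h1 : (2 / 3 : ℝ) ^ (perpSet n).card ≤ D.sigProd q := by
    rw [← Finset.prod_const, sigProd]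
    exact Finset.prod_le_prod (fun k _ => by norm_num) fun k _ => D.sig_ge k (q k)
  have h2 : (2 / 3 : ℝ) ^ n ≤ (2 / 3 : ℝ) ^ (perpSet n).card := by
    refine pow_le_pow_of_le_one (by norm_num) (by norm_num) ?_
    exact (Finset.card_filter_le _ _).trans (by simp)
  calc (D.sigProd q)⁻¹ ≤ ((2 / 3 : ℝ) ^ n)⁻¹ := inv_anti₀ (by positivity) (h2.trans h1)
    _ = _ := by rw [← inv_pow]; norm_num

/-! ### Stability -/

theorem mem_meshClosed_cases {j : Fin n → ℤ} (hj : j ∈ D.meshClosed) :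
    j ∈ D.meshInner ∪ D.meshGamma1 ∨ j ∈ D.meshGamma := by
  rw [meshGamma, Finset.mem_sdiff, Finset.mem_sdiff, Finset.mem_union]
  tauto

theorem mem_union_iff (hD : D.Admissible) {j : Fin n → ℤ} :
    j ∈ D.meshInner ∪ D.meshGamma1 ↔ j ∈ D.slab (j 0) ∧ 1 ≤ j 0 ∧ j 0 ≤ D.J 0 := by
  have h2 := hD.two_le_J
  rw [Finset.mem_union, mem_meshInner_iff, meshGamma1_eq, Finset.mem_Icc]
  constructor
  · rintro (⟨h, h1⟩ | h)
    · exact ⟨h1, by omega, by omega⟩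
    · have h0 := (D.mem_slab.mp h).1
      rw [h0]
      exact ⟨h, by omega, le_rfl⟩
  · rintro ⟨h, h0, h1⟩
    rcases h1.eq_or_lt with h1 | h1
    · right; rwa [h1] at h
    · left; exact ⟨by omega, h⟩

namespace IsSolution

variable {P0 : GridFun n} {F Pb Pt P : ℕ → GridFun n}

theorem Pb_eq (hD : D.Admissible) (hs : D.IsSolution P0 F Pb Pt P) (m : ℕ) {j : Fin n → ℤ}
    (hj : j ∈ D.meshInner ∪ D.meshGamma1) : Pb (m + 1) j = D.cayley (D.dV j) * P m j :=
  (half_step_iff hD.hbar_pos hD.tau_pos _ _ _).mp (hs.step1 (m + 1) (by omega) j hj)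

theorem P_eq (hD : D.Admissible) (hs : D.IsSolution P0 F Pb Pt P) (m : ℕ) {j : Fin n → ℤ}
    (hj : j ∈ D.meshInner ∪ D.meshGamma1) : P (m + 1) j = D.cayley (D.dV j) * Pt (m + 1) j :=
  (half_step_iff hD.hbar_pos hD.tau_pos _ _ _).mp (hs.step3 (m + 1) (by omega) j hj)

theorem normTilde_Pb (hD : D.Admissible) (hs : D.IsSolution P0 F Pb Pt P) (m : ℕ) :
    D.normTilde (Pb (m + 1)) = D.normTilde (P m) :=
  normTilde_congr fun j hj => by
    rw [hs.Pb_eq hD m hj, norm_mul, norm_cayley hD.hbar_pos hD.tau_pos, one_mul]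

theorem normTilde_P (hD : D.Admissible) (hs : D.IsSolution P0 F Pb Pt P) (m : ℕ) :
    D.normTilde (P (m + 1)) = D.normTilde (Pt (m + 1)) :=
  normTilde_congr fun j hj => by
    rw [hs.P_eq hD m hj, norm_mul, norm_cayley hD.hbar_pos hD.tau_pos, one_mul]

theorem normTilde_P_zero (hD : D.Admissible) (hs : D.IsSolution P0 F Pb Pt P) :
    D.normTilde (P 0) = D.normTilde P0 :=
  normTilde_congr fun j hj => by
    obtain ⟨h1, h2, h3⟩ := (mem_union_iff hD).mp hj
    rw [hs.initial j (D.mem_meshClosed_of_mem_slab h1 (by omega) h3)]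

/-- Near the boundary both half-steps are trivial, so `Ψ̆` at a level is the previous `Ψ̃`. At the
first level it is zero, since the initial function vanishes there; this matches the zero put in
place of `Pt 0`. -/
theorem Pb_eq_near_boundary (hD : D.Admissible)
    (hP0' : ∀ j ∈ D.meshClosed, j 0 = (D.J 0 : ℤ) - 1 ∨ j 0 = (D.J 0 : ℤ) → P0 j = 0)
    (hs : D.IsSolution P0 F Pb Pt P) (m : ℕ) {t : ℤ} (ht : t = (D.J 0 : ℤ) - 1 ∨ t = (D.J 0 : ℤ))
    {j : Fin n → ℤ} (hj : j ∈ D.slab t) : Pb (m + 1) j = Function.update Pt 0 0 m j := by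
  have h0 := (D.mem_slab.mp hj).1
  subst h0
  have h2 := hD.two_le_J
  have hmem : j ∈ D.meshInner ∪ D.meshGamma1 := (mem_union_iff hD).mpr ⟨hj, by omega, by omega⟩
  have hdV := hD.dV_eq_zero hj (by omega)
  rw [hs.Pb_eq hD m hmem, hdV, cayley_zero hD.hbar_pos hD.tau_pos, one_mul]
  rcases m with _ | m
  · have hc := D.mem_meshClosed_of_mem_slab hj (by omega) (by omega)
    rw [hs.initial j hc, hP0' j hc ht]; simp
  · rw [hs.P_eq hD m hmem, hdV, cayley_zero hD.hbar_pos hD.tau_pos, one_mul]; simp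

/-- The mesh norm alone is not shown to decrease in each step, since energy may return from outside.
`S` adds the tail energies of all modes, which start from zero. -/
theorem exists_energy (hD : D.Admissible)
    (hP0' : ∀ j ∈ D.meshClosed, j 0 = (D.J 0 : ℤ) - 1 ∨ j 0 = (D.J 0 : ℤ) → P0 j = 0)
    (hs : D.IsSolution P0 F Pb Pt P) :
    ∃ S : ℕ → ℝ, S 0 = D.normTilde P0 ∧ (∀ m, D.normTilde (P m) ≤ S m) ∧
      ∀ m, S (m + 1) ≤ S m + 2 / D.hbar * (3 / 2) ^ n * (D.normInner (F (m + 1)) * D.tau) := by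
  have h2 := hD.two_le_J
  set fs : (Fin n → ℤ) → ℕ → ℤ → ℂ := fun q m => D.coef (Function.update Pt 0 0 m) q with hfs
  set gs : (Fin n → ℤ) → ℕ → ℤ → ℂ := fun q m => D.coef (Pb m) q with hgs
  have hfs0 : ∀ q t, fs q 0 t = 0 := fun q t => by
    simp only [hfs, Function.update_self]
    exact D.coef_eq_zero (fun j _ => rfl) q
  have hfsS : ∀ q m, fs q (m + 1) = D.coef (Pt (m + 1)) q := fun q m => by simp [hfs]
  have hex := fun q => ModeTBC.exists_tail_energy D (vinf := D.VinfQ q) (hD.J_pos 0) (f := fs q)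
    (g := gs q) hD.hbar_pos hD.c_pos hD.tau_pos (hD.h_pos 0) ⟨hfs0 q _, hfs0 q _⟩
  choose T hT hT0 henergy using hex
  have hdir : ∀ m, (∀ j ∈ D.meshGamma, Pb (m + 1) j = 0) ∧
      (∀ j ∈ D.meshGamma, Pt (m + 1) j = 0) := fun m =>
    ⟨fun j hj => (hs.dirichlet (m + 1) (by omega) j hj).1,
      fun j hj => (hs.dirichlet (m + 1) (by omega) j hj).2.1⟩
  have hzero : ∀ W : GridFun n, (∀ j ∈ D.meshGamma, W j = 0) → ∀ q, D.coef W q 0 = 0 :=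
    fun W hW q => D.coef_eq_zero (fun j hj => hW j <| by
      have h0 := (D.mem_slab.mp hj).1
      rw [← h0] at hj
      exact D.mem_meshGamma_of_boundary
        (D.mem_meshClosed_of_mem_slab hj (by omega) (by omega)) (Or.inl ⟨h0, by omega⟩)) q
  have hstep : ∀ m, ∀ q ∈ D.slab 0,
      Real.sqrt (∑ j ∈ Finset.Icc (1 : ℤ) (D.J 0), ‖D.coef (Pt (m + 1)) q j‖ ^ 2 + T q (m + 1))
        ≤ Real.sqrt (∑ j ∈ Finset.Icc (1 : ℤ) (D.J 0), ‖D.coef (Pb (m + 1)) q j‖ ^ 2 + T q m)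
          + 3 * D.tau / (2 * D.hbar) * Real.sqrt (∑ j ∈ Finset.Icc (1 : ℤ) ((D.J 0 : ℤ) - 1),
            ‖D.coef (F (m + 1)) q j / D.sigProd q‖ ^ 2) := by
    intro m q hq
    have h1 := henergy q m (D.modePot q) (fun t => D.coef (F (m + 1)) q t / D.sigProd q) ?_
      (fun j hj => hD.modePot_eq q hj) (by rw [hfsS]; exact hzero _ (hdir m).2 q)
      (hzero _ (hdir m).1 q) ?_
    · rwa [hfsS] at h1
    · intro l _
      refine ⟨D.coef_congr_slab (fun j hj =>
        hs.Pb_eq_near_boundary hD hP0' l (Or.inr rfl) hj) q, D.coef_congr_slab (fun j hj =>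
        hs.Pb_eq_near_boundary hD hP0' l (Or.inl rfl) hj) q, ?_⟩
      refine (D.tbc_iff hD.X_pos hD.J_pos (U := Function.update Pt 0 0) (W := Pb) (m := l + 1)
        (by simpa using (hdir l).2) (hdir l).1).mp (fun j hj => ?_) q hq
      have := hs.tbc (l + 1) (by omega) j hj
      simpa using this
    · intro j hj
      rw [hfsS]
      exact (D.main_equation_iff hD.X_pos hD.J_pos (hdir m).2 (hdir m).1).mp
        (hs.step2 (m + 1) (by omega)) j hj q hq
  have hw := hD.normWeight_pos
  have hTs : ∀ m, 0 ≤ ∑ q ∈ D.slab 0, T q m := fun m => Finset.sum_nonneg fun q _ => hT q m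
  refine ⟨fun m => Real.sqrt (D.normTilde (P m) ^ 2 + D.normWeight * ∑ q ∈ D.slab 0, T q m), ?_,
    fun m => ?_, fun m => ?_⟩
  · simp [hT0, hs.normTilde_P_zero hD, Real.sqrt_sq (normTilde_nonneg P0)]
  · refine Real.le_sqrt_of_sq_le ?_
    have := mul_nonneg hw.le (hTs m)
    linarith
  -- The total energy as an `ℓ²` norm over the modes, so that the estimates of the modes add up by
  -- Minkowski's inequality.
  · have hcomb : ∀ (W : GridFun n) (m : ℕ),
        Real.sqrt (D.normTilde W ^ 2 + D.normWeight * ∑ q ∈ D.slab 0, T q m)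
        = Real.sqrt D.normWeight * Real.sqrt (∑ q ∈ D.slab 0, Real.sqrt
          (∑ j ∈ Finset.Icc (1 : ℤ) (D.J 0), ‖D.coef W q j‖ ^ 2 + T q m) ^ 2) := by
      intro W m
      rw [normTilde_sq hD, ← mul_add, ← Finset.sum_add_distrib, Real.sqrt_mul hw.le]
      congr 2
      refine Finset.sum_congr rfl fun q _ => ?_
      rw [Real.sq_sqrt (add_nonneg (by positivity) (hT q m))]
    beta_reduce
    rw [hs.normTilde_P hD m, ← hs.normTilde_Pb hD m, hcomb, hcomb]
    have h1 := Real.sqrt_sum_sq_le_add (fun q _ => Real.sqrt_nonneg _) (hstep m)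
    refine (mul_le_mul_of_nonneg_left h1 (Real.sqrt_nonneg _)).trans ?_
    rw [mul_add]
    refine add_le_add le_rfl ?_
    have h3 : ∀ q ∈ D.slab 0, (3 * D.tau / (2 * D.hbar) * Real.sqrt
        (∑ j ∈ Finset.Icc (1 : ℤ) ((D.J 0 : ℤ) - 1), ‖D.coef (F (m + 1)) q j / D.sigProd q‖ ^ 2)) ^ 2
        ≤ (3 * D.tau / (2 * D.hbar) * (3 / 2) ^ n) ^ 2 *
          ∑ j ∈ Finset.Icc (1 : ℤ) ((D.J 0 : ℤ) - 1), ‖D.coef (F (m + 1)) q j‖ ^ 2 := by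
      intro q _
      rw [mul_pow, mul_pow, Real.sq_sqrt (by positivity), mul_assoc]
      gcongr
      rw [Finset.mul_sum]
      refine Finset.sum_le_sum fun j _ => ?_
      rw [← mul_pow, norm_div, Complex.norm_real, Real.norm_of_nonneg (D.sigProd_pos q).le,
        div_eq_inv_mul]
      have h5 := inv_sigProd_le (D := D) q
      have h6 := (D.sigProd_pos q).le
      gcongr
    have hpos : 0 ≤ 3 * D.tau / (2 * D.hbar) * (3 / 2) ^ n := by
      have := hD.hbar_pos
      have := hD.tau_pos
      positivity
    calc _ ≤ Real.sqrt D.normWeight * Real.sqrt ((3 * D.tau / (2 * D.hbar) * (3 / 2) ^ n) ^ 2 *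
          ∑ q ∈ D.slab 0, ∑ j ∈ Finset.Icc (1 : ℤ) ((D.J 0 : ℤ) - 1),
            ‖D.coef (F (m + 1)) q j‖ ^ 2) := by
          gcongr
          rw [Finset.mul_sum]
          exact Finset.sum_le_sum h3
      _ = (3 * D.tau / (2 * D.hbar) * (3 / 2) ^ n) * D.normInner (F (m + 1)) := by
          rw [normInner_eq hD, Real.sqrt_mul (by positivity), Real.sqrt_sq hpos,
            Real.sqrt_mul hw.le]
          ring
      -- The argument yields the constant `3/2` in place of the `2` claimed.
      _ ≤ _ := by
          have h4 : 0 ≤ D.normInner (F (m + 1)) := Real.sqrt_nonneg _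
          have h5 : 0 ≤ (3 / 2 : ℝ) ^ n * D.normInner (F (m + 1)) * (D.tau / D.hbar) := by
            have := hD.hbar_pos
            have := hD.tau_pos
            positivity
          have e1 : 3 * D.tau / (2 * D.hbar) * (3 / 2) ^ n * D.normInner (F (m + 1))
              = 3 / 2 * ((3 / 2 : ℝ) ^ n * D.normInner (F (m + 1)) * (D.tau / D.hbar)) := by ring
          have e2 : 2 / D.hbar * (3 / 2) ^ n * (D.normInner (F (m + 1)) * D.tau)
              = 2 * ((3 / 2 : ℝ) ^ n * D.normInner (F (m + 1)) * (D.tau / D.hbar)) := by ring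
          rw [e1, e2]
          linarith

theorem normTilde_le (hD : D.Admissible)
    (hP0' : ∀ j ∈ D.meshClosed, j 0 = (D.J 0 : ℤ) - 1 ∨ j 0 = (D.J 0 : ℤ) → P0 j = 0)
    (hs : D.IsSolution P0 F Pb Pt P) (m : ℕ) : D.normTilde (P m) ≤ D.normTilde P0
      + 2 / D.hbar * (3 / 2) ^ n * ∑ l ∈ Finset.Icc 1 m, D.normInner (F l) * D.tau := by
  obtain ⟨S, hS0, hS, hstep⟩ := hs.exists_energy hD hP0'
  refine (hS m).trans ?_
  clear hS
  induction m with
  | zero => simp [hS0]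
  | succ m ih =>
    rw [Finset.sum_Icc_succ_top (by omega), mul_add]
    linarith [hstep m]

end IsSolution

end

end SplittingData

/-! ### Existence and uniqueness. -/

/-- A sequence can be built step by step if each step is possible for every history. -/
theorem exists_seq_of_forall_history {α : Type*} [Inhabited α] {Good : ℕ → (ℕ → α) → α → Prop}
    (h : ∀ m hist, ∃ x, Good m hist x) :
    ∃ s : ℕ → α, ∀ m, Good m (fun p => if p < m then s p else default) (s m) := by
  choose step hstep using h
  let s : ℕ → α := fun m => Nat.strongRec (motive := fun _ => α)
    (fun m ih => step m fun p => if hp : p < m then ih p hp else default) m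
  have hs : ∀ m, s m = step m fun p => if p < m then s p else default := by
    intro m
    change Nat.strongRec (motive := fun _ => α) _ m = _
    rw [Nat.strongRec_eq]
    rfl
  refine ⟨s, fun m => ?_⟩
  have h1 := hstep m fun p => if p < m then s p else default
  rwa [← hs m] at h1

namespace SplittingData

noncomputable section

variable {n : ℕ} [NeZero n] (D : SplittingData n)

/-- A half-step in the potential, for the functions vanishing outside `ω_h ∪ Γ_{1h}`. -/
def halfStep (W : GridFun n) : GridFun n := fun j =>
  if j ∈ D.meshInner ∪ D.meshGamma1 then D.cayley (D.dV j) * W j else 0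

theorem halfStep_of_mem (W : GridFun n) {j : Fin n → ℤ} (hj : j ∈ D.meshInner ∪ D.meshGamma1) :
    D.halfStep W j = D.cayley (D.dV j) * W j := if_pos hj

theorem halfStep_of_mem_meshGamma (W : GridFun n) {j : Fin n → ℤ} (hj : j ∈ D.meshGamma) :
    D.halfStep W j = 0 := by
  refine if_neg fun h => ?_
  rw [meshGamma, Finset.mem_sdiff, Finset.mem_sdiff] at hj
  rcases Finset.mem_union.mp h with h | h
  · exact hj.1.2 h
  · exact hj.2 h

theorem Sref_congr {m : ℕ} {Φ Φ' : ℕ → GridFun n} (h : ∀ l ≤ m, Φ l = Φ' l) :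
    D.Sref m Φ = D.Sref m Φ' := by
  funext j
  rw [Sref_eq, Sref_eq]
  refine Finset.sum_congr rfl fun q _ => ?_
  congr 2
  exact Finset.sum_congr rfl fun p _ => by rw [h (m - p) (Nat.sub_le m p)]

variable {D}

/-- Solvability of the scheme at one time level. -/
theorem exists_level (hD : D.Admissible) {m : ℕ} (hm : 1 ≤ m) (hist : ℕ → GridFun n)
    {W : GridFun n} (hW : ∀ j ∈ D.meshGamma, W j = 0) (F : GridFun n) :
    ∃ x : GridFun n, (∀ j ∈ D.meshGamma, x j = 0) ∧
      (∀ j ∈ D.meshInner, Complex.I * (D.hbar : ℂ) * sNprod ∅ (D.tdiff x W) j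
        = -(D.c : ℂ) * D.lapN (avg x W) j
          + sNprod ∅ (fun i => (D.Vaux (D.node i 0) : ℂ) * avg x W i) j + F j) ∧
      ∀ j ∈ D.meshGamma1, D.tbcLeft x W j
        = (D.c : ℂ) * D.Sref m (Function.update (Function.update hist m x) 0 0) j := by
  have h2 := hD.two_le_J
  have hex := fun q => D.exists_mode_step (hD.J_pos 0) hD.hbar_pos hD.c_pos hD.tau_pos (hD.h_pos 0)
    (v := D.modePot q) (fun j hj => hD.modePot_eq q hj) (D.coef W q)
    (fun t => D.coef F q t / D.sigProd q)
    -- The part of the convolution known from earlier levels; the term `p = 0` belongs to the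
    -- unknown.
    (∑ p ∈ Finset.range m, D.kernelR (D.VinfQ q) (p + 1)
      * D.coef (Function.update hist 0 0 (m - (p + 1))) q (D.J 0))
  choose f hf0 hfeq hftbc using hex
  set x : GridFun n := fun j => ∑ q ∈ D.slab 0, f q (j 0) * (D.sinMode q j : ℂ) with hx
  have hcoef : ∀ q ∈ D.slab 0, D.coef x q = f q := fun q hq => by
    funext t
    refine D.coef_eq hD.J_pos (A := fun q => f q t) (fun b _ => ?_) hq
    simp only [hx, Function.update_self, sinMode_update_zero]
  have hxΓ : ∀ j ∈ D.meshGamma, x j = 0 := by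
    intro j hj
    refine Finset.sum_eq_zero fun q _ => ?_
    rw [meshGamma, Finset.mem_sdiff, Finset.mem_sdiff] at hj
    have hc := D.mem_meshClosed_iff.mp hj.1.1 0
    by_cases hs : j ∈ D.slab (j 0)
    · have h0 : j 0 = 0 := by
        by_contra h0
        rcases Finset.mem_union.mp ((mem_union_iff hD).mpr ⟨hs, by omega, hc.2⟩) with h | h
        · exact hj.1.2 h
        · exact hj.2 h
      rw [h0, hf0, zero_mul]
    · obtain ⟨k, hk, h1⟩ := D.exists_boundary_index hj.1.1 hs
      have := hD.J_pos k
      rw [D.sinMode_eq_zero hk (by omega) h1]; simp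
  refine ⟨x, hxΓ, ?_, ?_⟩
  · refine (D.main_equation_iff hD.X_pos hD.J_pos hxΓ hW).mpr fun t ht q hq => ?_
    rw [hcoef q hq]
    exact hfeq q t ht
  · have hUm : Function.update (Function.update hist m x) 0 0 m = x := by
      rw [Function.update_of_ne (by omega), Function.update_self]
    have key := (D.tbc_iff hD.X_pos hD.J_pos (U := Function.update (Function.update hist m x) 0 0)
      (W := fun _ => W) (m := m) (by rw [hUm]; exact hxΓ) hW).mpr fun q hq => ?_
    · rwa [hUm] at key
    · rw [ModeTBC, hUm, hcoef q hq, hftbc, Finset.sum_range_succ', Nat.sub_zero, hUm, hcoef q hq,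
        add_comm]
      congr 2
      refine Finset.sum_congr rfl fun p hp => ?_
      have hp' := Finset.mem_range.mp hp
      congr 2
      by_cases h0 : m - (p + 1) = 0
      · rw [h0, Function.update_self, Function.update_self]
      · rw [Function.update_of_ne h0, Function.update_of_ne h0, Function.update_of_ne (by omega)]

theorem exists_isSolution (hD : D.Admissible) (P0 : GridFun n) (F : ℕ → GridFun n) :
    ∃ Pb Pt P : ℕ → GridFun n, D.IsSolution P0 F Pb Pt P := by
  -- `s m` is `Ψ̃` at level `m + 1`. Only the functions `Ψ̃` are built recursively, as the
  -- half-steps determine the rest.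
  obtain ⟨s, hs⟩ := exists_seq_of_forall_history fun (m : ℕ) (hist : ℕ → GridFun n) =>
    exists_level hD (m := m + 1) (by omega)
      (fun p => if p = 0 then 0 else hist (p - 1))
      (fun j hj => D.halfStep_of_mem_meshGamma
        (if m = 0 then P0 else D.halfStep (hist (m - 1))) hj) (F (m + 1))
  let Pt : ℕ → GridFun n := fun m => if m = 0 then 0 else s (m - 1)
  let P : ℕ → GridFun n := fun m => if m = 0 then P0 else D.halfStep (Pt m)
  let Pb : ℕ → GridFun n := fun m => D.halfStep (P (m - 1))
  have hP0 : P 0 = P0 := rfl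
  have hPS : ∀ m, P (m + 1) = D.halfStep (Pt (m + 1)) := fun m => rfl
  have hPb : ∀ m, Pb (m + 1) = D.halfStep (P m) := fun m => rfl
  have hPt : ∀ m, Pt (m + 1) = s m := fun m => rfl
  have hW : ∀ m, D.halfStep (if m = 0 then P0 else
      D.halfStep (if m - 1 < m then s (m - 1) else default)) = Pb (m + 1) := by
    intro m
    rw [hPb]
    rcases m with _ | m
    · rfl
    · rw [hPS, hPt, if_neg (by omega), if_pos (by omega), Nat.add_sub_cancel]
  refine ⟨Pb, Pt, P, ?_⟩
  constructor
  · intro m hm j hj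
    obtain ⟨m, rfl⟩ : ∃ l, m = l + 1 := ⟨m - 1, by omega⟩
    rw [half_step_iff hD.hbar_pos hD.tau_pos]
    exact D.halfStep_of_mem _ hj
  · intro m hm
    obtain ⟨m, rfl⟩ : ∃ l, m = l + 1 := ⟨m - 1, by omega⟩
    have h1 := (hs m).2.1
    rw [hW] at h1
    exact h1
  · intro m hm j hj
    obtain ⟨m, rfl⟩ : ∃ l, m = l + 1 := ⟨m - 1, by omega⟩
    rw [half_step_iff hD.hbar_pos hD.tau_pos]
    exact D.halfStep_of_mem _ hj
  · intro m hm j hj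
    obtain ⟨m, rfl⟩ : ∃ l, m = l + 1 := ⟨m - 1, by omega⟩
    exact ⟨D.halfStep_of_mem_meshGamma _ hj, (hs m).1 j hj, D.halfStep_of_mem_meshGamma _ hj⟩
  · intro m hm j hj
    obtain ⟨m, rfl⟩ : ∃ l, m = l + 1 := ⟨m - 1, by omega⟩
    have h1 := (hs m).2.2 j hj
    rw [hW] at h1
    rw [hPt, h1]
    congr 1
    -- The boundary operator at level `m + 1` sees only levels up to `m + 1`, where the truncated
    -- history agrees with `Pt`.
    refine congrFun (D.Sref_congr fun l hl => ?_) j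
    rcases l with _ | l
    · simp
    · rw [Function.update_of_ne (Nat.succ_ne_zero l), Function.update_of_ne (Nat.succ_ne_zero l), hPt]
      rcases (Nat.le_of_lt_succ (Nat.lt_succ_of_le hl)).eq_or_lt with h | h
      · obtain rfl : l = m := by omega
        rw [Function.update_self]
      · rw [Function.update_of_ne (fun h' => by omega)]
        simp only
        rw [if_neg (by omega), if_pos (by omega)]
        rfl
  · intro j _
    rfl

theorem Sref_sub (m : ℕ) (Φ Φ' : ℕ → GridFun n) (j : Fin n → ℤ) :
    D.Sref m (Φ - Φ') j = D.Sref m Φ j - D.Sref m Φ' j := by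
  have h1 : ∀ (U W : GridFun n) q t, D.coef (U - W) q t = D.coef U q t - D.coef W q t := by
    intro U W q t
    rw [coef, coef, coef, ← mul_sub, ← Finset.sum_sub_distrib]
    congr 1
    exact Finset.sum_congr rfl fun b _ => by rw [Pi.sub_apply, sub_mul]
  rw [Sref_eq, Sref_eq, Sref_eq, ← Finset.sum_sub_distrib]
  refine Finset.sum_congr rfl fun q _ => ?_
  rw [← sub_mul, ← mul_sub, ← Finset.sum_sub_distrib]
  congr 2
  refine Finset.sum_congr rfl fun p _ => ?_
  rw [Pi.sub_apply, h1, mul_sub]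

omit [NeZero n] in
theorem avg_sub (U U' W W' : GridFun n) : avg (U - U') (W - W') = avg U W - avg U' W' := by
  funext j; simp only [avg, Pi.sub_apply]; ring

omit [NeZero n] in
theorem tdiff_sub (U U' W W' : GridFun n) :
    D.tdiff (U - U') (W - W') = D.tdiff U W - D.tdiff U' W' := by
  funext j; simp only [tdiff, Pi.sub_apply]; ring

theorem tbcLeft_sub (U U' W W' : GridFun n) (j : Fin n → ℤ) :
    D.tbcLeft (U - U') (W - W') j = D.tbcLeft U W j - D.tbcLeft U' W' j := by
  rw [← Pi.sub_apply]
  refine congrFun ?_ j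
  simp only [tbcLeft, avg_sub, tdiff_sub, map_sub, map_add, map_smul, Finset.sum_sub_distrib]
  module

theorem IsSolution.sub {P0 : GridFun n} {F Pb Pt P Pb' Pt' P' : ℕ → GridFun n}
    (hs : D.IsSolution P0 F Pb Pt P) (hs' : D.IsSolution P0 F Pb' Pt' P') :
    D.IsSolution 0 0 (Pb - Pb') (Pt - Pt') (P - P') where
  step1 m hm j hj := by
    have h1 := hs.step1 m hm j hj
    have h2 := hs'.step1 m hm j hj
    simp only [Pi.sub_apply]
    linear_combination h1 - h2
  step2 m hm j hj := by
    have h1 := hs.step2 m hm j hj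
    have h2 := hs'.step2 m hm j hj
    have e1 : (fun i => (D.Vaux (D.node i 0) : ℂ) * (avg (Pt m) (Pb m) - avg (Pt' m) (Pb' m)) i)
      = (fun i => (D.Vaux (D.node i 0) : ℂ) * avg (Pt m) (Pb m) i)
        - fun i => (D.Vaux (D.node i 0) : ℂ) * avg (Pt' m) (Pb' m) i := by
      funext i; simp only [Pi.sub_apply]; ring
    rw [Pi.sub_apply, Pi.sub_apply, avg_sub, tdiff_sub, e1, map_sub, map_sub, map_sub]
    simp only [Pi.sub_apply, Pi.zero_apply]
    linear_combination h1 - h2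
  step3 m hm j hj := by
    have h1 := hs.step3 m hm j hj
    have h2 := hs'.step3 m hm j hj
    simp only [Pi.sub_apply]
    linear_combination h1 - h2
  dirichlet m hm j hj := by
    obtain ⟨h1, h2, h3⟩ := hs.dirichlet m hm j hj
    obtain ⟨h4, h5, h6⟩ := hs'.dirichlet m hm j hj
    simp [h1, h2, h3, h4, h5, h6]
  tbc m hm j hj := by
    have h1 := hs.tbc m hm j hj
    have h2 := hs'.tbc m hm j hj
    have e1 : Function.update (Pt - Pt') 0 0 = Function.update Pt 0 0 - Function.update Pt' 0 0 := by
      funext l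
      rcases l with _ | l
      · simp
      · simp [Function.update_of_ne]
    rw [Pi.sub_apply, Pi.sub_apply, tbcLeft_sub, e1, Sref_sub, h1, h2, mul_sub]
  initial j hj := by
    simp [hs.initial j hj, hs'.initial j hj]

theorem eq_zero_of_normTilde_eq_zero (hD : D.Admissible) {W : GridFun n} (h : D.normTilde W = 0) :
    ∀ j ∈ D.meshInner ∪ D.meshGamma1, W j = 0 := by
  have h1 := normTilde_sq hD W
  rw [h, zero_pow two_ne_zero, zero_eq_mul] at h1
  have h2 := h1.resolve_left hD.normWeight_pos.ne'
  rw [Finset.sum_eq_zero_iff_of_nonneg fun q _ => by positivity] at h2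
  intro j hj
  obtain ⟨hj1, hj2, hj3⟩ := (mem_union_iff hD).mp hj
  rw [← D.sum_coef_mul_sinMode hD.J_pos W hj1]
  refine Finset.sum_eq_zero fun q hq => ?_
  have h3 := h2 q hq
  rw [Finset.sum_eq_zero_iff_of_nonneg fun q _ => by positivity] at h3
  have h4 := h3 (j 0) (Finset.mem_Icc.mpr ⟨hj2, hj3⟩)
  rw [pow_eq_zero_iff two_ne_zero, norm_eq_zero] at h4
  rw [h4, zero_mul]

/-- Stability controls only `P`. The auxiliary functions follow because the half-steps multiply by
nonzero numbers, and on `Γ_h` from the Dirichlet conditions. -/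
theorem IsSolution.eq_zero (hD : D.Admissible) {Pb Pt P : ℕ → GridFun n}
    (hs : D.IsSolution 0 0 Pb Pt P) {j : Fin n → ℤ} (hj : j ∈ D.meshClosed) :
    (∀ m, P m j = 0) ∧ ∀ m ≥ 1, Pb m j = 0 ∧ Pt m j = 0 := by
  have hn0 : D.normTilde (0 : GridFun n) = 0 := by simp [normTilde]
  have hI0 : D.normInner (0 : GridFun n) = 0 := by simp [normInner]
  have hP : ∀ m, ∀ i ∈ D.meshInner ∪ D.meshGamma1, P m i = 0 := fun m => by
    refine eq_zero_of_normTilde_eq_zero hD (le_antisymm ?_ (normTilde_nonneg _))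
    have h1 := hs.normTilde_le hD (fun _ _ _ => rfl) m
    rw [show (fun _ => 0 : GridFun n) = 0 from rfl, hn0, Finset.sum_eq_zero fun l _ => by
      rw [show (0 : ℕ → GridFun n) l = 0 from rfl, hI0, zero_mul]] at h1
    simpa using h1
  rcases mem_meshClosed_cases hj with h | h
  · refine ⟨fun m => hP m j h, fun m hm => ?_⟩
    obtain ⟨m, rfl⟩ : ∃ l, m = l + 1 := ⟨m - 1, by omega⟩
    refine ⟨by rw [hs.Pb_eq hD m h, hP m j h, mul_zero], ?_⟩
    have h1 := hs.P_eq hD m h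
    rw [hP (m + 1) j h, zero_eq_mul] at h1
    refine h1.resolve_left fun h2 => ?_
    have h3 := norm_cayley hD.hbar_pos hD.tau_pos (D.dV j)
    rw [h2, norm_zero] at h3
    exact zero_ne_one h3
  · refine ⟨fun m => ?_, fun m hm => ⟨(hs.dirichlet m hm j h).1, (hs.dirichlet m hm j h).2.1⟩⟩
    rcases m with _ | m
    · exact hs.initial j hj
    · exact (hs.dirichlet (m + 1) (by omega) j h).2.2

end

end SplittingData

theorem mainTheorem3 (n : ℕ) [NeZero n] (hn : 2 ≤ n) (D : SplittingData n)
    (hhbar : 0 < D.hbar) (hm0 : 0 < D.m0) (htau : 0 < D.tau)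
    (hX : ∀ k, 0 < D.X k) (hJ : ∀ k, 1 ≤ D.J k)
    (hX0 : 0 < D.X0) (hX01 : D.X0 < D.X 0) (hh : 2 * D.h 0 ≤ D.X 0 - D.X0)
    (hV : ∀ x : Fin n → ℝ, D.X0 ≤ x 0 → (∀ k, k ≠ 0 → 0 < x k ∧ x k < D.X k) → D.V x = D.Vinf)
    (hVaux : ∀ x₁ : ℝ, D.X0 ≤ x₁ → D.Vaux x₁ = D.Vinf)
    (P0 : GridFun n) (hP0 : ∀ j ∈ D.meshGamma, P0 j = 0)
    (hP0' : ∀ j ∈ D.meshClosed, j 0 = (D.J 0 : ℤ) - 1 ∨ j 0 = (D.J 0 : ℤ) → P0 j = 0)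
    (F : ℕ → GridFun n) :
    -- a solution exists
    (∃ Pb Pt P : ℕ → GridFun n, D.IsSolution P0 F Pb Pt P) ∧
    -- it is unique as a triple of mesh functions
    (∀ Pb Pt P Pb' Pt' P' : ℕ → GridFun n,
      D.IsSolution P0 F Pb Pt P → D.IsSolution P0 F Pb' Pt' P' →
        ∀ j ∈ D.meshClosed,
          (∀ m, P m j = P' m j) ∧ ∀ m ≥ 1, Pb m j = Pb' m j ∧ Pt m j = Pt' m j) ∧
    -- it satisfies the stability bound
    (∀ Pb Pt P : ℕ → GridFun n, D.IsSolution P0 F Pb Pt P →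
      ∀ M ≥ 1, ∀ m ≤ M,
        D.normTilde (P m) ≤ D.normTilde P0
          + 2 / D.hbar * (3 / 2) ^ n * ∑ l ∈ Finset.Icc 1 M, D.normInner (F l) * D.tau) ∧
    -- for a zero free term the norm never exceeds its initial value
    (∀ Pb Pt P : ℕ → GridFun n, D.IsSolution P0 F Pb Pt P →
      (∀ m ≥ 1, ∀ j ∈ D.meshInner, F m j = 0) →
        ∀ m, D.normTilde (P m) ≤ D.normTilde P0) := by
  have hh0 : 0 < D.h 0 := div_pos (hX 0) (by exact_mod_cast hJ 0)
  have hD : D.Admissible :=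
    { hbar_pos := hhbar
      m0_pos := hm0
      tau_pos := htau
      X_pos := hX
      J_pos := hJ
      -- With `J₁ = 1` the mesh step would be `X₁`, contradicting `2 h₁ ≤ X₁ - X₀`.
      two_le_J := by
        by_contra hc
        have h1 : D.J 0 = 1 := by have := hJ 0; omega
        have h2 : D.h 0 = D.X 0 := by rw [SplittingData.h, h1]; simp
        linarith
      X0_le := by linarith
      V_eq := hV
      Vaux_eq := hVaux }
  refine ⟨SplittingData.exists_isSolution hD P0 F, ?_, ?_, ?_⟩
  · intro Pb Pt P Pb' Pt' P' hs hs' j hj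
    obtain ⟨h1, h2⟩ := (hs.sub hs').eq_zero hD hj
    exact ⟨fun m => sub_eq_zero.mp (h1 m), fun m hm =>
      ⟨sub_eq_zero.mp (h2 m hm).1, sub_eq_zero.mp (h2 m hm).2⟩⟩
  · intro Pb Pt P hs M _ m hmM
    refine (hs.normTilde_le hD hP0' m).trans ?_
    have h1 : ∑ l ∈ Finset.Icc 1 m, D.normInner (F l) * D.tau
        ≤ ∑ l ∈ Finset.Icc 1 M, D.normInner (F l) * D.tau :=
      Finset.sum_le_sum_of_subset_of_nonneg (Finset.Icc_subset_Icc_right hmM) fun l _ _ =>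
        mul_nonneg (Real.sqrt_nonneg _) htau.le
    gcongr
  · intro Pb Pt P hs hF m
    refine (hs.normTilde_le hD hP0' m).trans (le_of_eq ?_)
    have h1 : ∀ l ∈ Finset.Icc 1 m, D.normInner (F l) * D.tau = 0 := fun l hl => by
      have : D.normInner (F l) = 0 := by
        rw [SplittingData.normInner, Finset.sum_eq_zero fun j hj => by
          rw [hF l (Finset.mem_Icc.mp hl).1 j hj]; simp]
        simp
      rw [this, zero_mul]
    rw [Finset.sum_eq_zero h1]; simp
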